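/- Graphs are finite and may have loops and parallel edges. A circle is a connected $2$-regular graph. A cutpoint of a graph $G$ is a vertex $v$ such that $G=H_1\cup H_2$ for subgraphs $H_1,H_2$, each with at least one edge, with $H_1\cap H_2=\{v\}$; a block is a connected graph without cutpoint. Let $(B,\sigma)$ be a signed graph, i.e. $\sigma:E(B)\to\{+,-\}$, where $B$ is a block that is not a circle. Let $C$ be a circle in $B$ (so $B$ is not an isthmus either) and let $e$ be an edge of $C$. The sign of a circle is the product of the signs of its edges. Write $[e,C,-]$ if $C$ is negative and is the only negative circle of $B$ containing $e$; write $[e,C,+]$ if $C$ is positive and is the only positive circle of $B$ containing $e$. A chord of $C$ is an edge outside $C$ that connects two different vertices of $C$. A bridge of $C$ is either a chord of $C$ (with its endpoints), or a connected component $K$ of $B\setminus V(C)$ together with all edges joining $K$ to $C$ (and their endpoints). The vertices of attachment of a bridge $D$ are the vertices in $V(D)\cap V(C)$. A path through $D$ is a path contained in $D$ whose endpoints are two different vertices of attachment of $D$. The two halves of $C$ for such a path are the two paths in $C$ with the same endpoints. In any graph containing $C$: two chords $c_1,c_2$ of $C$ cross if $C\cup c_1\cup c_2$ is a subdivision of $K_4$.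 The endpoints of the chords divide $C$ into paths called segments. A handle is a segment whose two endpoints are joined by a chord. $C$ is $2$-handled if no two of its chords cross and it has exactly two handles. $B$ is $C$-layered if every bridge of $C$ in $B$ has exactly two vertices of attachment and $C$ is $2$-handled in the graph $C^*$ that is obtained from $C\subseteq B$ by replacing each bridge with a single chord between its two vertices of attachment; the handles of $C$ are then the handles of $C$ in $C^*$. A balancing edge is an edge $b$ of $B$ for which there is $\zeta:V(B)\to\{+,-\}$ such that $b$ is the only negative edge under the signature $f\mapsto\zeta(v)\sigma(f)\zeta(w)$, where $v,w$ are the endpoints of $f$. Theorem. $[e,C,-]$ or $[e,C,+]$ holds if and only if $B$ is $C$-layered, $e$ is contained in a handle of $C$, and at least one of the following holds: 1. the handle of $C$ not containing $e$ contains a balancing edge; 2. every path through a bridge of $C$ makes a negative circle with either half of $C$. More precisely, $[e,C,-]$ holds if and only if $B$ is $C$-layered, $e$ is contained in a handle of $C$, and (1) holds; and $[e,C,+]$ holds if and only if $B$ is $C$-layered, $e$ is contained in a handle of $C$, and (2) holds. -/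

import Mathlib

open scoped Graph

namespace Graph

/-! ### Basic notions for multigraphs (loops and parallel edges allowed) -/

/-- The degree of a vertex; a loop counts twice. -/
noncomputable def degree {α β : Type*} (G : Graph α β) (x : α) : ℕ∞ :=
  (G.incidenceSet x).encard + (G.loopSet x).encard

/-- A graph is connected if it has a vertex and any two vertices are joined by a chain of
adjacent vertices. -/
def IsConnected {α β : Type*} (G : Graph α β) : Prop :=
  V(G).Nonempty ∧ ∀ x ∈ V(G), ∀ y ∈ V(G), Relation.ReflTransGen G.Adj x y

/-- A circle: a connected `2`-regular graph. -/
def IsCircle {α β : Type*} (C : Graph α β) : Prop :=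
  C.IsConnected ∧ ∀ x ∈ V(C), C.degree x = 2

/-- A connected component: a maximal connected subgraph. -/
def IsComponent {α β : Type*} (G K : Graph α β) : Prop :=
  Maximal (fun L : Graph α β => L ≤ G ∧ L.IsConnected) K

/-- `K` is the union of its subgraphs `H₁` and `H₂`. -/
def IsUnion {α β : Type*} (K H₁ H₂ : Graph α β) : Prop :=
  H₁ ≤ K ∧ H₂ ≤ K ∧ V(K) = V(H₁) ∪ V(H₂) ∧ E(K) = E(H₁) ∪ E(H₂)

/-- A cutpoint `v` of `G`: `G` is the union of two subgraphs, each with at least one edge, whose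
intersection consists of the vertex `v` only. -/
def IsCutpoint {α β : Type*} (G : Graph α β) (v : α) : Prop :=
  ∃ H₁ H₂ : Graph α β, G.IsUnion H₁ H₂ ∧ E(H₁).Nonempty ∧ E(H₂).Nonempty ∧
    V(H₁) ∩ V(H₂) = {v} ∧ E(H₁) ∩ E(H₂) = ∅

/-- A graph that is a block (of itself): it is connected and has no cutpoint. -/
def IsBlock {α β : Type*} (G : Graph α β) : Prop :=
  G.IsConnected ∧ ∀ v, ¬ G.IsCutpoint v

/-- A path `v₀, e₀, v₁, …, eₙ₋₁, vₙ` in `G` without repeated vertices (hence also without repeated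
edges). -/
structure VPath {α β : Type*} (G : Graph α β) where
  length : ℕ
  vert : Fin (length + 1) → α
  edge : Fin length → β
  vert_mem : ∀ i, vert i ∈ V(G)
  isLink : ∀ i : Fin length, G.IsLink (edge i) (vert i.castSucc) (vert i.succ)
  vert_injective : Function.Injective vert

namespace VPath

/-- The first vertex of a path. -/
def first {α β : Type*} {G : Graph α β} (P : G.VPath) : α := P.vert 0

/-- The last vertex of a path. -/
def last {α β : Type*} {G : Graph α β} (P : G.VPath) : α := P.vert (Fin.last P.length)

/-- The subgraph formed by the vertices and edges of a path. -/
def toGraph {α β : Type*} {G : Graph α β} (P : G.VPath) : Graph α β where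
  vertexSet := Set.range P.vert
  edgeSet := Set.range P.edge
  IsLink f x y := f ∈ Set.range P.edge ∧ G.IsLink f x y
  isLink_symm _ _ := ⟨fun _ _ h => ⟨h.1, h.2.symm⟩⟩
  eq_or_eq_of_isLink_of_isLink _ _ _ _ _ h h' := h.2.left_eq_or_eq h'.2
  edge_mem_iff_exists_isLink f := by
    constructor
    · rintro ⟨i, rfl⟩
      exact ⟨_, _, ⟨i, rfl⟩, P.isLink i⟩
    · rintro ⟨_, _, h, _⟩
      exact h
  left_mem_of_isLink := by
    rintro _ x y ⟨⟨i, rfl⟩, h⟩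
    rcases h.left_eq_or_eq (P.isLink i) with h | h
    · exact ⟨_, h.symm⟩
    · exact ⟨_, h.symm⟩

end VPath

/-! ### Chords, crossing chords, segments, handles -/

/-- `K` is a subdivision of the complete graph `K₄`: there are four distinct branch vertices, and
`K` is the union of paths `P i j` (`i < j`), one between each two branch vertices, such that two
different ones of these paths meet at most in common endpoints. -/
def IsK4Subdivision {α β : Type*} (K : Graph α β) : Prop :=
  ∃ (b : Fin 4 → α) (P : Fin 4 → Fin 4 → K.VPath),
    Function.Injective b ∧
    (∀ i j, i < j → (P i j).first = b i ∧ (P i j).last = b j) ∧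
    (∀ i j k l, i < j → k < l → (i, j) ≠ (k, l) →
      V((P i j).toGraph) ∩ V((P k l).toGraph) ⊆ {b i, b j} ∩ {b k, b l}) ∧
    (∀ x ∈ V(K), ∃ i j, i < j ∧ x ∈ V((P i j).toGraph)) ∧
    (∀ f ∈ E(K), ∃ i j, i < j ∧ f ∈ E((P i j).toGraph))

/-- A chord of the circle `C` in `G`: an edge of `G` outside `C` that connects two different
vertices of `C`. -/
def IsChord {α β : Type*} (G C : Graph α β) (c : β) : Prop :=
  c ∈ E(G) ∧ c ∉ E(C) ∧ ∃ x ∈ V(C), ∃ y ∈ V(C), x ≠ y ∧ G.IsLink c x y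

/-- Two chords `c₁`, `c₂` of `C` cross if `C ∪ c₁ ∪ c₂` is a subdivision of `K₄`. -/
def ChordsCross {α β : Type*} (G C : Graph α β) (c₁ c₂ : β) : Prop :=
  ∃ K : Graph α β, K ≤ G ∧ V(K) = V(C) ∧ E(K) = E(C) ∪ {c₁, c₂} ∧ K.IsK4Subdivision

/-- The vertices of `C` that are endpoints of some chord of `C`. -/
def chordEnds {α β : Type*} (G C : Graph α β) : Set α :=
  {x | x ∈ V(C) ∧ ∃ c, G.IsChord C c ∧ G.Inc c x}

/-- `S` is (the subgraph formed by) a path in `C` from `x` to `y` with at least one edge such that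
`x` and `y` are endpoints of chords of `C` and no interior vertex is. -/
def IsSegmentBetween {α β : Type*} (G C S : Graph α β) (x y : α) : Prop :=
  ∃ P : C.VPath, P.toGraph = S ∧ 0 < P.length ∧ P.first = x ∧ P.last = y ∧
    x ∈ G.chordEnds C ∧ y ∈ G.chordEnds C ∧
    ∀ i, P.vert i ∈ G.chordEnds C → i = 0 ∨ i = Fin.last P.length

/-- A handle of `C` in `G`: a segment of `C` whose endpoints have a chord between them. -/
def IsHandle {α β : Type*} (G C H : Graph α β) : Prop :=
  ∃ x y, G.IsSegmentBetween C H x y ∧ ∃ c, G.IsChord C c ∧ G.IsLink c x y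

/-- `C` is `2`-handled in `G`: any two of its chords are noncrossing, and it has exactly two
handles. -/
def IsTwoHandled {α β : Type*} (G C : Graph α β) : Prop :=
  (∀ c₁ c₂, G.IsChord C c₁ → G.IsChord C c₂ → ¬ G.ChordsCross C c₁ c₂) ∧
    {H : Graph α β | G.IsHandle C H}.encard = 2

/-! ### Bridges and layering -/

/-- A bridge of `C` in `G`: either a chord of `C` (with its two endpoints), or a connected component
`K` of `G ∖ V(C)` along with all edges joining `K` to `C` (and the endpoints of these edges). -/
def IsBridge {α β : Type*} (G C D : Graph α β) : Prop :=
  D ≤ G ∧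
    ((∃ c, G.IsChord C c ∧ E(D) = {c} ∧ V(D) = {x | G.Inc c x}) ∨
      ∃ K : Graph α β, (G.deleteVerts V(C)).IsComponent K ∧
        E(D) = {f | ∃ x ∈ V(K), G.Inc f x} ∧
        V(D) = V(K) ∪ {y | ∃ f, (∃ x ∈ V(K), G.Inc f x) ∧ G.Inc f y})

/-- The vertices of attachment of a bridge `D` of `C`. -/
def attachments {α β : Type*} (C D : Graph α β) : Set α := V(D) ∩ V(C)

/-- The graph `G` with its edges relabelled along `Sum.inl`. -/
def inlEdges {α β : Type*} (γ : Type*) (G : Graph α β) : Graph α (β ⊕ γ) where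
  vertexSet := V(G)
  IsLink f x y := ∃ g, f = Sum.inl g ∧ G.IsLink g x y
  isLink_symm := by
    rintro f -
    exact ⟨fun x y ⟨g, hf, h⟩ => ⟨g, hf, h.symm⟩⟩
  eq_or_eq_of_isLink_of_isLink := by
    rintro _ x y v w ⟨g, rfl, h⟩ ⟨g', hg, h'⟩
    obtain rfl := Sum.inl_injective hg
    exact h.left_eq_or_eq h'
  left_mem_of_isLink := by
    rintro _ x y ⟨g, -, h⟩
    exact h.left_mem

/-- The reduced graph `C*`: the circle `C` (edges `Sum.inl f`) together with, for each bridge `D`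
of `C` in `G` with exactly two vertices of attachment `x`, `y`, one chord `Sum.inr D` between
`x` and `y`. -/
def reduced {α β : Type*} (G C : Graph α β) : Graph α (β ⊕ Graph α β) where
  vertexSet := V(C)
  IsLink f x y := (∃ g, f = Sum.inl g ∧ C.IsLink g x y) ∨
    ∃ D, f = Sum.inr D ∧ G.IsBridge C D ∧ x ≠ y ∧ C.attachments D = {x, y}
  isLink_symm := by
    rintro f -
    refine ⟨?_⟩
    rintro x y (⟨g, hf, h⟩ | ⟨D, hf, hD, hne, h⟩)
    · exact Or.inl ⟨g, hf, h.symm⟩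
    · exact Or.inr ⟨D, hf, hD, hne.symm, by rw [h, Set.pair_comm]⟩
  eq_or_eq_of_isLink_of_isLink := by
    rintro _ x y v w (⟨g, rfl, h⟩ | ⟨D, rfl, -, -, h⟩) (⟨g', hg, h'⟩ | ⟨D', hD, -, -, h'⟩)
    · obtain rfl := Sum.inl_injective hg
      exact h.left_eq_or_eq h'
    · cases hD
    · cases hg
    · obtain rfl := Sum.inr_injective hD
      have hx : x ∈ ({v, w} : Set α) := by
        rw [← h', h]
        exact Set.mem_insert _ _
      simpa using hx
  left_mem_of_isLink := by
    rintro _ x y (⟨g, -, h⟩ | ⟨D, -, -, -, h⟩)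
    · exact h.left_mem
    · have hx : x ∈ C.attachments D := by
        rw [h]
        exact Set.mem_insert _ _
      exact hx.2

/-- The circle `C`, as a subgraph of the reduced graph `C*`. -/
def circleInReduced {α β : Type*} (C : Graph α β) : Graph α (β ⊕ Graph α β) :=
  C.inlEdges (Graph α β)

/-- `H` is a handle of `C` with respect to the reduced graph `C*`. -/
def IsReducedHandle {α β : Type*} (G C : Graph α β) (H : Graph α (β ⊕ Graph α β)) : Prop :=
  (G.reduced C).IsHandle C.circleInReduced H

/-- `G` is `C`-layered: every bridge of `C` has exactly two vertices of attachment, and the circle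
`C` is `2`-handled in the reduced graph `C*`. -/
def IsLayered {α β : Type*} (G C : Graph α β) : Prop :=
  (∀ D, G.IsBridge C D → (C.attachments D).encard = 2) ∧
    (G.reduced C).IsTwoHandled C.circleInReduced

/-! ### Signed graphs -/

/-- The sign of a (finite) subgraph: the product of the signs of its edges. -/
noncomputable def sign {α β : Type*} (C : Graph α β) (σ : β → ℤˣ) : ℤˣ :=
  ∏ᶠ f ∈ E(C), σ f

/-- `[e, C, s]`: the circle `C` of `G` has sign `s`, contains `e`, and is the only circle of
`G` of sign `s` that contains `e`. -/
def IsBatteryIn {α β : Type*} (G : Graph α β) (σ : β → ℤˣ) (e : β) (C : Graph α β) (s : ℤˣ) :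
    Prop :=
  (C ≤ G ∧ C.IsCircle ∧ C.sign σ = s ∧ e ∈ E(C)) ∧
    ∀ Z : Graph α β, Z ≤ G → Z.IsCircle → Z.sign σ = s → e ∈ E(Z) → Z = C

/-- A balancing edge `b` of `(G, σ)`: some switching of `σ` makes `b` the only negative edge. -/
def IsBalancingEdge {α β : Type*} (G : Graph α β) (σ : β → ℤˣ) (b : β) : Prop :=
  b ∈ E(G) ∧ ∃ ζ : α → ℤˣ, ∀ f x y, G.IsLink f x y → (ζ x * σ f * ζ y = -1 ↔ f = b)

/-- `e` lies in a handle of `C`, and the other handle of `C` contains a balancing edge. -/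
def OtherHandleBalancing {α β : Type*} (G : Graph α β) (σ : β → ℤˣ) (C : Graph α β) (e : β) :
    Prop :=
  ∃ H H', G.IsReducedHandle C H ∧ G.IsReducedHandle C H' ∧ H ≠ H' ∧ Sum.inl e ∈ E(H) ∧
    ∃ b, Sum.inl b ∈ E(H') ∧ G.IsBalancingEdge σ b

/-- Every path `P` through a bridge `D` of `C` (a path in `D` whose endpoints are different vertices
of attachment) makes a negative circle with either half of `C` (either path `Q` in `C` with the
same endpoints as `P`). -/
def BridgePathsNegative {α β : Type*} (G : Graph α β) (σ : β → ℤˣ) (C : Graph α β) : Prop :=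
  ∀ D, G.IsBridge C D → ∀ P : D.VPath,
    P.first ∈ C.attachments D → P.last ∈ C.attachments D → P.first ≠ P.last →
    ∀ Q : C.VPath, Q.first = P.first → Q.last = P.last →
      ∃ Z, Z ≤ G ∧ Z.IsUnion P.toGraph Q.toGraph ∧ Z.IsCircle ∧ Z.sign σ = -1

end Graph

/-!
# Edges in a unique negative or a unique positive circle of a signed block

Number the vertices of `C` as `v 0, …, v n` so that `e` closes the path from `v 0` to `v n`
(`Graph.IsCyc`). A bridge attached to `C` at exactly `v i` and `v j`, `i < j`, *spans* the arc from
`v i` to `v j`, which avoids `e`. The combinatorial core is `Graph.IsNested`: every bridge has exactly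
two vertices of attachment, and the spanned arcs form a chain under inclusion.

*Nested is the same as layered with `e` in a handle.* In a chain of arcs the innermost arc and the
complement of the outermost one are the only handles (`Graph.IsNested.exists_handles`), and `e` lies
in the latter. Chords with interleaved spans form a subdivision of `K₄` with `C`
(`Graph.Span.chordsCross`), whereas for nested spans a cut with two edges rules this out
(`Graph.Span.not_chordsCross`). Two disjoint noncrossing spans would each contain a handle besides
the one through `e`, giving three (`Graph.isNested_of_handles`).

*Uniqueness implies nestedness.* Suppose that `C` is the only circle of its sign through `e`.
Replacing a spanned arc by a path through the bridge gives another circle through `e`, so the path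
and the arc have opposite signs (`Graph.IsSignUnique.edgeSign_jump`). This is inconsistent for the
three paths of a tripod in a bridge with three attachments, and two paths with crossing or
consecutive spans yield a circle through `e` in which the two changes of sign cancel
(`Graph.IsSignUnique.not_jumps`). Hence `Graph.IsSignUnique.isNested`.

*Balancing edges.* Let `C` be negative and let every bridge path have the sign opposite to that of
the arc it spans. Switch so that a chosen edge of the innermost arc is the only negative edge of `C`.
The switching function then extends over each bridge by adding ears one at a time: any two vertices
reached so far in a bridge are linked by disjoint paths to different attachments, which determines
the sign of a new ear (`Graph.IsBlock.isBalancingEdge`). So the chosen edge is balancing. Conversely,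
if an edge of the innermost arc is balancing, the negative circles are those through it. The two ends
of a span separate the spanned arc, the bridge, and the rest of the graph, and a circle can change
only twice between these parts; so a circle through `e` and an edge of the innermost arc uses no
bridge and equals `C` (`Graph.IsNested.edge_notMem`, `Graph.IsNested.eq_of_mem`).

*The positive case.* Reversing the sign of `e` interchanges negative and positive circles through `e`
and turns the condition that bridge paths form negative circles with both halves of `C` into the
situation of the preceding paragraph (`Graph.IsNested.isBalancingEdge_update`).
-/

namespace Graph

section

/-! ### Paths with prescribed vertex and edge sets -/

/-- `G.IsPath x y X F`: there is a path in `G` from `x` to `y` without repeated vertices whose vertex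
set is `X` and whose edge set is `F`. -/
inductive IsPath {α β : Type*} (G : Graph α β) : α → α → Set α → Set β → Prop
  | nil {x : α} : x ∈ V(G) → IsPath G x x {x} ∅
  | cons {f : β} {x y z : α} {X : Set α} {F : Set β} :
      G.IsLink f x y → x ∉ X → IsPath G y z X F → IsPath G x z (insert x X) (insert f F)

variable {α β : Type*} {G H : Graph α β} {x y z w : α} {X X₁ X₂ W : Set α} {F F₁ F₂ : Set β} {f : β}

namespace IsPath

theorem left_mem (h : G.IsPath x y X F) : x ∈ X := by
  cases h <;> simp

theorem right_mem (h : G.IsPath x y X F) : y ∈ X := by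
  induction h with
  | nil => simp
  | cons _ _ _ ih => exact Or.inr ih

theorem subset_vertexSet (h : G.IsPath x y X F) : X ⊆ V(G) := by
  induction h with
  | nil hx => simpa using hx
  | cons hl _ _ ih => exact Set.insert_subset hl.left_mem ih

theorem subset_edgeSet (h : G.IsPath x y X F) : F ⊆ E(G) := by
  induction h with
  | nil hx => simp
  | cons hl _ _ ih => exact Set.insert_subset hl.edge_mem ih

theorem finite_edges (h : G.IsPath x y X F) : F.Finite := by
  induction h with
  | nil hx => simp
  | cons hl _ _ ih => exact ih.insert _

theorem exists_ends (h : G.IsPath x y X F) (hf : f ∈ F) :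
    ∃ u v, u ≠ v ∧ u ∈ X ∧ v ∈ X ∧ G.IsLink f u v := by
  induction h with
  | nil hx => simp at hf
  | @cons g x y z X F hl hx hp ih =>
    rcases hf with rfl | hf
    · refine ⟨x, y, ?_, by simp, Or.inr hp.left_mem, hl⟩
      rintro rfl
      exact hx hp.left_mem
    · obtain ⟨u, v, h1, h2, h3, h4⟩ := ih hf
      exact ⟨u, v, h1, Or.inr h2, Or.inr h3, h4⟩

theorem inc_mem (h : G.IsPath x y X F) (hf : f ∈ F) (hw : G.Inc f w) : w ∈ X := by
  obtain ⟨u, v, h1, h2, h3, h4⟩ := h.exists_ends hf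
  rcases hw.eq_or_eq_of_isLink h4 with rfl | rfl <;> assumption

theorem mono (hGH : G ≤ H) (h : G.IsPath x y X F) : H.IsPath x y X F := by
  induction h with
  | nil hx => exact .nil (hGH.1 hx)
  | cons hl hx _ ih => exact .cons (hl.mono hGH) hx ih

/-- A path of `H` all of whose vertices and edges lie in a subgraph `G` is a path of `G`. -/
theorem of_le (hGH : G ≤ H) (h : H.IsPath x y X F) (hX : X ⊆ V(G)) (hF : F ⊆ E(G)) :
    G.IsPath x y X F := by
  induction h with
  | nil hx => exact .nil (hX rfl)
  | @cons f x y z X F hl hx _ ih =>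
    refine .cons ?_ hx (ih (fun _ h => hX (Or.inr h)) (fun _ h => hF (Or.inr h)))
    exact (IsSubgraph.isLink_iff hGH (hF (Or.inl rfl))).2 hl

theorem snoc (h : G.IsPath x y X F) (hl : G.IsLink f y z) (hz : z ∉ X) :
    G.IsPath x z (insert z X) (insert f F) := by
  induction h with
  | @nil x hx =>
    have := IsPath.cons (f := f) hl (X := {z}) (F := ∅) (by simpa [eq_comm] using hz)
      (.nil hl.right_mem)
    rwa [Set.pair_comm] at this
  | @cons g x y' y X F hl' hx hp ih =>
    have := IsPath.cons (f := g) hl' (X := insert z X) (F := insert f F)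
      (by
        rintro (rfl | h)
        · exact hz (Or.inl rfl)
        · exact hx h) (ih hl (fun h => hz (Or.inr h)))
    rwa [Set.insert_comm, Set.insert_comm g] at this

theorem symm (h : G.IsPath x y X F) : G.IsPath y x X F := by
  induction h with
  | nil hx => exact .nil hx
  | cons hl hx _ ih => exact ih.snoc hl.symm hx

theorem concat (h₁ : G.IsPath x y X₁ F₁) (h₂ : G.IsPath y z X₂ F₂) (h : X₁ ∩ X₂ ⊆ {y}) :
    G.IsPath x z (X₁ ∪ X₂) (F₁ ∪ F₂) := by
  induction h₁ with
  | @nil x hx =>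
    rw [Set.empty_union, Set.singleton_union, Set.insert_eq_of_mem h₂.left_mem]
    exact h₂
  | @cons g x y' y X F hl' hx hp ih =>
    rw [Set.insert_union, Set.insert_union]
    refine .cons hl' ?_ (ih h₂ fun w hw => h ⟨Or.inr hw.1, hw.2⟩)
    rintro (h1 | h1)
    · exact hx h1
    · have : x = y := h ⟨Or.inl rfl, h1⟩
      subst this
      exact hx hp.right_mem

theorem edges_disjoint (h₁ : G.IsPath x y X₁ F₁) {x' y' : α} (h₂ : G.IsPath x' y' X₂ F₂)
    (h : (X₁ ∩ X₂).Subsingleton) : Disjoint F₁ F₂ := by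
  rw [Set.disjoint_left]
  intro f hf hf'
  obtain ⟨u, v, huv, hu, hv, hl⟩ := h₁.exists_ends hf
  exact huv (h ⟨hu, h₂.inc_mem hf' hl.inc_left⟩ ⟨hv, h₂.inc_mem hf' hl.inc_right⟩)

theorem eq_singleton (h : G.IsPath x x X F) : X = {x} ∧ F = ∅ := by
  cases h with
  | nil => simp
  | cons hl hx hp => exact absurd hp.right_mem hx

theorem split (h : G.IsPath x y X F) (hz : z ∈ X) :
    ∃ X₁ F₁ X₂ F₂, G.IsPath x z X₁ F₁ ∧ G.IsPath z y X₂ F₂ ∧ X₁ ∩ X₂ = {z} ∧ X = X₁ ∪ X₂ ∧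
      F = F₁ ∪ F₂ := by
  induction h with
  | @nil x hx =>
    obtain rfl : z = x := hz
    exact ⟨_, _, _, _, .nil hx, .nil hx, by simp, by simp, by simp⟩
  | @cons g x y' y X F hl hx hp ih =>
    by_cases hzx : z = x
    · subst hzx
      exact ⟨{z}, ∅, _, _, .nil hl.left_mem, .cons hl hx hp, by simp, by simp, by simp⟩
    · obtain ⟨X₁, F₁, X₂, F₂, h1, h2, h3, rfl, rfl⟩ := ih (hz.resolve_left hzx)
      refine ⟨insert x X₁, insert g F₁, X₂, F₂, .cons hl (fun h => hx (Or.inl h)) h1, h2, ?_,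
        by rw [Set.insert_union], by rw [Set.insert_union]⟩
      rw [Set.insert_inter_of_notMem (fun h => hx (Or.inr h)), h3]

/-- The initial part of a path up to its first vertex in `W`. -/
theorem first_hit (h : G.IsPath x y X F) (hy : y ∈ W) :
    ∃ z X' F', z ∈ W ∧ G.IsPath x z X' F' ∧ X' ⊆ X ∧ F' ⊆ F ∧ X' ∩ W = {z} := by
  induction h with
  | @nil x hx => exact ⟨x, {x}, ∅, hy, .nil hx, le_rfl, le_rfl, by simpa using hy⟩
  | @cons g x y' y X F hl hx hp ih =>
    by_cases hxW : x ∈ W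
    · exact ⟨x, {x}, ∅, hxW, .nil hl.left_mem, by simp, by simp, by simpa using hxW⟩
    · obtain ⟨z, X', F', h1, h2, h3, h4, h5⟩ := ih hy
      refine ⟨z, insert x X', insert g F', h1, .cons hl (fun h => hx (h3 h)) h2,
        Set.insert_subset_insert h3, Set.insert_subset_insert h4, ?_⟩
      rw [Set.insert_inter_of_notMem hxW, h5]

end IsPath

/-- A chain of adjacent vertices all of which lie in `S` can be shortened to a path in `S`. -/
theorem exists_isPath_of_reflTransGen {r : α → α → Prop} (S : Set α)
    (hr : ∀ a b, r a b → G.Adj a b ∧ a ∈ S) (h : Relation.ReflTransGen r x y)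
    (hyV : y ∈ V(G)) (hyS : y ∈ S) :
    ∃ X F, G.IsPath x y X F ∧ X ⊆ S := by
  induction h using Relation.ReflTransGen.head_induction_on with
  | refl => exact ⟨_, _, .nil hyV, by simpa using hyS⟩
  | @head a b hab hb ih =>
    obtain ⟨X, F, hp, hXS⟩ := ih
    obtain ⟨⟨g, hg⟩, haS⟩ := hr a b hab
    by_cases ha : a ∈ X
    · obtain ⟨X₁, F₁, X₂, F₂, h1, h2, h3, rfl, rfl⟩ := hp.split ha
      exact ⟨_, _, h2, fun _ h => hXS (Or.inr h)⟩
    · exact ⟨_, _, .cons hg ha hp, Set.insert_subset haS hXS⟩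

theorem IsConnected.exists_isPath (h : G.IsConnected) (hx : x ∈ V(G)) (hy : y ∈ V(G)) :
    ∃ X F, G.IsPath x y X F := by
  obtain ⟨X, F, hp, -⟩ := exists_isPath_of_reflTransGen (G := G) Set.univ (fun _ _ h => ⟨h, trivial⟩)
    (h.2 x hx y hy) hy trivial
  exact ⟨X, F, hp⟩

/-! ### Conversion between `IsPath` and `VPath` -/

theorem IsPath.exists_vPath (h : G.IsPath x y X F) :
    ∃ P : G.VPath, P.first = x ∧ P.last = y ∧ V(P.toGraph) = X ∧ E(P.toGraph) = F := by
  induction h with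
  | @nil x hx =>
    refine ⟨⟨0, fun _ => x, Fin.elim0, fun _ => hx, fun i => i.elim0, ?_⟩, rfl, rfl, ?_, ?_⟩
    · intro i j _
      exact Subsingleton.elim (α := Fin 1) i j
    · simp [VPath.toGraph]
    · simp [VPath.toGraph]
  | @cons g x y z X F hl hx hp ih =>
    obtain ⟨P, h1, h2, h3, h4⟩ := ih
    refine ⟨⟨P.length + 1, Fin.cons x P.vert, Fin.cons g P.edge, ?_, ?_, ?_⟩, ?_, ?_, ?_, ?_⟩
    · intro i
      refine Fin.cases ?_ (fun i => ?_) i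
      · exact hl.left_mem
      · exact P.vert_mem i
    · intro i
      refine Fin.cases ?_ (fun i => ?_) i
      · have : P.vert 0 = y := h1
        simpa [this] using hl
      · simpa using P.isLink i
    · rw [Fin.cons_injective_iff]
      exact ⟨by rw [← h3] at hx; exact hx, P.vert_injective⟩
    · rfl
    · rw [← h2]; rfl
    · change Set.range (Fin.cons x P.vert) = _
      rw [Fin.range_cons, ← h3]; rfl
    · change Set.range (Fin.cons g P.edge) = _
      rw [Fin.range_cons, ← h4]; rfl

theorem isPath_of_fin (n : ℕ) (vert : Fin (n + 1) → α) (edge : Fin n → β)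
    (hv : ∀ i, vert i ∈ V(G)) (hl : ∀ i : Fin n, G.IsLink (edge i) (vert i.castSucc) (vert i.succ))
    (hi : Function.Injective vert) :
    G.IsPath (vert 0) (vert (Fin.last n)) (Set.range vert) (Set.range edge) := by
  induction n with
  | zero =>
    have h1 : Set.range vert = {vert 0} := by
      ext w
      constructor
      · rintro ⟨i, rfl⟩
        rw [Subsingleton.elim (α := Fin 1) i 0]; rfl
      · rintro rfl
        exact ⟨0, rfl⟩
    rw [h1, Set.range_eq_empty edge]
    exact .nil (hv 0)
  | succ n ih =>
    have h := ih (Fin.tail vert) (Fin.tail edge) (fun i => hv _) (fun i => hl i.succ)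
      (hi.comp (Fin.succ_injective _))
    have h1 : Set.range vert = insert (vert 0) (Set.range (Fin.tail vert)) := by
      rw [← Fin.range_cons, Fin.cons_self_tail]
    have h2 : Set.range edge = insert (edge 0) (Set.range (Fin.tail edge)) := by
      rw [← Fin.range_cons, Fin.cons_self_tail]
    rw [h1, h2]
    refine .cons (hl 0) ?_ h
    rintro ⟨i, hi'⟩
    exact absurd (hi hi') (Fin.succ_ne_zero i)

theorem VPath.isPath (P : G.VPath) : G.IsPath P.first P.last V(P.toGraph) E(P.toGraph) :=
  isPath_of_fin P.length P.vert P.edge P.vert_mem P.isLink P.vert_injective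

theorem VPath.toGraph_le (P : G.VPath) : P.toGraph ≤ G :=
  ⟨by rintro _ ⟨i, rfl⟩; exact P.vert_mem i, fun _ _ _ h => h.2⟩

/-- The path as a sequence indexed by natural numbers. The edge `e₀` only serves as a value of the
edge sequence outside its range. -/
theorem IsPath.exists_seq (h : G.IsPath x y X F) (e₀ : β) :
    ∃ (n : ℕ) (v : ℕ → α) (ε : ℕ → β), v 0 = x ∧ v n = y ∧ Set.InjOn v (Set.Iic n) ∧
      (∀ i < n, G.IsLink (ε i) (v i) (v (i + 1))) ∧ X = v '' Set.Iic n ∧ F = ε '' Set.Iio n := by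
  induction h with
  | @nil x hx =>
    refine ⟨0, fun _ => x, fun _ => e₀, rfl, rfl, ?_, by simp, ?_, ?_⟩
    · intro i hi j hj _
      simp only [Set.mem_Iic, Nat.le_zero] at hi hj
      omega
    · ext; simp [eq_comm]
    · ext; simp
  | @cons g x y z X F hl hx hp ih =>
    obtain ⟨n, v, ε, h0, hn, hinj, hlink, hX, hF⟩ := ih
    refine ⟨n + 1, fun i => Nat.casesOn i x v, fun i => Nat.casesOn i g ε, rfl, hn, ?_, ?_, ?_, ?_⟩
    · rintro (_ | i) hi (_ | j) hj hij
      · rfl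
      · exact absurd (hX ▸ ⟨j, by simpa using hj, hij.symm⟩ : x ∈ X) hx
      · exact absurd (hX ▸ ⟨i, by simpa using hi, hij⟩ : x ∈ X) hx
      · rw [hinj (by simpa using hi) (by simpa using hj) hij]
    · rintro (_ | i) hi
      · simpa [h0] using hl
      · exact hlink i (by omega)
    · ext w
      constructor
      · rintro (rfl | hw)
        · exact ⟨0, by simp, rfl⟩
        · rw [hX] at hw
          obtain ⟨i, hi, rfl⟩ := hw
          exact ⟨i + 1, by simpa using hi, rfl⟩
      · rintro ⟨_ | i, hi, rfl⟩
        · exact Or.inl rfl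
        · right; rw [hX]; exact ⟨i, by simpa using hi, rfl⟩
    · ext w
      constructor
      · rintro (rfl | hw)
        · exact ⟨0, by simp, rfl⟩
        · rw [hF] at hw
          obtain ⟨i, hi, rfl⟩ := hw
          exact ⟨i + 1, by simpa using hi, rfl⟩
      · rintro ⟨_ | i, hi, rfl⟩
        · exact Or.inl rfl
        · right; rw [hF]; exact ⟨i, by simpa using hi, rfl⟩

/-! ### Subgraphs with prescribed vertex and edge sets -/

/-- Two subgraphs of the same graph are equal if they have the same vertices and edges. -/
theorem eq_of_le_le {K : Graph α β} (hG : G ≤ K) (hH : H ≤ K) (hV : V(G) = V(H))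
    (hE : E(G) = E(H)) : G = H :=
  Compatible.ext hV hE (.of_le_le hG hH)

theorem exists_subgraph (hX : X ⊆ V(G)) (hF : F ⊆ E(G))
    (hinc : ∀ f ∈ F, ∀ w, G.Inc f w → w ∈ X) :
    ∃ K, K ≤ G ∧ V(K) = X ∧ E(K) = F := by
  refine ⟨(G.induce X).restrict F, restrict_le.trans (induce_le hX), rfl, ?_⟩
  ext f
  constructor
  · intro hf
    obtain ⟨a, b, hab⟩ := exists_isLink_of_mem_edgeSet hf
    exact ((restrict_inc (G := G.induce X)).1 hab.inc_left).2
  · intro hf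
    obtain ⟨a, b, hab⟩ := exists_isLink_of_mem_edgeSet (hF hf)
    have h1 : (G.induce X).IsLink f a b := ⟨hab, hinc f hf a hab.inc_left, hinc f hf b hab.inc_right⟩
    obtain ⟨c, hc⟩ : ((G.induce X).restrict F).Inc f a := restrict_inc.2 ⟨h1.inc_left, hf⟩
    exact hc.edge_mem

/-! ### Circles as paths closed up by an edge -/

/-- The edges of a path at its vertices: two at an interior vertex, one at an end. -/
theorem IsPath.degrees (h : G.IsPath x y X F) :
    (∀ w ∈ X, w ≠ x → w ≠ y → ∃ f g, f ≠ g ∧ ∀ k, k ∈ F ∧ G.Inc k w ↔ k = f ∨ k = g) ∧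
    (x ≠ y → (∃ f, ∀ k, k ∈ F ∧ G.Inc k x ↔ k = f) ∧ (∃ f, ∀ k, k ∈ F ∧ G.Inc k y ↔ k = f)) := by
  induction h with
  | @nil x hx => simp
  | @cons g x y z X F hl hx hp ih =>
    have hgF : g ∉ F := fun hg => hx (hp.inc_mem hg hl.inc_left)
    have hxF : ∀ k ∈ F, ¬ G.Inc k x := fun k hk hi => hx (hp.inc_mem hk hi)
    have hxy : x ≠ y := by rintro rfl; exact hx hp.left_mem
    have hxz : x ≠ z := by rintro rfl; exact hx hp.right_mem
    have hg : ∀ w, G.Inc g w ↔ w = x ∨ w = y := fun w =>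
      ⟨fun h => h.eq_or_eq_of_isLink hl, by
        rintro (rfl | rfl)
        exacts [hl.inc_left, hl.inc_right]⟩
    refine ⟨?_, fun _ => ⟨⟨g, ?_⟩, ?_⟩⟩
    · rintro w hw hwx hwz
      have hwX := hw.resolve_left hwx
      by_cases hwy : w = y
      · subst hwy
        obtain ⟨f, hf⟩ := (ih.2 hwz).1
        refine ⟨g, f, ?_, fun k => ?_⟩
        · rintro rfl
          exact hgF ((hf g).2 rfl).1
        · rw [← hf k]
          constructor
          · rintro ⟨rfl | h1, h2⟩
            exacts [Or.inl rfl, Or.inr ⟨h1, h2⟩]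
          · rintro (rfl | h)
            exacts [⟨Or.inl rfl, hl.inc_right⟩, ⟨Or.inr h.1, h.2⟩]
      · obtain ⟨f, f', hne, hf⟩ := ih.1 w hwX hwy hwz
        refine ⟨f, f', hne, fun k => ?_⟩
        rw [← hf k]
        constructor
        · rintro ⟨rfl | h1, h2⟩
          · rw [hg] at h2; tauto
          · exact ⟨h1, h2⟩
        · rintro h
          exact ⟨Or.inr h.1, h.2⟩
    · intro k
      constructor
      · rintro ⟨rfl | h1, h2⟩
        · rfl
        · exact absurd h2 (hxF k h1)
      · rintro rfl
        exact ⟨Or.inl rfl, hl.inc_left⟩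
    · by_cases hyz : y = z
      · subst hyz
        obtain ⟨-, rfl⟩ := hp.eq_singleton
        refine ⟨g, fun k => ?_⟩
        constructor
        · rintro ⟨rfl | h1, h2⟩
          · rfl
          · exact absurd h1 (by simp)
        · rintro rfl
          exact ⟨Or.inl rfl, hl.inc_right⟩
      · obtain ⟨f, hf⟩ := (ih.2 hyz).2
        refine ⟨f, fun k => ?_⟩
        rw [← hf k]
        constructor
        · rintro ⟨rfl | h1, h2⟩
          · rw [hg] at h2
            rcases h2 with h2 | h2
            · exact absurd h2.symm hxz
            · exact absurd h2.symm hyz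
          · exact ⟨h1, h2⟩
        · rintro h
          exact ⟨Or.inr h.1, h.2⟩

theorem IsPath.reflTransGen (h : G.IsPath x y X F) (hw : w ∈ X) :
    Relation.ReflTransGen (fun a b => ∃ f ∈ F, G.IsLink f a b) x w := by
  induction h with
  | @nil x hx => rw [show w = x from hw]
  | @cons g x y z X F hl hx hp ih =>
    rcases hw with rfl | hw
    · exact .refl
    · refine .head ⟨g, Or.inl rfl, hl⟩ (Relation.ReflTransGen.mono ?_ _ _ (ih hw))
      rintro a b ⟨f, hf, hl⟩
      exact ⟨f, Or.inr hf, hl⟩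

/-- A path of positive length together with an edge joining its ends is a circle. -/
theorem IsPath.exists_circle (h : G.IsPath x y X F) (hxy : x ≠ y) {e : β} (he : G.IsLink e x y)
    (heF : e ∉ F) : ∃ Z, Z ≤ G ∧ Z.IsCircle ∧ V(Z) = X ∧ E(Z) = insert e F := by
  have hinc : ∀ f ∈ insert e F, ∀ w, G.Inc f w → w ∈ X := by
    rintro f (rfl | hf) w hw
    · rcases hw.eq_or_eq_of_isLink he with rfl | rfl
      exacts [h.left_mem, h.right_mem]
    · exact h.inc_mem hf hw
  obtain ⟨Z, hZG, hZV, hZE⟩ := exists_subgraph h.subset_vertexSet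
    (Set.insert_subset he.edge_mem h.subset_edgeSet) hinc
  refine ⟨Z, hZG, ⟨⟨⟨x, hZV ▸ h.left_mem⟩, ?_⟩, ?_⟩, hZV, hZE⟩
  · have key : ∀ a ∈ V(Z), Relation.ReflTransGen Z.Adj x a := by
      intro a ha
      rw [hZV] at ha
      refine Relation.ReflTransGen.mono ?_ _ _ (h.reflTransGen ha)
      rintro a b ⟨f, hf, hl⟩
      exact ⟨f, (IsSubgraph.isLink_iff hZG (by rw [hZE]; exact Or.inr hf)).2 hl⟩
    intro a ha b hb
    exact (symm_of (Relation.ReflTransGen Z.Adj) (key a ha)).trans (key b hb)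
  · intro w hw
    rw [hZV] at hw
    have hZinc : ∀ k, Z.Inc k w ↔ (k = e ∨ k ∈ F) ∧ G.Inc k w := by
      intro k
      constructor
      · intro hk
        refine ⟨?_, hk.mono hZG⟩
        have := hk.edge_mem
        rwa [hZE] at this
      · rintro ⟨hk, hk'⟩
        exact (IsSubgraph.inc_congr hZG (by rw [hZE]; exact hk)).2 hk'
    have hloop : Z.loopSet w = ∅ := by
      ext k
      simp only [mem_loopSet, Set.mem_empty_iff_false, iff_false]
      intro hk
      have hkE := hk.edge_mem
      have hk' : G.IsLink k w w := IsLink.mono hZG hk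
      rw [hZE] at hkE
      rcases hkE with rfl | hkF
      · rcases hk'.eq_and_eq_or_eq_and_eq he with ⟨h1, h2⟩ | ⟨h1, h2⟩
        · exact hxy (h1.symm.trans h2)
        · exact hxy (h2.symm.trans h1)
      · obtain ⟨u, v, huv, -, -, hl⟩ := h.exists_ends hkF
        rcases hk'.eq_and_eq_or_eq_and_eq hl with ⟨h1, h2⟩ | ⟨h1, h2⟩
        · exact huv (h1.symm.trans h2)
        · exact huv (h2.symm.trans h1)
    have key : ∃ f g, f ≠ g ∧ Z.incidenceSet w = {f, g} := by
      by_cases hwx : w = x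
      · subst hwx
        obtain ⟨f, hf⟩ := (h.degrees.2 hxy).1
        refine ⟨e, f, ?_, ?_⟩
        · rintro rfl
          exact heF ((hf e).2 rfl).1
        · ext k
          simp only [mem_incidenceSet, hZinc, Set.mem_insert_iff, Set.mem_singleton_iff, ← hf k]
          constructor
          · tauto
          · rintro (rfl | h)
            · exact ⟨Or.inl rfl, he.inc_left⟩
            · tauto
      · by_cases hwy : w = y
        · subst hwy
          obtain ⟨f, hf⟩ := (h.degrees.2 hxy).2
          refine ⟨e, f, ?_, ?_⟩
          · rintro rfl
            exact heF ((hf e).2 rfl).1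
          · ext k
            simp only [mem_incidenceSet, hZinc, Set.mem_insert_iff, Set.mem_singleton_iff, ← hf k]
            constructor
            · tauto
            · rintro (rfl | h)
              · exact ⟨Or.inl rfl, he.inc_right⟩
              · tauto
        · obtain ⟨f, g, hfg, hf⟩ := h.degrees.1 w hw hwx hwy
          refine ⟨f, g, hfg, ?_⟩
          ext k
          simp only [mem_incidenceSet, hZinc, Set.mem_insert_iff, Set.mem_singleton_iff, ← hf k]
          constructor
          · rintro ⟨rfl | h1, h2⟩
            · rcases h2.eq_or_eq_of_isLink he with h | h <;> tauto
            · exact ⟨h1, h2⟩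
          · tauto
    obtain ⟨f, g, hfg, hk⟩ := key
    rw [degree, hk, hloop, Set.encard_pair hfg]
    simp

/-- A circle without loops is a path closed up by any of its edges. -/
theorem IsCircle.exists_isPath {C : Graph α β} (hC : C.IsCircle) (hfin : V(C).Finite)
    (hloop : ∀ f x, ¬ C.IsLink f x x) {e : β} {p q : α} (he : C.IsLink e p q) :
    C.IsPath p q V(C) (E(C) \ {e}) := by
  have hpq : p ≠ q := by rintro rfl; exact hloop _ _ he
  have hdeg : ∀ w ∈ V(C), ∀ f, C.Inc f w → ∃ g, g ≠ f ∧ ∀ k, C.Inc k w ↔ k = f ∨ k = g := by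
    intro w hw f hf
    have h2 := hC.2 w hw
    have h0 : C.loopSet w = ∅ := by
      ext k
      simp only [mem_loopSet, Set.mem_empty_iff_false, iff_false]
      exact hloop k w
    rw [degree, h0, Set.encard_empty, add_zero, Set.encard_eq_two] at h2
    obtain ⟨a, b, hab, hs⟩ := h2
    have hs' : ∀ k, C.Inc k w ↔ k = a ∨ k = b := by
      intro k
      rw [← mem_incidenceSet, hs]
      simp
    rcases (hs' f).1 hf with rfl | rfl
    · exact ⟨b, hab.symm, hs'⟩
    · exact ⟨a, hab, fun k => by rw [hs' k]; tauto⟩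
  -- Grow a path ending at `q`, keeping track of the only edge by which it can be continued.
  have grow : ∀ (N : ℕ) (x : α) (X : Set α) (F : Set β) (g : β), C.IsPath x q X F → p ∉ X → e ∉ F →
      (∀ w ∈ X, w ≠ x → ∀ k, C.Inc k w → k ∈ insert e F) → C.Inc g x → g ∉ insert e F →
      (∀ k, C.Inc k x → k ∈ insert e F ∨ k = g) → (V(C) \ X).ncard = N →
      ∃ X' F', C.IsPath p q X' F' ∧ e ∉ F' ∧ ∀ w ∈ X', ∀ k, C.Inc k w → k ∈ insert e F' := by
    intro N
    induction N using Nat.strong_induction_on with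
    | _ N ih =>
      intro x X F g hP hp heF hsat hgx hgF hx hN
      obtain ⟨y, hy⟩ := hgx
      have hyX : y ∉ X := by
        intro hyX
        have : y ≠ x := by rintro rfl; exact hloop _ _ hy
        exact hgF (hsat y hyX this g hy.inc_right)
      have hP' := IsPath.cons hy.symm hyX hP
      have hge : e ≠ g := fun h => hgF (Or.inl h.symm)
      have heF' : e ∉ insert g F := by
        rintro (h | h)
        exacts [hge h, heF h]
      have hsat' : ∀ w ∈ insert y X, w ≠ y → ∀ k, C.Inc k w → k ∈ insert e (insert g F) := by
        rintro w (rfl | hw) hwy k hk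
        · exact absurd rfl hwy
        · by_cases hwx : w = x
          · subst hwx
            rcases hx k hk with (rfl | h) | rfl
            · exact Or.inl rfl
            · exact Or.inr (Or.inr h)
            · exact Or.inr (Or.inl rfl)
          · rcases hsat w hw hwx k hk with rfl | h
            · exact Or.inl rfl
            · exact Or.inr (Or.inr h)
      obtain ⟨g', hg', hk'⟩ := hdeg y hy.right_mem g hy.inc_right
      by_cases hyp : y = p
      · subst hyp
        refine ⟨_, _, hP', heF', ?_⟩
        intro w hw k hk
        by_cases hwy : w = y
        · subst hwy
          have h1 := (hk' e).1 he.inc_left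
          have h2 := h1.resolve_left hge
          rcases (hk' k).1 hk with rfl | rfl
          · exact Or.inr (Or.inl rfl)
          · exact Or.inl h2.symm
        · exact hsat' w hw hwy k hk
      · refine ih _ ?_ y _ _ g' hP' ?_ heF' hsat' ((hk' g').2 (Or.inr rfl)) ?_ ?_ rfl
        · rw [← hN]
          refine Set.ncard_lt_ncard ?_ (hfin.sdiff)
          refine ⟨fun w hw => ⟨hw.1, fun h => hw.2 (Or.inr h)⟩, fun h => ?_⟩
          exact (h ⟨hy.right_mem, hyX⟩).2 (Or.inl rfl)
        · rintro (h | h)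
          exacts [hyp h.symm, hp h]
        · rintro (rfl | rfl | h)
          · rcases ((hk' g').2 (Or.inr rfl)).eq_or_eq_of_isLink he with h | h
            · exact hyp h
            · exact hyX (h ▸ hP.right_mem)
          · exact hg' rfl
          · exact hyX (hP.inc_mem h ((hk' g').2 (Or.inr rfl)))
        · intro k hk
          rcases (hk' k).1 hk with rfl | rfl
          · exact Or.inl (Or.inr (Or.inl rfl))
          · exact Or.inr rfl
  obtain ⟨g, hg, hk⟩ := hdeg q he.right_mem e he.inc_right
  obtain ⟨X, F, hP, heF, hsat⟩ := grow _ q {q} ∅ g (.nil he.right_mem) (by simpa using hpq)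
    (by simp) (by rintro w rfl h; exact absurd rfl h) ((hk g).2 (Or.inr rfl)) (by simpa using hg)
    (fun k h => by simpa using (hk k).1 h) rfl
  have hX : X = V(C) := by
    refine Set.Subset.antisymm hP.subset_vertexSet fun w hw => ?_
    have hr := hC.1.2 p he.left_mem w hw
    clear hw
    induction hr with
    | refl => exact hP.left_mem
    | tail _ hab ih =>
      obtain ⟨k, hkl⟩ := hab
      rcases hsat _ ih k hkl.inc_left with rfl | h
      · rcases hkl.inc_right.eq_or_eq_of_isLink he with rfl | rfl
        exacts [hP.left_mem, hP.right_mem]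
      · exact hP.inc_mem h hkl.inc_right
  have hF : F = E(C) \ {e} := by
    ext k
    constructor
    · intro h
      refine ⟨hP.subset_edgeSet h, ?_⟩
      rintro rfl
      exact heF h
    · rintro ⟨h1, h2⟩
      obtain ⟨a, b, hab⟩ := exists_isLink_of_mem_edgeSet h1
      exact (hsat a (hX ▸ hab.left_mem) k hab.inc_left).resolve_left h2
  rw [← hX, ← hF]
  exact hP

/-! ### Signs of edge sets -/

/-- The product of the signs of the edges in a finite set. -/
noncomputable def edgeSign {β : Type*} (σ : β → ℤˣ) (F : Set β) : ℤˣ := ∏ᶠ f ∈ F, σ f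

variable {σ : β → ℤˣ}

theorem sign_eq_edgeSign (C : Graph α β) : C.sign σ = edgeSign σ E(C) := rfl

@[simp] theorem edgeSign_empty : edgeSign σ ∅ = 1 := finprod_mem_empty

theorem edgeSign_union (h₁ : F₁.Finite) (h₂ : F₂.Finite) (h : Disjoint F₁ F₂) :
    edgeSign σ (F₁ ∪ F₂) = edgeSign σ F₁ * edgeSign σ F₂ :=
  finprod_mem_union h h₁ h₂

theorem edgeSign_insert (hF : F.Finite) (hf : f ∉ F) :
    edgeSign σ (insert f F) = σ f * edgeSign σ F :=
  finprod_mem_insert _ hf hF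

theorem edgeSign_congr {τ : β → ℤˣ} (h : ∀ f ∈ F, σ f = τ f) : edgeSign σ F = edgeSign τ F :=
  finprod_mem_congr rfl h

/-- If `ζ` switches every edge of a path to `+`, then the sign of the path is the product of the
values of `ζ` at its ends. -/
theorem IsPath.edgeSign_eq (h : G.IsPath x y X F) {ζ : α → ℤˣ}
    (hζ : ∀ f ∈ F, ∀ a b, G.IsLink f a b → ζ a * σ f * ζ b = 1) : edgeSign σ F = ζ x * ζ y := by
  induction h with
  | nil => simp
  | @cons g x y z X F hl hx hp ih =>
    rw [edgeSign_insert hp.finite_edges (fun hg => hx (hp.inc_mem hg hl.inc_left)),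
      ih (fun f hf => hζ f (Or.inr hf))]
    have h1 := hζ g (Or.inl rfl) x y hl
    have h2 : σ g = ζ x * ζ y := by
      have h3 := Int.units_mul_self (ζ x)
      have h4 := Int.units_mul_self (ζ y)
      calc σ g = (ζ x * ζ x) * σ g * (ζ y * ζ y) := by rw [h3, h4]; simp
        _ = ζ x * (ζ x * σ g * ζ y) * ζ y := by simp only [mul_assoc]
        _ = _ := by rw [h1]; simp
    rw [h2]
    calc ζ x * ζ y * (ζ y * ζ z) = ζ x * (ζ y * ζ y) * ζ z := by simp only [mul_assoc]
      _ = _ := by rw [Int.units_mul_self]; simp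

end

section

/-! ### Blocks -/

variable {α β : Type*} {B C : Graph α β}

/-- A loop is a circle, and in a block with further edges its vertex would be a cutpoint. -/
theorem IsBlock.not_isLink_self (hB : B.IsBlock) (hB' : ¬ B.IsCircle) (f : β) (x : α) :
    ¬ B.IsLink f x x := by
  intro hf
  by_cases hE : E(B) ⊆ {f}
  · have hE' : E(B) = {f} := Set.Subset.antisymm hE (by simpa using hf.edge_mem)
    have honly : ∀ k a b, B.IsLink k a b → k = f ∧ a = x ∧ b = x := by
      intro k a b hab
      obtain rfl : k = f := hE hab.edge_mem
      rcases hab.eq_and_eq_or_eq_and_eq hf with h | h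
      exacts [⟨rfl, h⟩, ⟨rfl, h⟩]
    have hV : ∀ y ∈ V(B), y = x := by
      intro y hy
      have hr := hB.1.2 x hf.left_mem y hy
      clear hy
      induction hr with
      | refl => rfl
      | tail _ h _ =>
        obtain ⟨k, hk⟩ := h
        exact (honly _ _ _ hk).2.2
    refine hB' ⟨hB.1, fun y hy => ?_⟩
    obtain rfl := hV y hy
    have h1 : B.incidenceSet y = {f} := by
      ext k
      constructor
      · rintro ⟨b, hb⟩
        exact (honly _ _ _ hb).1
      · rintro rfl
        exact hf.inc_left
    have h2 : B.loopSet y = {f} := by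
      ext k
      constructor
      · intro hb
        exact (honly _ _ _ hb).1
      · rintro rfl
        exact hf
    rw [degree, h1, h2, Set.encard_singleton, one_add_one_eq_two]
  · obtain ⟨g, hg, hgf⟩ := Set.not_subset.1 hE
    obtain ⟨H₁, hH₁, hV₁, hE₁⟩ := exists_subgraph (G := B) (X := {x}) (F := {f})
      (by simpa using hf.left_mem) (by simpa using hf.edge_mem) (by
        rintro k rfl w hw
        rcases hw.eq_or_eq_of_isLink hf with h | h <;> exact h)
    obtain ⟨H₂, hH₂, hV₂, hE₂⟩ := exists_subgraph (G := B) (X := V(B)) (F := E(B) \ {f})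
      le_rfl Set.sdiff_subset (fun k _ w hw => hw.vertex_mem)
    refine hB.2 x ⟨H₁, H₂, ⟨hH₁, hH₂, ?_, ?_⟩, ?_, ?_, ?_, ?_⟩
    · rw [hV₁, hV₂]
      exact (Set.union_eq_right.2 (by simpa using hf.left_mem)).symm
    · rw [hE₁, hE₂]
      exact (Set.union_sdiff_cancel (by simpa using hf.edge_mem)).symm
    · rw [hE₁]; simp
    · rw [hE₂]; exact ⟨g, hg, hgf⟩
    · rw [hV₁, hV₂]; simpa using hf.left_mem
    · rw [hE₁, hE₂]; simp

/-- In a block, a vertex `w` outside a set `W` can be joined to `W` by a path that avoids a given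
vertex `u` of `W`, as soon as `W` contains both ends of some edge. -/
theorem IsBlock.exists_isPath_avoiding (hB : B.IsBlock) {W : Set α} {u w a b : α} {g : β}
    (huB : u ∈ V(B)) (hu : u ∈ W) (hwB : w ∈ V(B)) (hw : w ∉ W) (hg : B.IsLink g a b) (ha : a ∈ W)
    (hb : b ∈ W) :
    ∃ z X F, z ∈ W ∧ z ≠ u ∧ B.IsPath w z X F ∧ X ∩ W = {z} := by
  by_contra hcon
  have hwu : w ≠ u := by rintro rfl; exact hw hu
  set S : Set α := {s | Relation.ReflTransGen (fun a b => B.Adj a b ∧ a ≠ u ∧ b ≠ u) w s} with hS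
  have hwS : w ∈ S := Relation.ReflTransGen.refl
  have hSV : S ⊆ V(B) := by
    intro s hs
    cases hs with
    | refl => exact hwB
    | tail _ h => exact h.1.right_mem
  have huS : u ∉ S := by
    intro h
    cases h with
    | refl => exact hwu rfl
    | tail _ h => exact h.2.2 rfl
  have hSW : ∀ s ∈ S, s ∉ W := by
    intro s hs hsW
    have hsu : s ≠ u := by rintro rfl; exact huS hs
    obtain ⟨X, F, hP, hX⟩ := exists_isPath_of_reflTransGen (G := B) {y | y ≠ u}
      (fun _ _ h => ⟨h.1, h.2.1⟩) hs (hSV hs) hsu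
    obtain ⟨z, X', F', hz, hP', hX', -, hXW⟩ := hP.first_hit hsW
    exact hcon ⟨z, X', F', hz, hX (hX' hP'.right_mem), hP', hXW⟩
  have hstep : ∀ f s t, s ∈ S → B.IsLink f s t → t ∈ S ∨ t = u := by
    intro f s t hs hl
    by_cases ht : t = u
    · exact Or.inr ht
    · exact Or.inl (Relation.ReflTransGen.tail hs
        ⟨⟨f, hl⟩, by rintro rfl; exact huS hs, ht⟩)
  obtain ⟨H₁, hH₁, hV₁, hE₁⟩ := exists_subgraph (G := B) (X := insert u S)
    (F := {f | ∃ s ∈ S, B.Inc f s}) (Set.insert_subset huB hSV)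
    (by rintro f ⟨s, -, hs⟩; exact hs.edge_mem)
    (by
      rintro f ⟨s, hs, t, hl⟩ y hy
      rcases hy.eq_or_eq_of_isLink hl with rfl | rfl
      · exact Or.inr hs
      · exact (hstep f s y hs hl).symm)
  obtain ⟨H₂, hH₂, hV₂, hE₂⟩ := exists_subgraph (G := B) (X := V(B) \ S)
    (F := {f | f ∈ E(B) ∧ ¬ ∃ s ∈ S, B.Inc f s}) Set.sdiff_subset (fun f hf => hf.1)
    (fun f hf y hy => ⟨hy.vertex_mem, fun h => hf.2 ⟨y, h, hy⟩⟩)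
  refine hB.2 u ⟨H₁, H₂, ⟨hH₁, hH₂, ?_, ?_⟩, ?_, ?_, ?_, ?_⟩
  · rw [hV₁, hV₂]
    ext y
    constructor
    · intro hy
      by_cases hyS : y ∈ S
      exacts [Or.inl (Or.inr hyS), Or.inr ⟨hy, hyS⟩]
    · rintro ((rfl | h) | h)
      exacts [huB, hSV h, h.1]
  · rw [hE₁, hE₂]
    ext f
    constructor
    · intro hf
      by_cases h : ∃ s ∈ S, B.Inc f s
      exacts [Or.inl h, Or.inr ⟨hf, h⟩]
    · rintro (⟨s, -, h⟩ | h)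
      exacts [h.edge_mem, h.1]
  · rw [hE₁]
    rcases Relation.ReflTransGen.cases_head (hB.1.2 w hwB u huB) with h | ⟨c, ⟨f, hf⟩, -⟩
    · exact absurd h hwu
    · exact ⟨f, w, hwS, hf.inc_left⟩
  · rw [hE₂]
    refine ⟨g, hg.edge_mem, ?_⟩
    rintro ⟨s, hs, hi⟩
    rcases hi.eq_or_eq_of_isLink hg with rfl | rfl
    exacts [hSW _ hs ha, hSW _ hs hb]
  · rw [hV₁, hV₂]
    ext y
    constructor
    · rintro ⟨rfl | h1, h2⟩
      exacts [rfl, absurd h1 h2.2]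
    · rintro rfl
      exact ⟨Or.inl rfl, huB, huS⟩
  · rw [hE₁, hE₂]
    exact Set.eq_empty_of_forall_notMem fun f hf => hf.2.2 hf.1

theorem IsBlock.exists_edge_notMem (hB : B.IsBlock) (hB' : ¬ B.IsCircle) (hCB : C ≤ B)
    (hC : C.IsCircle) : ∃ f ∈ E(B), f ∉ E(C) := by
  by_contra! hcon
  have hV : V(B) ⊆ V(C) := by
    intro y hy
    obtain ⟨x, hx⟩ := hC.1.1
    have hr := hB.1.2 x (hCB.1 hx) y hy
    clear hy
    induction hr with
    | refl => exact hx
    | tail _ h _ =>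
      obtain ⟨k, hk⟩ := h
      exact ((IsSubgraph.isLink_iff hCB (hcon k hk.edge_mem)).2 hk).right_mem
  have : C = B := eq_of_le_le hCB le_rfl (Set.Subset.antisymm hCB.1 hV)
    (Set.Subset.antisymm (IsSubgraph.edgeSet_mono hCB) hcon)
  exact hB' (this ▸ hC)

end

section

/-! ### Components and bridges -/

variable {α β : Type*} {B C D D' H K : Graph α β} {f : β} {u w x y z : α}

theorem isConnected_induce_reachable :
    (H.induce {z | Relation.ReflTransGen H.Adj x z}).IsConnected := by
  set L := H.induce {z | Relation.ReflTransGen H.Adj x z} with hL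
  have key : ∀ z, Relation.ReflTransGen H.Adj x z → Relation.ReflTransGen L.Adj x z := by
    intro z hz
    induction hz with
    | refl => exact .refl
    | @tail b c hb hbc ih =>
      obtain ⟨f, hf⟩ := hbc
      exact ih.tail ⟨f, hf, hb, hb.tail ⟨f, hf⟩⟩
  refine ⟨⟨x, Relation.ReflTransGen.refl⟩, fun a ha b hb => ?_⟩
  exact (symm_of (Relation.ReflTransGen L.Adj) (key a ha)).trans (key b hb)

theorem IsConnected.le_induce_reachable (hK : K.IsConnected) (hKH : K ≤ H) (hx : x ∈ V(K)) :
    K ≤ H.induce {z | Relation.ReflTransGen H.Adj x z} := by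
  have hV : ∀ z ∈ V(K), Relation.ReflTransGen H.Adj x z := fun z hz =>
    Relation.ReflTransGen.mono (fun a b h => h.mono hKH) _ _ (hK.2 x hx z hz)
  exact ⟨hV, fun e a b h => ⟨h.mono hKH, hV a h.left_mem, hV b h.right_mem⟩⟩

theorem induce_reachable_le (hx : x ∈ V(H)) :
    H.induce {z | Relation.ReflTransGen H.Adj x z} ≤ H := by
  refine induce_le fun z hz => ?_
  cases hz with
  | refl => exact hx
  | tail _ h => exact h.right_mem

theorem isComponent_induce_reachable (hx : x ∈ V(H)) :
    H.IsComponent (H.induce {z | Relation.ReflTransGen H.Adj x z}) :=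
  ⟨⟨induce_reachable_le hx, isConnected_induce_reachable⟩, fun _ hL hle =>
    hL.2.le_induce_reachable hL.1 (hle.1 Relation.ReflTransGen.refl)⟩

theorem IsComponent.eq_induce (hK : H.IsComponent K) (hx : x ∈ V(K)) :
    K = H.induce {z | Relation.ReflTransGen H.Adj x z} := by
  have hxH := hK.1.1.1 hx
  have hle := hK.1.2.le_induce_reachable hK.1.1 hx
  exact le_antisymm hle (hK.2 ⟨induce_reachable_le hxH, isConnected_induce_reachable⟩ hle)

theorem IsComponent.mem_of_isLink (hK : H.IsComponent K) (hx : x ∈ V(K)) (h : H.IsLink f x y) :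
    y ∈ V(K) := by
  rw [hK.eq_induce hx]
  exact Relation.ReflTransGen.single ⟨f, h⟩

theorem IsComponent.eq_of_mem {K' : Graph α β} (hK : H.IsComponent K) (hK' : H.IsComponent K')
    (hx : x ∈ V(K)) (hx' : x ∈ V(K')) : K = K' := by
  rw [hK.eq_induce hx, hK'.eq_induce hx']

/-- An edge at a vertex of a component `K` of `B ∖ V(C)` leads to `K` or to `C`. -/
theorem IsComponent.mem_or_mem (hK : (B.deleteVerts V(C)).IsComponent K) (hx : x ∈ V(K))
    (h : B.IsLink f x y) : y ∈ V(K) ∨ y ∈ V(C) := by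
  by_cases hy : y ∈ V(C)
  · exact Or.inr hy
  · left
    have hx' := hK.1.1.1 hx
    exact hK.mem_of_isLink hx ((deleteVerts_isLink _ _).2 ⟨h, hx'.2, hy⟩)

/-- A bridge is a chord with its ends, or it is formed by a component `K` of `B ∖ V(C)`: its vertices
off `C` are those of `K`, and its vertices on `C` are the neighbours of `K`. -/
theorem IsBridge.chord_or_component (hD : B.IsBridge C D) :
    (∃ c x y, x ≠ y ∧ x ∈ V(C) ∧ y ∈ V(C) ∧ B.IsLink c x y ∧ c ∉ E(C) ∧ E(D) = {c} ∧
      V(D) = {x, y}) ∨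
    ∃ K, (B.deleteVerts V(C)).IsComponent K ∧ V(K) ⊆ V(D) ∧ (∀ x ∈ V(K), x ∉ V(C)) ∧
      E(D) = {f | ∃ x ∈ V(K), B.Inc f x} ∧ (∀ x, x ∈ V(D) → x ∉ V(C) → x ∈ V(K)) ∧
      (∀ x ∈ V(D), x ∈ V(C) → ∃ f, ∃ k ∈ V(K), B.IsLink f x k) := by
  rcases hD.2 with ⟨c, ⟨hc, hcC, x, hx, y, hy, hxy, hl⟩, hE, hV⟩ | ⟨K, hK, hE, hV⟩
  · left
    refine ⟨c, x, y, hxy, hx, hy, hl, hcC, hE, ?_⟩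
    rw [hV]
    ext w
    constructor
    · intro h
      exact h.eq_or_eq_of_isLink hl
    · rintro (rfl | rfl)
      exacts [hl.inc_left, hl.inc_right]
  · right
    have hKC : ∀ x ∈ V(K), x ∉ V(C) := fun x hx => (hK.1.1.1 hx).2
    refine ⟨K, hK, hV ▸ Set.subset_union_left, hKC, hE, ?_, ?_⟩
    · intro x hx hxC
      rw [hV] at hx
      rcases hx with hx | ⟨f, ⟨k, hk, a, ha⟩, hf⟩
      · exact hx
      · rcases hf.eq_or_eq_of_isLink ha with rfl | rfl
        · exact hk
        · exact (hK.mem_or_mem hk ha).resolve_right hxC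
    · intro x hx hxC
      rw [hV] at hx
      rcases hx with hx | ⟨f, ⟨k, hk, a, ha⟩, hf⟩
      · exact absurd hxC (hKC x hx)
      · rcases hf.eq_or_eq_of_isLink ha with rfl | rfl
        · exact absurd hxC (hKC x hk)
        · exact ⟨f, k, hk, ha.symm⟩

theorem IsBridge.edge_notMem (hCB : C ≤ B) (hD : B.IsBridge C D) (hf : f ∈ E(D)) : f ∉ E(C) := by
  rcases hD.chord_or_component with ⟨c, x, y, -, -, -, -, hc, hE, -⟩ | ⟨K, hK, hKD, hKC, hE, -⟩
  · rw [hE] at hf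
    rwa [show f = c from hf]
  · rw [hE] at hf
    obtain ⟨x, hx, hi⟩ := hf
    intro hfC
    exact hKC x hx ((IsSubgraph.inc_congr hCB hfC).2 hi).vertex_mem

theorem IsBridge.inc_mem (hD : B.IsBridge C D) (hf : f ∈ E(D)) (h : B.Inc f w) : w ∈ V(D) :=
  ((IsSubgraph.inc_congr hD.1 hf).2 h).vertex_mem

theorem IsBridge.edge_mem_of_inc (hD : B.IsBridge C D) (hw : w ∈ V(D)) (hwC : w ∉ V(C))
    (h : B.Inc f w) : f ∈ E(D) := by
  rcases hD.chord_or_component with ⟨c, x, y, -, hx, hy, -, -, -, hV⟩ | ⟨K, -, -, -, hE, h1, -⟩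
  · rw [hV] at hw
    rcases hw with rfl | rfl <;> contradiction
  · rw [hE]
    exact ⟨w, h1 w hw hwC, h⟩

theorem IsBridge.exists_component (hD : B.IsBridge C D) (hw : w ∈ V(D)) (hwC : w ∉ V(C)) :
    ∃ K, (B.deleteVerts V(C)).IsComponent K ∧ w ∈ V(K) ∧
      E(D) = {f | ∃ x ∈ V(K), B.Inc f x} ∧
      V(D) = V(K) ∪ {y | ∃ f, (∃ x ∈ V(K), B.Inc f x) ∧ B.Inc f y} := by
  rcases hD.2 with ⟨c, ⟨hc, hcC, x, hx, y, hy, hxy, hl⟩, hE, hV⟩ | ⟨K, hK, hE, hV⟩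
  · rw [hV] at hw
    rcases Inc.eq_or_eq_of_isLink hw hl with rfl | rfl <;> contradiction
  · refine ⟨K, hK, ?_, hE, hV⟩
    rw [hV] at hw
    rcases hw with hw | ⟨f, ⟨k, hk, a, ha⟩, hf⟩
    · exact hw
    · rcases hf.eq_or_eq_of_isLink ha with rfl | rfl
      · exact hk
      · exact (hK.mem_or_mem hk ha).resolve_right hwC

/-- Different bridges meet only in `C`. -/
theorem IsBridge.eq_of_mem (hD : B.IsBridge C D) (hD' : B.IsBridge C D') (hw : w ∈ V(D))
    (hw' : w ∈ V(D')) (hwC : w ∉ V(C)) : D = D' := by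
  obtain ⟨K, hK, hwK, hE, hV⟩ := hD.exists_component hw hwC
  obtain ⟨K', hK', hwK', hE', hV'⟩ := hD'.exists_component hw' hwC
  obtain rfl := hK.eq_of_mem hK' hwK hwK'
  exact eq_of_le_le hD.1 hD'.1 (hV.trans hV'.symm) (hE.trans hE'.symm)

theorem IsBridge.eq_of_edge_mem (hD : B.IsBridge C D) (hD' : B.IsBridge C D') (hf : f ∈ E(D))
    (hf' : f ∈ E(D')) : D = D' := by
  obtain ⟨a, b, hab⟩ := exists_isLink_of_mem_edgeSet hf
  have hab' := hab.mono hD.1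
  by_cases ha : a ∈ V(C)
  · by_cases hb : b ∈ V(C)
    · have key : ∀ D, B.IsBridge C D → f ∈ E(D) → E(D) = {f} ∧ V(D) = {x | B.Inc f x} := by
        intro D hD hf
        rcases hD.2 with ⟨c, -, hE, hV⟩ | ⟨K, hK, hE, -⟩
        · rw [hE] at hf
          obtain rfl : f = c := hf
          exact ⟨hE, hV⟩
        · rw [hE] at hf
          obtain ⟨x, hx, hi⟩ := hf
          have hxC : x ∉ V(C) := (hK.1.1.1 hx).2
          rcases hi.eq_or_eq_of_isLink hab' with rfl | rfl <;> contradiction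
      obtain ⟨h1, h2⟩ := key D hD hf
      obtain ⟨h3, h4⟩ := key D' hD' hf'
      exact eq_of_le_le hD.1 hD'.1 (h2.trans h4.symm) (h1.trans h3.symm)
    · exact hD.eq_of_mem hD' (hD.inc_mem hf hab'.inc_right) (hD'.inc_mem hf' hab'.inc_right) hb
  · exact hD.eq_of_mem hD' (hD.inc_mem hf hab'.inc_left) (hD'.inc_mem hf' hab'.inc_left) ha

theorem exists_isBridge_of_mem_vertexSet (hw : w ∈ V(B)) (hwC : w ∉ V(C)) :
    ∃ D, B.IsBridge C D ∧ w ∈ V(D) := by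
  have hw' : w ∈ V(B.deleteVerts V(C)) := ⟨hw, hwC⟩
  have hK := isComponent_induce_reachable hw'
  set K := (B.deleteVerts V(C)).induce
    {z | Relation.ReflTransGen (B.deleteVerts V(C)).Adj w z} with hKdef
  have hwK : w ∈ V(K) := Relation.ReflTransGen.refl
  obtain ⟨D, hD, hV, hE⟩ := exists_subgraph (G := B)
    (X := V(K) ∪ {y | ∃ f, (∃ x ∈ V(K), B.Inc f x) ∧ B.Inc f y})
    (F := {f | ∃ x ∈ V(K), B.Inc f x})
    (by
      rintro y (hy | ⟨f, -, hf⟩)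
      exacts [(hK.1.1.1 hy).1, hf.vertex_mem])
    (by rintro f ⟨x, -, h⟩; exact h.edge_mem)
    (fun f hf w hw => Or.inr ⟨f, hf, hw⟩)
  exact ⟨D, ⟨hD, Or.inr ⟨K, hK, hE, hV⟩⟩, hV ▸ Or.inl hwK⟩

theorem exists_isBridge_of_mem_edgeSet (hloop : ∀ f x, ¬ B.IsLink f x x) (hf : f ∈ E(B))
    (hfC : f ∉ E(C)) : ∃ D, B.IsBridge C D ∧ f ∈ E(D) := by
  obtain ⟨a, b, hab⟩ := exists_isLink_of_mem_edgeSet hf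
  by_cases ha : a ∈ V(C)
  · by_cases hb : b ∈ V(C)
    · obtain ⟨D, hD, hV, hE⟩ := exists_subgraph (G := B) (X := {x | B.Inc f x}) (F := {f})
        (fun x hx => Inc.vertex_mem hx) (by simpa using hf) (by rintro f rfl w hw; exact hw)
      refine ⟨D, ⟨hD, Or.inl ⟨f, ⟨hf, hfC, a, ha, b, hb, ?_, hab⟩, hE, hV⟩⟩, hE ▸ rfl⟩
      rintro rfl
      exact hloop _ _ hab
    · obtain ⟨D, hD, hbD⟩ := exists_isBridge_of_mem_vertexSet hab.right_mem hb
      exact ⟨D, hD, hD.edge_mem_of_inc hbD hb hab.inc_right⟩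
  · obtain ⟨D, hD, haD⟩ := exists_isBridge_of_mem_vertexSet hab.left_mem ha
    exact ⟨D, hD, hD.edge_mem_of_inc haD ha hab.inc_left⟩

/-- A path that starts in a bridge outside `C` and does not pass through `C` stays in the bridge. -/
theorem IsBridge.subset_of_isPath (hD : B.IsBridge C D) {X : Set α} {F : Set β}
    (hP : B.IsPath w z X F) (hw : w ∈ V(D)) (hwC : w ∉ V(C)) (hX : X ∩ V(C) ⊆ {z}) :
    X ⊆ V(D) ∧ F ⊆ E(D) := by
  induction hP with
  | nil => exact ⟨by simpa using hw, by simp⟩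
  | @cons g x y z X F hl hx hp ih =>
    have hg := hD.edge_mem_of_inc hw hwC hl.inc_left
    have hy := hD.inc_mem hg hl.inc_right
    by_cases hyC : y ∈ V(C)
    · obtain rfl : y = z := hX ⟨Or.inr hp.left_mem, hyC⟩
      obtain ⟨rfl, rfl⟩ := hp.eq_singleton
      exact ⟨Set.insert_subset hw (by simpa using hy), by simpa using hg⟩
    · obtain ⟨h1, h2⟩ := ih hy hyC fun w hw => hX ⟨Or.inr hw.1, hw.2⟩
      exact ⟨Set.insert_subset hw h1, Set.insert_subset hg h2⟩

theorem IsPath.vertices_subset {X : Set α} {F : Set β} (hP : B.IsPath x y X F) (hDB : D ≤ B)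
    (hx : x ∈ V(D)) (hF : F ⊆ E(D)) : X ⊆ V(D) := by
  induction hP with
  | nil => simpa using hx
  | cons hl _ _ ih =>
    exact Set.insert_subset hx (ih ((IsSubgraph.isLink_iff hDB (hF (Or.inl rfl))).2 hl).right_mem
      fun _ h => hF (Or.inr h))

/-- Any two vertices of attachment of a bridge are joined by a path through the bridge. -/
theorem IsBridge.exists_isPath (hD : B.IsBridge C D) (hu : u ∈ C.attachments D)
    (hw : w ∈ C.attachments D) (huw : u ≠ w) :
    ∃ X F, B.IsPath u w X F ∧ X ∩ V(C) = {u, w} ∧ X ⊆ V(D) ∧ F ⊆ E(D) := by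
  have hfin : ∀ {X F}, B.IsPath u w X F → X ∩ V(C) = {u, w} → F ⊆ E(D) →
      ∃ X F, B.IsPath u w X F ∧ X ∩ V(C) = {u, w} ∧ X ⊆ V(D) ∧ F ⊆ E(D) := by
    intro X F hP hX hF
    exact ⟨X, F, hP, hX, hP.vertices_subset hD.1 hu.1 hF, hF⟩
  rcases hD.chord_or_component with ⟨c, x, y, hxy, hx, hy, hl, hc, hE, hV⟩ | ⟨K, hK, hKD, hKC, hE, h1, h2⟩
  · have hl' : B.IsLink c u w := by
      have h1 := hu.1
      have h2 := hw.1
      rw [hV] at h1 h2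
      rcases h1 with rfl | rfl <;> rcases h2 with rfl | rfl
      exacts [absurd rfl huw, hl, hl.symm, absurd rfl huw]
    refine hfin (.cons hl' (by simpa using huw) (.nil hl'.right_mem)) ?_ (by simp [hE])
    exact Set.inter_eq_left.2 (Set.insert_subset hu.2 (by simpa using hw.2))
  · obtain ⟨f, k, hk, hf⟩ := h2 u hu.1 hu.2
    obtain ⟨g, l, hlK, hg⟩ := h2 w hw.1 hw.2
    obtain ⟨X, F, hP⟩ := hK.1.2.exists_isPath hk hlK
    have hXK := hP.subset_vertexSet
    have hXC : ∀ x ∈ X, x ∉ V(C) := fun x hx => hKC x (hXK hx)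
    have hP' := hP.mono (hK.1.1.trans deleteVerts_le)
    have hQ := hP'.snoc hg.symm (fun h => hXC _ h hw.2)
    refine hfin (.cons hf ?_ hQ) ?_ ?_
    · rintro (h | h)
      exacts [huw h, hXC _ h hu.2]
    · ext v
      constructor
      · rintro ⟨rfl | rfl | h, hv⟩
        exacts [Or.inl rfl, Or.inr rfl, absurd hv (hXC v h)]
      · rintro (rfl | rfl)
        exacts [⟨Or.inl rfl, hu.2⟩, ⟨Or.inr (Or.inl rfl), hw.2⟩]
    · rw [hE]
      rintro e (rfl | rfl | he)
      · exact ⟨k, hk, hf.inc_right⟩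
      · exact ⟨l, hlK, hg.inc_right⟩
      · obtain ⟨a, b, -, ha, -, hl⟩ := hP'.exists_ends he
        exact ⟨a, hXK ha, hl.inc_left⟩

/-- Three vertices of attachment of a bridge are joined by a tripod inside the bridge. -/
theorem IsBridge.exists_tripod (hD : B.IsBridge C D) {u₁ u₂ u₃ : α} (h₁ : u₁ ∈ C.attachments D)
    (h₂ : u₂ ∈ C.attachments D) (h₃ : u₃ ∈ C.attachments D) (h₁₂ : u₁ ≠ u₂) (h₁₃ : u₁ ≠ u₃)
    (h₂₃ : u₂ ≠ u₃) :
    ∃ w X₁ F₁ X₂ F₂ X₃ F₃, B.IsPath u₁ w X₁ F₁ ∧ B.IsPath u₂ w X₂ F₂ ∧ B.IsPath u₃ w X₃ F₃ ∧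
      X₁ ∩ X₂ ⊆ {w} ∧ X₁ ∩ X₃ ⊆ {w} ∧ X₂ ∩ X₃ ⊆ {w} ∧ X₁ ∩ V(C) = {u₁} ∧ X₂ ∩ V(C) = {u₂} ∧
      X₃ ∩ V(C) = {u₃} ∧ F₁ ⊆ E(D) ∧ F₂ ⊆ E(D) ∧ F₃ ⊆ E(D) := by
  rcases hD.chord_or_component with ⟨c, x, y, hxy, hx, hy, hl, hc, hE, hV⟩ | ⟨K, hK, hKD, hKC, hE, hK1, hK2⟩
  · have h1 := h₁.1
    have h2 := h₂.1
    have h3 := h₃.1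
    rw [hV] at h1 h2 h3
    rcases h1 with rfl | rfl <;> rcases h2 with rfl | rfl <;> rcases h3 with rfl | rfl <;>
      simp at h₁₂ h₁₃ h₂₃
  · obtain ⟨f₁, k₁, hk₁, hf₁⟩ := hK2 u₁ h₁.1 h₁.2
    obtain ⟨f₂, k₂, hk₂, hf₂⟩ := hK2 u₂ h₂.1 h₂.2
    obtain ⟨f₃, k₃, hk₃, hf₃⟩ := hK2 u₃ h₃.1 h₃.2
    obtain ⟨X, F, hP⟩ := hK.1.2.exists_isPath hk₁ hk₂
    obtain ⟨X₀, F₀, hP₀⟩ := hK.1.2.exists_isPath hk₃ hk₁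
    obtain ⟨w, X₃, F₃, hw, hP₃, -, -, hX₃⟩ := hP₀.first_hit hP.left_mem
    obtain ⟨X₁, F₁, X₂, F₂, hP₁, hP₂, hX, rfl, rfl⟩ := hP.split hw
    have hle : K ≤ B := hK.1.1.trans deleteVerts_le
    have hadd : ∀ {u k f X F}, K.IsPath k w X F → B.IsLink f u k → u ∈ V(C) → k ∈ V(K) →
        B.IsPath u w (insert u X) (insert f F) ∧ insert u X ∩ V(C) = {u} ∧
          insert f F ⊆ E(D) := by
      intro u k f X F hp hf hu hk
      have hXC : ∀ x ∈ X, x ∉ V(C) := fun x hx => hKC x (hp.subset_vertexSet hx)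
      refine ⟨.cons hf (fun h => hXC u h hu) (hp.mono hle), ?_, ?_⟩
      · ext v
        constructor
        · rintro ⟨rfl | h, hv⟩
          exacts [rfl, absurd hv (hXC v h)]
        · rintro rfl
          exact ⟨Or.inl rfl, hu⟩
      · rw [hE]
        rintro e (rfl | he)
        · exact ⟨k, hk, hf.inc_right⟩
        · obtain ⟨a, b, -, ha, -, hl⟩ := hp.exists_ends he
          exact ⟨a, hp.subset_vertexSet ha, (hl.mono hle).inc_left⟩
    have hint : ∀ {u u' : α} {X X' : Set α}, u ∈ V(C) → u' ∈ V(C) → u ≠ u' → X ⊆ V(K) →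
        X' ⊆ V(K) → X ∩ X' ⊆ {w} → insert u X ∩ insert u' X' ⊆ {w} := by
      rintro u u' X X' hu hu' hne hX hX' hXX v ⟨rfl | hv, rfl | hv'⟩
      · exact absurd rfl hne
      · exact absurd hu (hKC _ (hX' hv'))
      · exact absurd hu' (hKC _ (hX hv))
      · exact hXX ⟨hv, hv'⟩
    obtain ⟨a1, b1, c1⟩ := hadd hP₁ hf₁ h₁.2 hk₁
    obtain ⟨a2, b2, c2⟩ := hadd hP₂.symm hf₂ h₂.2 hk₂
    obtain ⟨a3, b3, c3⟩ := hadd hP₃ hf₃ h₃.2 hk₃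
    refine ⟨w, _, _, _, _, _, _, a1, a2, a3, ?_, ?_, ?_, b1, b2, b3, c1, c2, c3⟩
    · exact hint h₁.2 h₂.2 h₁₂ hP₁.subset_vertexSet hP₂.subset_vertexSet hX.subset
    · refine hint h₁.2 h₃.2 h₁₃ hP₁.subset_vertexSet hP₃.subset_vertexSet ?_
      intro v hv
      rw [← hX₃]
      exact ⟨hv.2, Or.inl hv.1⟩
    · refine hint h₂.2 h₃.2 h₂₃ hP₂.subset_vertexSet hP₃.subset_vertexSet ?_
      intro v hv
      rw [← hX₃]
      exact ⟨hv.2, Or.inr hv.1⟩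

/-- A bridge of a circle in a block has at least two vertices of attachment. -/
theorem IsBlock.exists_attachments (hB : B.IsBlock) (hCB : C ≤ B) {e : β} {p q : α}
    (he : C.IsLink e p q) (hD : B.IsBridge C D) :
    ∃ u w, u ≠ w ∧ u ∈ C.attachments D ∧ w ∈ C.attachments D := by
  rcases hD.chord_or_component with ⟨c, x, y, hxy, hx, hy, hl, hc, hE, hV⟩ | ⟨K, hK, hKD, hKC, hE, hK1, hK2⟩
  · exact ⟨x, y, hxy, ⟨by simp [hV], hx⟩, ⟨by simp [hV], hy⟩⟩
  · obtain ⟨k, hkK⟩ := hK.1.2.1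
    have hkC := hKC k hkK
    have hkB : k ∈ V(B) := (hK.1.1.1 hkK).1
    have hkD : k ∈ V(D) := hKD hkK
    have hatt : ∀ v ∈ V(C), ∃ z ∈ C.attachments D, z ≠ v := by
      intro v hv
      obtain ⟨z, X, F, hz, hzv, hP, hX⟩ := hB.exists_isPath_avoiding (hCB.1 hv) hv hkB hkC
        (he.mono hCB) he.left_mem he.right_mem
      exact ⟨z, ⟨(hD.subset_of_isPath hP hkD hkC hX.subset).1 hP.right_mem, hz⟩, hzv⟩
    obtain ⟨u, hu, -⟩ := hatt p he.left_mem
    obtain ⟨w, hw, hwu⟩ := hatt u hu.2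
    exact ⟨u, w, hwu.symm, hu, hw⟩

end

section

/-! ### Circles with a cyclic numbering -/

variable {α β : Type*} {B C : Graph α β} {e : β} {n : ℕ} {v : ℕ → α} {ε : ℕ → β}

/-- `C` is a circle with vertices `v 0, …, v n` and edges `ε 0, …, ε (n - 1), e`, where `ε i` joins
`v i` to `v (i + 1)` and `e` joins `v n` to `v 0`. -/
structure IsCyc (C : Graph α β) (e : β) (n : ℕ) (v : ℕ → α) (ε : ℕ → β) : Prop where
  pos : 0 < n
  inj : Set.InjOn v (Set.Iic n)
  vertexSet_eq : V(C) = v '' Set.Iic n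
  edgeSet_eq : E(C) = insert e (ε '' Set.Iio n)
  isLink : ∀ i < n, C.IsLink (ε i) (v i) (v (i + 1))
  closing : C.IsLink e (v n) (v 0)
  ne_closing : ∀ i < n, ε i ≠ e

theorem IsCircle.exists_isCyc (hC : C.IsCircle) (hfin : V(C).Finite)
    (hloop : ∀ f x, ¬ C.IsLink f x x) (he : e ∈ E(C)) : ∃ n v ε, C.IsCyc e n v ε := by
  obtain ⟨p, q, hpq⟩ := exists_isLink_of_mem_edgeSet he
  obtain ⟨n, v, ε, h0, hn, hinj, hl, hV, hE⟩ := (hC.exists_isPath hfin hloop hpq).exists_seq e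
  have hne : ∀ i < n, ε i ≠ e := by
    intro i hi h
    have : e ∈ E(C) \ {e} := by rw [hE]; exact ⟨i, hi, h⟩
    exact this.2 rfl
  refine ⟨n, v, ε, ?_, hinj, hV, ?_, hl, by rw [h0, hn]; exact hpq.symm, hne⟩
  · rcases Nat.eq_zero_or_pos n with rfl | h
    · rw [← h0, ← hn] at hpq
      exact absurd hpq (hloop _ _)
    · exact h
  · rw [← hE, Set.insert_sdiff_singleton, Set.insert_eq_of_mem he]

namespace IsCyc

theorem v_inj (h : C.IsCyc e n v ε) {i j : ℕ} (hi : i ≤ n) (hj : j ≤ n) (hij : v i = v j) :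
    i = j := h.inj hi hj hij

theorem v_mem (h : C.IsCyc e n v ε) {i : ℕ} (hi : i ≤ n) : v i ∈ V(C) := by
  rw [h.vertexSet_eq]; exact ⟨i, hi, rfl⟩

theorem exists_index (h : C.IsCyc e n v ε) {x : α} (hx : x ∈ V(C)) : ∃ i ≤ n, v i = x := by
  rw [h.vertexSet_eq] at hx; exact hx

theorem edge_mem (h : C.IsCyc e n v ε) {i : ℕ} (hi : i < n) : ε i ∈ E(C) := (h.isLink i hi).edge_mem

theorem mem_image_iff (h : C.IsCyc e n v ε) {i : ℕ} (hi : i ≤ n) {S : Set ℕ} (hS : S ⊆ Set.Iic n) :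
    v i ∈ v '' S ↔ i ∈ S := by
  constructor
  · rintro ⟨j, hj, hji⟩
    rwa [← h.v_inj (hS hj) hi hji]
  · exact fun hi => ⟨i, hi, rfl⟩

theorem ε_inj (h : C.IsCyc e n v ε) {i j : ℕ} (hi : i < n) (hj : j < n) (hij : ε i = ε j) :
    i = j := by
  have h1 := h.isLink i hi
  rw [hij] at h1
  rcases h1.eq_and_eq_or_eq_and_eq (h.isLink j hj) with ⟨h2, -⟩ | ⟨h2, h3⟩
  · exact h.v_inj hi.le hj.le h2
  · have := h.v_inj hi.le hj h2
    have := h.v_inj hi hj.le h3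
    omega

theorem arc (h : C.IsCyc e n v ε) {i j : ℕ} (hij : i ≤ j) (hj : j ≤ n) :
    C.IsPath (v i) (v j) (v '' Set.Icc i j) (ε '' Set.Ico i j) := by
  induction j, hij using Nat.le_induction with
  | base =>
    simpa using IsPath.nil (h.v_mem hj)
  | succ j hij ih =>
    have h1 := (ih (by omega)).snoc (h.isLink j (by omega)) (by
      rintro ⟨m, hm, hmj⟩
      simp only [Set.mem_Icc] at hm
      have := h.v_inj (by omega) hj hmj
      omega)
    rw [← Set.image_insert_eq, ← Set.image_insert_eq] at h1
    convert h1 using 2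
    · ext m; simp only [Set.mem_Icc, Set.mem_insert_iff]; omega
    · ext m; simp only [Set.mem_Ico, Set.mem_insert_iff]; omega

theorem outer_arc (h : C.IsCyc e n v ε) {i j : ℕ} (hij : i < j) (hj : j ≤ n) :
    C.IsPath (v i) (v j) (v '' (Set.Iic i ∪ Set.Icc j n))
      (insert e (ε '' (Set.Iio i ∪ Set.Ico j n))) := by
  have h1 := (h.arc (Nat.zero_le i) (by omega)).symm
  have h2 := (h.arc hj le_rfl).symm
  have h3 := (h1.snoc h.closing.symm (by
    rintro ⟨m, hm, hmj⟩
    simp only [Set.mem_Icc] at hm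
    have := h.v_inj (by omega) le_rfl hmj
    omega)).concat h2 (by
    rintro _ ⟨rfl | ⟨m, hm, rfl⟩, ⟨k, hk, hkm⟩⟩
    · rfl
    · simp only [Set.mem_Icc] at hm hk
      have := h.v_inj (by omega) (by omega) hkm
      omega)
  convert h3 using 1
  · rw [Set.image_union]
    ext x
    simp only [Set.mem_union, Set.mem_insert_iff, Set.mem_image, Set.mem_Icc, Set.mem_Iic,
      Nat.zero_le, true_and]
    constructor
    · rintro (h | h)
      exacts [Or.inl (Or.inr h), Or.inr h]
    · rintro ((rfl | h) | h)
      · exact Or.inr ⟨n, ⟨hj, le_rfl⟩, rfl⟩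
      · exact Or.inl h
      · exact Or.inr h
  · rw [Set.image_union, Set.insert_union]
    congr 3
    ext m; simp

theorem isLink_cases (h : C.IsCyc e n v ε) {k : ℕ} (hk : k ≤ n) {f : β} {y : α}
    (hl : C.IsLink f (v k) y) :
    (k < n ∧ f = ε k ∧ y = v (k + 1)) ∨ (∃ m, k = m + 1 ∧ f = ε m ∧ y = v m) ∨
      (k = n ∧ f = e ∧ y = v 0) ∨ (k = 0 ∧ f = e ∧ y = v n) := by
  have hf := hl.edge_mem
  rw [h.edgeSet_eq] at hf
  rcases hf with rfl | ⟨i, hi, rfl⟩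
  · rcases hl.eq_and_eq_or_eq_and_eq h.closing with ⟨h1, h2⟩ | ⟨h1, h2⟩
    · exact Or.inr (Or.inr (Or.inl ⟨h.v_inj hk le_rfl h1, rfl, h2⟩))
    · exact Or.inr (Or.inr (Or.inr ⟨h.v_inj hk (Nat.zero_le _) h1, rfl, h2⟩))
  · simp only [Set.mem_Iio] at hi
    rcases hl.eq_and_eq_or_eq_and_eq (h.isLink i hi) with ⟨h1, h2⟩ | ⟨h1, h2⟩
    · obtain rfl := h.v_inj hk hi.le h1
      exact Or.inl ⟨hi, rfl, h2⟩
    · obtain rfl := h.v_inj hk hi h1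
      exact Or.inr (Or.inl ⟨i, rfl, rfl, h2⟩)

variable {a b : α} {X : Set α} {F : Set β}

/-- A path of the circle that starts at `v (k + 1)` and avoids `v k` follows the numbering upwards. -/
theorem path_up (h : C.IsCyc e n v ε) (hP : C.IsPath a b X F) : ∀ k j, a = v (k + 1) → b = v j →
    k + 1 ≤ j → j ≤ n → v k ∉ X → X = v '' Set.Icc (k + 1) j ∧ F = ε '' Set.Ico (k + 1) j := by
  induction hP with
  | @nil x hx =>
    rintro k j rfl hb hkj hj hk
    obtain rfl := h.v_inj (by omega) hj hb
    simp
  | @cons g x y z X F hl hx hp ih =>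
    rintro k j rfl rfl hkj hj hk
    have hne : k + 1 ≠ j := by
      rintro rfl
      exact hx hp.right_mem
    rcases h.isLink_cases (by omega) hl with ⟨-, rfl, rfl⟩ | ⟨m, hm, rfl, rfl⟩ | ⟨h1, -⟩ | ⟨h1, -⟩
    · obtain ⟨rfl, rfl⟩ := ih (k + 1) j rfl rfl (by omega) hj hx
      rw [← Set.image_insert_eq, ← Set.image_insert_eq]
      constructor <;> congr 1 <;> ext m <;>
        simp only [Set.mem_Icc, Set.mem_Ico, Set.mem_insert_iff] <;> omega
    · obtain rfl : k = m := by omega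
      exact absurd (Or.inr hp.left_mem) hk
    · omega
    · omega

/-- A path of the circle that starts at `v k` and avoids the next vertex follows the numbering
downwards. -/
theorem path_down (h : C.IsCyc e n v ε) (hP : C.IsPath a b X F) : ∀ k j, a = v k → b = v j →
    j ≤ k → k ≤ n → (k < n → v (k + 1) ∉ X) → (k = n → v 0 ∉ X) →
    X = v '' Set.Icc j k ∧ F = ε '' Set.Ico j k := by
  induction hP with
  | @nil x hx =>
    rintro k j rfl hb hkj hj - -
    obtain rfl := h.v_inj (by omega) (by omega) hb
    simp
  | @cons g x y z X F hl hx hp ih =>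
    rintro k j rfl rfl hkj hj hk hkn
    have hne : k ≠ j := by
      rintro rfl
      exact hx hp.right_mem
    rcases h.isLink_cases (by omega) hl with ⟨h1, -, rfl⟩ | ⟨m, rfl, rfl, rfl⟩ | ⟨h1, -, rfl⟩ | ⟨h1, -⟩
    · exact absurd (Or.inr hp.left_mem) (hk h1)
    · obtain ⟨rfl, rfl⟩ := ih m j rfl rfl (by omega) (by omega) (fun _ => hx) (by omega)
      rw [← Set.image_insert_eq, ← Set.image_insert_eq]
      constructor <;> congr 1 <;> ext m <;>
        simp only [Set.mem_Icc, Set.mem_Ico, Set.mem_insert_iff] <;> omega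
    · exact absurd (Or.inr hp.left_mem) (hkn h1)
    · omega

/-- A path of the circle from `v k` to a later vertex `v j` that avoids `v (k + 1)` runs down to `v 0`,
along the closing edge to `v n`, and down to `v j`. -/
theorem path_around (h : C.IsCyc e n v ε) (hP : C.IsPath a b X F) : ∀ k j, a = v k → b = v j →
    k < j → j ≤ n → v (k + 1) ∉ X →
    X = v '' (Set.Iic k ∪ Set.Icc j n) ∧ F = insert e (ε '' (Set.Iio k ∪ Set.Ico j n)) := by
  induction hP with
  | @nil x hx =>
    rintro k j rfl hb hkj hj -
    have := h.v_inj (by omega) (by omega) hb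
    omega
  | @cons g x y z X F hl hx hp ih =>
    rintro k j rfl rfl hkj hj hk
    rcases h.isLink_cases (by omega) hl with
      ⟨h1, -, rfl⟩ | ⟨m, rfl, rfl, rfl⟩ | ⟨h1, -, rfl⟩ | ⟨rfl, rfl, rfl⟩
    · exact absurd (Or.inr hp.left_mem) hk
    · obtain ⟨rfl, rfl⟩ := ih m j rfl rfl (by omega) (by omega) hx
      rw [← Set.image_insert_eq, Set.insert_comm, ← Set.image_insert_eq]
      constructor
      · congr 1; ext m
        simp only [Set.mem_Icc, Set.mem_Iic, Set.mem_union, Set.mem_insert_iff]; omega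
      · congr 2; ext m
        simp only [Set.mem_Ico, Set.mem_Iio, Set.mem_union, Set.mem_insert_iff]; omega
    · omega
    · obtain ⟨rfl, rfl⟩ := h.path_down hp n j rfl rfl hj le_rfl (by omega) (fun _ => hx)
      rw [← Set.image_insert_eq]
      constructor
      · congr 1; ext m
        simp only [Set.mem_Icc, Set.mem_Iic, Set.mem_union, Set.mem_insert_iff]; omega
      · congr 2; ext m
        simp only [Set.mem_Ico, Set.mem_Iio, Set.mem_union]; omega

/-- A path of a circle between two different vertices is one of the two arcs between them. -/
theorem path_eq_arc (h : C.IsCyc e n v ε) {i j : ℕ} (hij : i < j) (hj : j ≤ n)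
    (hP : C.IsPath (v i) (v j) X F) :
    (X = v '' Set.Icc i j ∧ F = ε '' Set.Ico i j) ∨
      (X = v '' (Set.Iic i ∪ Set.Icc j n) ∧ F = insert e (ε '' (Set.Iio i ∪ Set.Ico j n))) := by
  generalize hx : v i = x at hP
  generalize hy : v j = y at hP
  cases hP with
  | nil =>
    have := h.v_inj (by omega) hj (hx.trans hy.symm)
    omega
  | @cons g _ y' _ X F hl hxX hp =>
    subst hx hy
    rcases h.isLink_cases (by omega) hl with
      ⟨h1, rfl, rfl⟩ | ⟨m, rfl, rfl, rfl⟩ | ⟨h1, rfl, rfl⟩ | ⟨rfl, rfl, rfl⟩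
    · left
      obtain ⟨rfl, rfl⟩ := h.path_up hp i j rfl rfl hij hj hxX
      rw [← Set.image_insert_eq, ← Set.image_insert_eq]
      constructor <;> congr 1 <;> ext m <;>
        simp only [Set.mem_Icc, Set.mem_Ico, Set.mem_insert_iff] <;> omega
    · right
      obtain ⟨rfl, rfl⟩ := h.path_around hp m j rfl rfl (by omega) hj hxX
      rw [← Set.image_insert_eq, Set.insert_comm, ← Set.image_insert_eq]
      constructor
      · congr 1; ext m
        simp only [Set.mem_Icc, Set.mem_Iic, Set.mem_union, Set.mem_insert_iff]; omega
      · congr 2; ext m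
        simp only [Set.mem_Ico, Set.mem_Iio, Set.mem_union, Set.mem_insert_iff]; omega
    · omega
    · right
      obtain ⟨rfl, rfl⟩ := h.path_down hp n j rfl rfl hj le_rfl (by omega) (fun _ => hxX)
      rw [← Set.image_insert_eq]
      constructor
      · congr 1; ext m
        simp only [Set.mem_Icc, Set.mem_Iic, Set.mem_union, Set.mem_insert_iff]; omega
      · congr 2; ext m
        simp only [Set.mem_Ico, Set.mem_Iio, Set.mem_union]; omega

end IsCyc

end

section

/-! ### Signs along a numbered circle -/

variable {α β : Type*} {B C D D' : Graph α β} {e : β} {n : ℕ} {v : ℕ → α} {ε : ℕ → β}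
  {σ : β → ℤˣ} {X X' : Set α} {F F' : Set β}

/-- The product of the signs of the first `i` edges of the sequence `ε`. -/
def prefixSign (σ : β → ℤˣ) (ε : ℕ → β) : ℕ → ℤˣ
  | 0 => 1
  | i + 1 => prefixSign σ ε i * σ (ε i)

theorem IsCyc.edgeSign_Ico (h : C.IsCyc e n v ε) {i j : ℕ} (hij : i ≤ j) (hj : j ≤ n) :
    edgeSign σ (ε '' Set.Ico i j) = prefixSign σ ε i * prefixSign σ ε j := by
  induction j, hij using Nat.le_induction with
  | base => simp [Int.units_mul_self]
  | succ j hij ih =>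
    have h1 : Set.Ico i (j + 1) = insert j (Set.Ico i j) := by
      ext m; simp only [Set.mem_Ico, Set.mem_insert_iff]; omega
    rw [h1, Set.image_insert_eq, edgeSign_insert ((Set.finite_Ico i j).image ε), ih (by omega),
      prefixSign]
    · rw [mul_left_comm, mul_comm (σ (ε j))]
    · rintro ⟨m, hm, hmj⟩
      simp only [Set.mem_Ico] at hm
      have := h.ε_inj (by omega) (by omega) hmj
      omega

theorem IsCyc.sign_eq (h : C.IsCyc e n v ε) : C.sign σ = σ e * prefixSign σ ε n := by
  rw [sign_eq_edgeSign, h.edgeSet_eq, edgeSign_insert ((Set.finite_Iio n).image ε)]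
  · have := h.edgeSign_Ico (σ := σ) (Nat.zero_le n) le_rfl
    rw [show Set.Ico 0 n = Set.Iio n by ext m; simp] at this
    rw [this, prefixSign, one_mul]
  · rintro ⟨m, hm, hme⟩
    exact h.ne_closing m hm hme

theorem IsPath.edgeSign_concat {G : Graph α β} {x y x' y' : α} (h₁ : G.IsPath x y X F)
    (h₂ : G.IsPath x' y' X' F') {w : α} (h : X ∩ X' ⊆ {w}) :
    edgeSign σ (F ∪ F') = edgeSign σ F * edgeSign σ F' :=
  edgeSign_union h₁.finite_edges h₂.finite_edges
    (h₁.edges_disjoint h₂ (Set.subsingleton_singleton.anti h))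

theorem IsPath.edges_nonempty {G : Graph α β} {x y : α} (h : G.IsPath x y X F) (hxy : x ≠ y) :
    F.Nonempty := by
  cases h with
  | nil => exact absurd rfl hxy
  | cons => exact ⟨_, Or.inl rfl⟩

/-! ### The circle is the only one of its sign through `e` -/

/-- Every circle of `B` through `e` other than `C` has the sign opposite to that of `C`. -/
def IsSignUnique (B : Graph α β) (σ : β → ℤˣ) (e : β) (C : Graph α β) : Prop :=
  ∀ Z : Graph α β, Z ≤ B → Z.IsCircle → e ∈ E(Z) → Z ≠ C → Z.sign σ = -C.sign σ

theorem isBatteryIn_iff {s : ℤˣ} (hCB : C ≤ B) (hC : C.IsCircle) (he : e ∈ E(C)) :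
    B.IsBatteryIn σ e C s ↔ C.sign σ = s ∧ B.IsSignUnique σ e C := by
  constructor
  · rintro ⟨⟨-, -, hs, -⟩, hu⟩
    refine ⟨hs, fun Z hZ hZc heZ hne => ?_⟩
    by_contra hcon
    refine hne (hu Z hZ hZc ?_ heZ)
    rw [← hs]
    by_contra h
    exact hcon (Int.units_ne_iff_eq_neg.1 h)
  · rintro ⟨hs, hu⟩
    refine ⟨⟨hCB, hC, hs, he⟩, fun Z hZ hZc hZs heZ => ?_⟩
    by_contra hne
    have h1 := hu Z hZ hZc heZ hne
    rw [hZs, hs] at h1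
    exact units_ne_neg_self s h1

/-- A path from `v 0` to `v n` that leaves `C` forms with `e` a circle other than `C`, so its sign is
opposite to that of `C ∖ e`. -/
theorem IsSignUnique.edgeSign_eq (hu : B.IsSignUnique σ e C) (hcyc : C.IsCyc e n v ε)
    (hCB : C ≤ B) (hP : B.IsPath (v 0) (v n) X F)
    (he : e ∉ F) {f : β} (hf : f ∈ F) (hfC : f ∉ E(C)) : edgeSign σ F = -prefixSign σ ε n := by
  have hne : v 0 ≠ v n := fun h => by
    have := hcyc.v_inj (Nat.zero_le _) le_rfl h
    have := hcyc.pos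
    omega
  obtain ⟨Z, hZB, hZ, -, hZE⟩ := hP.exists_circle hne (hcyc.closing.mono hCB).symm he
  have hZC : Z ≠ C := by
    rintro rfl
    exact hfC (hZE ▸ Or.inr hf)
  have h := hu Z hZB hZ (hZE ▸ Or.inl rfl) hZC
  rw [hcyc.sign_eq, sign_eq_edgeSign, hZE, edgeSign_insert hP.finite_edges he, ← mul_neg] at h
  exact mul_left_cancel h

/-- The sign of a path `P` that leaves the circle at `v i` and returns to it at `v j` is opposite to
that of the arc between `v i` and `v j` avoiding `e`. -/
theorem IsSignUnique.edgeSign_jump (hu : B.IsSignUnique σ e C) (hcyc : C.IsCyc e n v ε)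
    (hCB : C ≤ B) {i j : ℕ} (hij : i < j) (hj : j ≤ n)
    (hP : B.IsPath (v i) (v j) X F) (hX : X ∩ V(C) = {v i, v j}) (hF : ∀ f ∈ F, f ∉ E(C)) :
    edgeSign σ F = -(prefixSign σ ε i * prefixSign σ ε j) := by
  have hXm : ∀ m ≤ n, v m ∈ X → m = i ∨ m = j := by
    intro m hm hmX
    have : v m ∈ X ∩ V(C) := ⟨hmX, hcyc.v_mem hm⟩
    rw [hX] at this
    exact this.imp (hcyc.v_inj hm (by omega)) (hcyc.v_inj hm hj)
  have hA := (hcyc.arc (Nat.zero_le i) (by omega)).mono hCB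
  have hL := (hcyc.arc hj le_rfl).mono hCB
  have i1 : v '' Set.Icc 0 i ∩ X ⊆ {v i} := by
    rintro _ ⟨⟨m, hm, rfl⟩, hmX⟩
    simp only [Set.mem_Icc] at hm
    rcases hXm m (by omega) hmX with rfl | rfl
    · rfl
    · omega
  have hAP := hA.concat hP i1
  have i2 : (v '' Set.Icc 0 i ∪ X) ∩ v '' Set.Icc j n ⊆ {v j} := by
    rintro _ ⟨h, ⟨m, hm, rfl⟩⟩
    simp only [Set.mem_Icc] at hm
    rcases h with ⟨k, hk, hkm⟩ | h
    · simp only [Set.mem_Icc] at hk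
      have := hcyc.v_inj (by omega) (by omega) hkm
      omega
    · rcases hXm m (by omega) h with rfl | rfl
      · omega
      · rfl
  have hAPL := hAP.concat hL i2
  have hne : v i ≠ v j := fun h => by
    have := hcyc.v_inj (by omega) hj h
    omega
  obtain ⟨f, hf⟩ := hP.edges_nonempty hne
  have key := hu.edgeSign_eq hcyc hCB hAPL (by
    rintro ((⟨m, hm, hme⟩ | h) | ⟨m, hm, hme⟩)
    · exact hcyc.ne_closing m (by simp only [Set.mem_Ico] at hm; omega) hme
    · exact hF e h hcyc.closing.edge_mem
    · exact hcyc.ne_closing m (by simp only [Set.mem_Ico] at hm; omega) hme)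
    (Or.inl (Or.inr hf)) (hF f hf)
  rw [hAP.edgeSign_concat hL i2, hA.edgeSign_concat hP i1, hcyc.edgeSign_Ico (by omega) (by omega),
    hcyc.edgeSign_Ico hj le_rfl] at key
  revert key
  generalize prefixSign σ ε n = a
  generalize prefixSign σ ε i = b
  generalize prefixSign σ ε j = c
  generalize edgeSign σ F = d
  rw [prefixSign]
  revert a b c d
  decide

/-- Two disjoint paths that leave the circle at `v i`, `v k` and return to it at `v j`, `v l`
cannot have crossing or consecutive ends: together with `e` and the arcs from `v 0` to `v i`, between
`v j` and `v k`, and from `v l` to `v n` they would form a circle through `e` of the same sign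
as `C`. -/
theorem IsSignUnique.not_jumps (hu : B.IsSignUnique σ e C) (hcyc : C.IsCyc e n v ε)
    (hCB : C ≤ B) {i j k l : ℕ} (hj : j ≤ n) (hl : l ≤ n)
    (hij : i < j) (hik : i < k) (hjl : j < l) (hkl : k < l)
    (hP : B.IsPath (v i) (v j) X F) (hX : X ∩ V(C) = {v i, v j}) (hF : ∀ f ∈ F, f ∉ E(C))
    (hP' : B.IsPath (v k) (v l) X' F') (hX' : X' ∩ V(C) = {v k, v l}) (hF' : ∀ f ∈ F', f ∉ E(C))
    (hXX : X ∩ X' ⊆ V(C)) : False := by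
  have hXm : ∀ m ≤ n, v m ∈ X → m = i ∨ m = j := by
    intro m hm hmX
    have : v m ∈ X ∩ V(C) := ⟨hmX, hcyc.v_mem hm⟩
    rw [hX] at this
    exact this.imp (hcyc.v_inj hm (by omega)) (hcyc.v_inj hm hj)
  have hXm' : ∀ m ≤ n, v m ∈ X' → m = k ∨ m = l := by
    intro m hm hmX
    have : v m ∈ X' ∩ V(C) := ⟨hmX, hcyc.v_mem hm⟩
    rw [hX'] at this
    exact this.imp (hcyc.v_inj hm (by omega)) (hcyc.v_inj hm hl)
  have hA := (hcyc.arc (Nat.zero_le i) (by omega)).mono hCB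
  have hL := (hcyc.arc hl le_rfl).mono hCB
  have i1 : v '' Set.Icc 0 i ∩ X ⊆ {v i} := by
    rintro _ ⟨⟨m, hm, rfl⟩, hmX⟩
    simp only [Set.mem_Icc] at hm
    rcases hXm m (by omega) hmX with rfl | rfl
    · rfl
    · omega
  have hAP := hA.concat hP i1
  -- The arc from `v j` to `v k`, traversed upwards or downwards.
  obtain ⟨YM, FM, hM, hYM, hFM, hsM⟩ : ∃ YM FM, B.IsPath (v j) (v k) YM FM ∧
      (∀ x ∈ YM, ∃ m ≤ n, x = v m ∧ i < m ∧ m < l ∧ (m ≤ j ∨ m ≤ k) ∧ (j ≤ m ∨ k ≤ m)) ∧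
      (∀ f ∈ FM, ∃ m < n, f = ε m) ∧
      edgeSign σ FM = prefixSign σ ε j * prefixSign σ ε k := by
    rcases le_total j k with hjk | hjk
    · refine ⟨_, _, (hcyc.arc hjk (by omega)).mono hCB, ?_, ?_,
        hcyc.edgeSign_Ico hjk (by omega)⟩
      · rintro _ ⟨m, hm, rfl⟩
        simp only [Set.mem_Icc] at hm
        exact ⟨m, by omega, rfl, by omega, by omega, by omega, by omega⟩
      · rintro _ ⟨m, hm, rfl⟩
        simp only [Set.mem_Ico] at hm
        exact ⟨m, by omega, rfl⟩
    · refine ⟨_, _, (hcyc.arc hjk hj).symm.mono hCB, ?_, ?_,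
        (hcyc.edgeSign_Ico hjk hj).trans (mul_comm _ _)⟩
      · rintro _ ⟨m, hm, rfl⟩
        simp only [Set.mem_Icc] at hm
        exact ⟨m, by omega, rfl, by omega, by omega, by omega, by omega⟩
      · rintro _ ⟨m, hm, rfl⟩
        simp only [Set.mem_Ico] at hm
        exact ⟨m, by omega, rfl⟩
  have i2 : (v '' Set.Icc 0 i ∪ X) ∩ YM ⊆ {v j} := by
    rintro x ⟨h, hx⟩
    obtain ⟨m, hmn, rfl, hm⟩ := hYM x hx
    rcases h with ⟨k, hk, hkm⟩ | h
    · simp only [Set.mem_Icc] at hk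
      have := hcyc.v_inj (by omega) (by omega) hkm
      omega
    · rcases hXm m (by omega) h with rfl | rfl
      · omega
      · rfl
  have hAPM := hAP.concat hM i2
  have i3 : (v '' Set.Icc 0 i ∪ X ∪ YM) ∩ X' ⊆ {v k} := by
    rintro x ⟨(⟨m, hm, rfl⟩ | h) | h, hx⟩
    · simp only [Set.mem_Icc] at hm
      have := hXm' m (by omega) hx
      omega
    · obtain ⟨m, hm, rfl⟩ := hcyc.exists_index (hXX ⟨h, hx⟩)
      have h1 := hXm m hm h
      have h2 := hXm' m hm hx
      obtain rfl : m = k := by omega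
      rfl
    · obtain ⟨m, hmn, rfl, hm⟩ := hYM x h
      have h2 := hXm' m hmn hx
      obtain rfl : m = k := by omega
      rfl
  have hAPMP := hAPM.concat hP' i3
  have i4 : (v '' Set.Icc 0 i ∪ X ∪ YM ∪ X') ∩ v '' Set.Icc l n ⊆ {v l} := by
    rintro _ ⟨h, ⟨m, hm, rfl⟩⟩
    simp only [Set.mem_Icc] at hm
    rcases h with ((⟨k, hk, hkm⟩ | h) | h) | h
    · simp only [Set.mem_Icc] at hk
      have := hcyc.v_inj (by omega) (by omega) hkm
      omega
    · have := hXm m (by omega) h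
      omega
    · obtain ⟨k, hkn, hkm, hk⟩ := hYM _ h
      have := hcyc.v_inj (by omega) (by omega) hkm
      omega
    · have := hXm' m (by omega) h
      obtain rfl : m = l := by omega
      rfl
  have hall := hAPMP.concat hL i4
  have hne : v i ≠ v j := fun h => by
    have := hcyc.v_inj (by omega) hj h
    omega
  obtain ⟨f, hf⟩ := hP.edges_nonempty hne
  have key := hu.edgeSign_eq hcyc hCB hall (by
    rintro ((((⟨m, hm, hme⟩ | h) | h) | h) | ⟨m, hm, hme⟩)
    · exact hcyc.ne_closing m (by simp only [Set.mem_Ico] at hm; omega) hme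
    · exact hF e h hcyc.closing.edge_mem
    · obtain ⟨m, hm, hme⟩ := hFM e h
      exact hcyc.ne_closing m hm hme.symm
    · exact hF' e h hcyc.closing.edge_mem
    · exact hcyc.ne_closing m (by simp only [Set.mem_Ico] at hm; omega) hme)
    (Or.inl (Or.inl (Or.inl (Or.inr hf)))) (hF f hf)
  have s1 := hu.edgeSign_jump hcyc hCB hij hj hP hX hF
  have s2 := hu.edgeSign_jump hcyc hCB hkl hl hP' hX' hF'
  rw [hAPMP.edgeSign_concat hL i4, hAPM.edgeSign_concat hP' i3, hAP.edgeSign_concat hM i2,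
    hA.edgeSign_concat hP i1, hcyc.edgeSign_Ico (by omega) (by omega),
    hcyc.edgeSign_Ico hl le_rfl, s1, s2, hsM] at key
  revert key
  generalize prefixSign σ ε n = a
  generalize prefixSign σ ε i = b
  generalize prefixSign σ ε j = c
  generalize prefixSign σ ε k = d
  generalize prefixSign σ ε l = f
  rw [prefixSign]
  revert a b c d f
  decide

/-! ### Spans of bridges -/

/-- The bridge `D` of `C` is attached to `C` exactly at `v i` and `v j`, where `i < j ≤ n`. -/
def Span (B C : Graph α β) (n : ℕ) (v : ℕ → α) (D : Graph α β) (i j : ℕ) : Prop :=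
  B.IsBridge C D ∧ i < j ∧ j ≤ n ∧ C.attachments D = {v i, v j}

/-- Every bridge has exactly two vertices of attachment, and the arcs of the bridges that avoid the
closing edge are totally ordered by inclusion. -/
def IsNested (B C : Graph α β) (n : ℕ) (v : ℕ → α) : Prop :=
  (∀ D, B.IsBridge C D → ∃ i j, B.Span C n v D i j) ∧
    ∀ D D' i j k l, B.Span C n v D i j → B.Span C n v D' k l →
      (i ≤ k ∧ l ≤ j) ∨ (k ≤ i ∧ j ≤ l)

theorem IsCyc.exists_span (hcyc : C.IsCyc e n v ε) (hD : B.IsBridge C D)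
    (h : (C.attachments D).encard = 2) : ∃ i j, B.Span C n v D i j := by
  obtain ⟨x, y, hxy, hA⟩ := Set.encard_eq_two.1 h
  have hx : x ∈ C.attachments D := by rw [hA]; simp
  have hy : y ∈ C.attachments D := by rw [hA]; simp
  obtain ⟨i, hi, rfl⟩ := hcyc.exists_index hx.2
  obtain ⟨j, hj, rfl⟩ := hcyc.exists_index hy.2
  rcases lt_trichotomy i j with h | rfl | h
  · exact ⟨i, j, hD, h, hj, hA⟩
  · exact absurd rfl hxy
  · exact ⟨j, i, hD, h, hi, hA.trans (Set.pair_comm _ _)⟩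

theorem Span.encard_attachments (hcyc : C.IsCyc e n v ε) {i j : ℕ} (h : B.Span C n v D i j) :
    (C.attachments D).encard = 2 := by
  rw [h.2.2.2, Set.encard_pair]
  intro hij
  have := hcyc.v_inj (by have := h.2; omega) h.2.2.1 hij
  have := h.2.1
  omega

theorem Span.unique (hcyc : C.IsCyc e n v ε) {i j k l : ℕ} (h : B.Span C n v D i j)
    (h' : B.Span C n v D k l) : i = k ∧ j = l := by
  have hA := h.2.2.2.symm.trans h'.2.2.2
  obtain ⟨-, h1, h2, -⟩ := h
  obtain ⟨-, h3, h4, -⟩ := h'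
  rcases Set.pair_eq_pair_iff.1 hA with ⟨h5, h6⟩ | ⟨h5, h6⟩
  · exact ⟨hcyc.v_inj (by omega) (by omega) h5, hcyc.v_inj h2 h4 h6⟩
  · have := hcyc.v_inj (by omega) (by omega) h5
    have := hcyc.v_inj (by omega) (by omega) h6
    omega

theorem Span.exists_isPath {i j : ℕ} (hcyc : C.IsCyc e n v ε) (h : B.Span C n v D i j) :
    ∃ X F, B.IsPath (v i) (v j) X F ∧ X ∩ V(C) = {v i, v j} ∧ X ⊆ V(D) ∧ F ⊆ E(D) := by
  obtain ⟨hD, hij, hj, hA⟩ := h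
  refine hD.exists_isPath (hA ▸ by simp) (hA ▸ by simp) fun h => ?_
  have := hcyc.v_inj (by omega) hj h
  omega

/-- A bridge of a circle that is unique of its sign through `e` has exactly two vertices of attachment. -/
theorem IsSignUnique.attachments (hu : B.IsSignUnique σ e C) (hcyc : C.IsCyc e n v ε) (hCB : C ≤ B)
    (hB : B.IsBlock) (hD : B.IsBridge C D) : ∃ i j, B.Span C n v D i j := by
  obtain ⟨x, y, hxy, hx, hy⟩ := hB.exists_attachments hCB hcyc.closing hD
  -- Three attachments would give a tripod, and the signs of its three paths are inconsistent.
  have key : ∀ i j k, i < j → j < k → k ≤ n → v i ∈ C.attachments D → v j ∈ C.attachments D →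
      v k ∈ C.attachments D → False := by
    intro i j k hij hjk hk hi hj hk'
    obtain ⟨w, X₁, F₁, X₂, F₂, X₃, F₃, h1, h2, h3, h12, h13, h23, c1, c2, c3, d1, d2, d3⟩ :=
      hD.exists_tripod hi hj hk' (fun h => by have := hcyc.v_inj (by omega) (by omega) h; omega)
        (fun h => by have := hcyc.v_inj (by omega) (by omega) h; omega)
        (fun h => by have := hcyc.v_inj (by omega) (by omega) h; omega)
    have jump : ∀ {a b : ℕ} {X X' F F'}, a < b → b ≤ n → B.IsPath (v a) w X F →
        B.IsPath (v b) w X' F' → X ∩ X' ⊆ {w} → X ∩ V(C) = {v a} → X' ∩ V(C) = {v b} →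
        F ⊆ E(D) → F' ⊆ E(D) → edgeSign σ F * edgeSign σ F' =
          -(prefixSign σ ε a * prefixSign σ ε b) := by
      intro a b X X' F F' hab hb hP hP' hXX hX hX' hF hF'
      rw [← hP.edgeSign_concat hP' hXX]
      refine hu.edgeSign_jump hcyc hCB hab hb (hP.concat hP'.symm hXX) ?_ ?_
      · rw [Set.union_inter_distrib_right, hX, hX']; rfl
      · rintro f (hf | hf)
        exacts [hD.edge_notMem hCB (hF hf), hD.edge_notMem hCB (hF' hf)]
    have s1 := jump hij (by omega) h1 h2 h12 c1 c2 d1 d2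
    have s2 := jump hjk hk h2 h3 h23 c2 c3 d2 d3
    have s3 := jump (hij.trans hjk) hk h1 h3 h13 c1 c3 d1 d3
    revert s1 s2 s3
    generalize edgeSign σ F₁ = a
    generalize edgeSign σ F₂ = b
    generalize edgeSign σ F₃ = c
    generalize prefixSign σ ε i = p
    generalize prefixSign σ ε j = q
    generalize prefixSign σ ε k = r
    revert a b c p q r
    decide
  have key' : ∀ i j, i < j → j ≤ n → v i ∈ C.attachments D → v j ∈ C.attachments D →
      ∃ i j, B.Span C n v D i j := by
    intro i j hij hj hi hj'
    refine ⟨i, j, hD, hij, hj, Set.Subset.antisymm ?_ ?_⟩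
    · intro z hz
      obtain ⟨k, hk, rfl⟩ := hcyc.exists_index hz.2
      by_contra hcon
      have h1 : k ≠ i := by rintro rfl; exact hcon (Or.inl rfl)
      have h2 : k ≠ j := by rintro rfl; exact hcon (Or.inr rfl)
      rcases lt_or_gt_of_ne h1 with h1 | h1
      · exact key k i j h1 hij hj hz hi hj'
      · rcases lt_or_gt_of_ne h2 with h2 | h2
        · exact key i k j h1 h2 hj hi hz hj'
        · exact key i j k hij h2 hk hi hj' hz
    · rintro z (rfl | rfl)
      exacts [hi, hj']
  obtain ⟨i, hi, rfl⟩ := hcyc.exists_index hx.2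
  obtain ⟨j, hj, rfl⟩ := hcyc.exists_index hy.2
  rcases lt_trichotomy i j with h | rfl | h
  · exact key' i j h hj hx hy
  · exact absurd rfl hxy
  · exact key' j i h hi hy hx

/-- The bridges of a circle that is unique of its sign through `e` have nested spans: paths through
bridges with other spans could be combined as in `IsSignUnique.not_jumps`. -/
theorem IsSignUnique.isNested (hu : B.IsSignUnique σ e C) (hcyc : C.IsCyc e n v ε) (hCB : C ≤ B)
    (hB : B.IsBlock) : B.IsNested C n v := by
  refine ⟨fun D hD => hu.attachments hcyc hCB hB hD, fun D D' i j k l h h' => ?_⟩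
  by_cases hDD : D = D'
  · subst hDD
    obtain ⟨rfl, rfl⟩ := h.unique hcyc h'
    exact Or.inl ⟨le_rfl, le_rfl⟩
  · by_contra hcon
    obtain ⟨X, F, hP, hX, hXD, hF⟩ := h.exists_isPath hcyc
    obtain ⟨X', F', hP', hX', hXD', hF'⟩ := h'.exists_isPath hcyc
    have hFC : ∀ f ∈ F, f ∉ E(C) := fun f hf => h.1.edge_notMem hCB (hF hf)
    have hFC' : ∀ f ∈ F', f ∉ E(C) := fun f hf => h'.1.edge_notMem hCB (hF' hf)
    have hXX : X ∩ X' ⊆ V(C) := by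
      rintro x ⟨hx, hx'⟩
      by_contra hxC
      exact hDD (h.1.eq_of_mem h'.1 (hXD hx) (hXD' hx') hxC)
    obtain ⟨-, h1, h2, -⟩ := h
    obtain ⟨-, h3, h4, -⟩ := h'
    rcases le_total i k with hik | hik
    · exact hu.not_jumps hcyc hCB h2 h4 h1 (by omega) (by omega) h3 hP hX hFC hP' hX' hFC' hXX
    · exact hu.not_jumps hcyc hCB h4 h2 h3 (by omega) (by omega) h1 hP' hX' hFC' hP hX hFC
        (by rwa [Set.inter_comm])

end

section

/-! ### Extending a switching function over the bridges -/

variable {α β : Type*} {B C D D' : Graph α β} {σ : β → ℤˣ} {X W : Set α} {F F' : Set β}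
  {u w x y : α} {b : β}

/-- A function that agrees at the ends of a path with the sign of the path can be changed at interior
vertices of the path so that it switches all edges of the path to `+`. -/
theorem IsPath.exists_switching (hP : B.IsPath x y X F) : ∀ ζ : α → ℤˣ, edgeSign σ F = ζ x * ζ y →
    ∃ ζ' : α → ℤˣ, (∀ a, (a ∉ X ∨ a = x ∨ a = y) → ζ' a = ζ a) ∧
      ∀ f ∈ F, ∀ a b, B.IsLink f a b → ζ' a * σ f * ζ' b = 1 := by
  classical
  induction hP with
  | nil => exact fun ζ _ => ⟨ζ, fun _ _ => rfl, by simp⟩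
  | @cons g x y z X F hl hx hp ih =>
    intro ζ hs
    have hgF : g ∉ F := fun hg => hx (hp.inc_mem hg hl.inc_left)
    rw [edgeSign_insert hp.finite_edges hgF] at hs
    obtain ⟨ζ', h1, h2, h3⟩ : ∃ ζ' : α → ℤˣ, (∀ a, (a ∉ insert x X ∨ a = x ∨ a = z) → ζ' a = ζ a) ∧
        (∀ f ∈ F, ∀ a b, B.IsLink f a b → ζ' a * σ f * ζ' b = 1) ∧ ζ' x * σ g * ζ' y = 1 := by
      by_cases hyz : y = z
      · subst hyz
        obtain ⟨-, rfl⟩ := hp.eq_singleton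
        refine ⟨ζ, fun _ _ => rfl, by simp, ?_⟩
        rw [edgeSign_empty, mul_one] at hs
        rw [hs, ← mul_assoc, Int.units_mul_self, one_mul, Int.units_mul_self]
      · have hxy : x ≠ y := by rintro rfl; exact hx hp.left_mem
        obtain ⟨ζ', h1, h2⟩ := ih (Function.update ζ y (ζ x * σ g)) (by
          rw [Function.update_self, Function.update_of_ne (Ne.symm hyz)]
          revert hs
          generalize edgeSign σ F = a
          generalize ζ x = b
          generalize ζ z = c
          generalize σ g = d
          revert a b c d
          decide)
        refine ⟨ζ', ?_, h2, ?_⟩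
        · intro a ha
          have hay : a ≠ y := by
            rintro rfl
            rcases ha with ha | ha | ha
            exacts [ha (Or.inr hp.left_mem), hxy ha.symm, hyz ha]
          rw [h1 a, Function.update_of_ne hay]
          rcases ha with ha | rfl | ha
          exacts [Or.inl fun h => ha (Or.inr h), Or.inl hx, Or.inr (Or.inr ha)]
        · rw [h1 x (Or.inl hx), h1 y (Or.inr (Or.inl rfl)), Function.update_self,
            Function.update_of_ne hxy, Int.units_mul_self]
    refine ⟨ζ', h1, ?_⟩
    rintro f (rfl | hf) a b hab
    · rcases hab.eq_and_eq_or_eq_and_eq hl with ⟨rfl, rfl⟩ | ⟨rfl, rfl⟩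
      · exact h3
      · rw [← h3]
        ac_rfl
    · exact h2 f hf a b hab

/-- The vertices `u` and `w` of the bridge `D` are joined to different vertices of attachment by
disjoint paths of `D` with vertices in `W` and edges in `F`. -/
def IsLinkedIn (B C D : Graph α β) (W : Set α) (F : Set β) (u w : α) : Prop :=
  ∃ x y X₁ F₁ X₂ F₂, x ∈ C.attachments D ∧ y ∈ C.attachments D ∧ B.IsPath x u X₁ F₁ ∧
    B.IsPath y w X₂ F₂ ∧ Disjoint X₁ X₂ ∧ X₁ ⊆ W ∧ X₂ ⊆ W ∧ F₁ ⊆ E(D) ∩ F ∧ F₂ ⊆ E(D) ∩ F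

theorem IsLinkedIn.symm (h : B.IsLinkedIn C D W F u w) : B.IsLinkedIn C D W F w u := by
  obtain ⟨x, y, X₁, F₁, X₂, F₂, hx, hy, h1, h2, hd, a1, a2, a3, a4⟩ := h
  exact ⟨y, x, X₂, F₂, X₁, F₁, hy, hx, h2, h1, hd.symm, a2, a1, a4, a3⟩

/-- Linked vertices remain linked when they are moved along disjoint paths leaving `W`. -/
theorem IsLinkedIn.extend (h : B.IsLinkedIn C D W F u w) {u' w' : α} {Y₁ Y₂ Y : Set α}
    {G₁ G₂ G : Set β} (h₁ : B.IsPath u u' Y₁ G₁) (h₂ : B.IsPath w w' Y₂ G₂) (hd : Disjoint Y₁ Y₂)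
    (hW₁ : Y₁ ∩ W ⊆ {u}) (hW₂ : Y₂ ∩ W ⊆ {w}) (hY₁ : Y₁ ⊆ Y) (hY₂ : Y₂ ⊆ Y) (hGD : G ⊆ E(D))
    (hG₁ : G₁ ⊆ G) (hG₂ : G₂ ⊆ G) : B.IsLinkedIn C D (W ∪ Y) (F ∪ G) u' w' := by
  obtain ⟨x, y, X₁, F₁, X₂, F₂, hx, hy, p1, p2, hXd, a1, a2, a3, a4⟩ := h
  refine ⟨x, y, _, _, _, _, hx, hy, p1.concat h₁ fun a ha => hW₁ ⟨ha.2, a1 ha.1⟩,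
    p2.concat h₂ fun a ha => hW₂ ⟨ha.2, a2 ha.1⟩, ?_, Set.union_subset_union a1 hY₁,
    Set.union_subset_union a2 hY₂, ?_, ?_⟩
  · rw [Set.disjoint_left] at hXd hd ⊢
    rintro a (ha | ha) (ha' | ha')
    · exact hXd ha ha'
    · have : a = w := hW₂ ⟨ha', a1 ha⟩
      subst this
      exact hXd ha p2.right_mem
    · have : a = u := hW₁ ⟨ha, a2 ha'⟩
      subst this
      exact hXd p1.right_mem ha'
    · exact hd ha ha'
  · rintro f (hf | hf)
    exacts [⟨(a3 hf).1, Or.inl (a3 hf).2⟩, ⟨hGD (hG₁ hf), Or.inr (hG₁ hf)⟩]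
  · rintro f (hf | hf)
    exacts [⟨(a4 hf).1, Or.inl (a4 hf).2⟩, ⟨hGD (hG₂ hf), Or.inr (hG₂ hf)⟩]

/-- Adding an ear of the bridge `D` to `(W, F)` preserves the linking property. -/
theorem isLinkedIn_ear (hDB : D ≤ B) (hlink : ∀ u w, u ∈ V(D) → w ∈ V(D) → u ∈ W → w ∈ W → u ≠ w →
      B.IsLinkedIn C D W F u w) (hu : u ∈ V(D)) (hw : w ∈ V(D)) (huw : u ≠ w)
    (hP : B.IsPath u w X F') (hX : X ∩ W = {u, w}) (hF' : F' ⊆ E(D)) {u' w' : α}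
    (hu' : u' ∈ V(D)) (hw' : w' ∈ V(D)) (hu'W : u' ∈ W ∪ X) (hw'W : w' ∈ W ∪ X) (hne : u' ≠ w') :
    B.IsLinkedIn C D (W ∪ X) (F ∪ F') u' w' := by
  have huW : u ∈ W := (hX.symm.subset (Or.inl rfl)).2
  have hwW : w ∈ W := (hX.symm.subset (Or.inr rfl)).2
  have hD : B.IsLinkedIn C D W F u w := hlink u w hu hw huW hwW huw
  -- Both vertices lie on the ear.
  have both : ∀ u' w', u' ∈ X → w' ∈ X → u' ≠ w' → B.IsLinkedIn C D (W ∪ X) (F ∪ F') u' w' := by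
    intro u' w' hu' hw' hne
    have ordered : ∀ u' w', u' ≠ w' → ∀ X₁ F₁ X₂ F₂, B.IsPath u u' X₁ F₁ → B.IsPath u' w X₂ F₂ →
        X₁ ∩ X₂ = {u'} → X = X₁ ∪ X₂ → F' = F₁ ∪ F₂ → w' ∈ X₂ →
        B.IsLinkedIn C D (W ∪ X) (F ∪ F') u' w' := by
      intro u' w' hne X₁ F₁ X₂ F₂ h1 h2 h12 hXeq hFeq hw'
      obtain ⟨X₃, F₃, X₄, F₄, h3, h4, h34, rfl, rfl⟩ := h2.split hw'
      have hu4 : u' ∉ X₄ := fun h => hne (h34.subset ⟨h3.left_mem, h⟩)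
      have hd : Disjoint X₁ X₄ := by
        rw [Set.disjoint_left]
        intro a ha ha'
        have : a = u' := h12.subset ⟨ha, Or.inr ha'⟩
        exact hu4 (this ▸ ha')
      refine hD.extend h1 h4.symm hd ?_ ?_ ?_ ?_ hF' ?_ ?_
      · rintro a ⟨ha, haW⟩
        rcases hX.subset ⟨hXeq ▸ Or.inl ha, haW⟩ with h | rfl
        · exact h
        · exact absurd h4.right_mem (Set.disjoint_left.1 hd ha)
      · rintro a ⟨ha, haW⟩
        rcases hX.subset ⟨hXeq ▸ Or.inr (Or.inr ha), haW⟩ with rfl | h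
        · exact absurd ha (Set.disjoint_left.1 hd h1.left_mem)
        · exact h
      · rw [hXeq]; exact Set.subset_union_left
      · rw [hXeq]; exact fun a ha => Or.inr (Or.inr ha)
      · rw [hFeq]; exact Set.subset_union_left
      · rw [hFeq]; exact fun a ha => Or.inr (Or.inr ha)
    obtain ⟨X₁, F₁, X₂, F₂, h1, h2, h12, hXeq, hFeq⟩ := hP.split hu'
    rw [hXeq] at hw'
    rcases hw' with hw' | hw'
    · obtain ⟨X₃, F₃, X₄, F₄, h3, h4, h34, rfl, rfl⟩ := h1.split hw'
      refine (ordered w' u' hne.symm X₃ F₃ (X₄ ∪ X₂) (F₄ ∪ F₂) h3 (h4.concat h2 ?_) ?_ ?_ ?_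
        (Or.inl h4.right_mem)).symm
      · exact fun a ha => h12.subset ⟨Or.inr ha.1, ha.2⟩
      · ext a
        constructor
        · rintro ⟨ha, ha' | ha'⟩
          · exact h34.subset ⟨ha, ha'⟩
          · have : a = u' := h12.subset ⟨Or.inl ha, ha'⟩
            subst this
            exact h34.subset ⟨ha, h4.right_mem⟩
        · rintro rfl
          exact ⟨h3.right_mem, Or.inl h4.left_mem⟩
      · rw [hXeq, Set.union_assoc]
      · rw [hFeq, Set.union_assoc]
    · exact ordered u' w' hne X₁ F₁ X₂ F₂ h1 h2 h12 hXeq hFeq hw'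
  -- One vertex is an interior vertex of the ear, the other lies in `W`.
  have mixed : ∀ u' w', u' ∈ X → u' ∉ W → w' ∈ V(D) → w' ∈ W →
      B.IsLinkedIn C D (W ∪ X) (F ∪ F') u' w' := by
    intro u' w' hu' hu'W hw' hw'W
    by_cases hw'u : w' = u ∨ w' = w
    · refine both u' w' hu' ?_ (by rintro rfl; exact hu'W hw'W)
      rcases hw'u with rfl | rfl
      exacts [hP.left_mem, hP.right_mem]
    · push Not at hw'u
      obtain ⟨X₁, F₁, X₂, F₂, h1, h2, h12, hXeq, hFeq⟩ := hP.split hu'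
      have hw'X : w' ∉ X := fun h => by
        rcases hX.subset ⟨h, hw'W⟩ with h | h
        exacts [hw'u.1 h, hw'u.2 h]
      have hl := (hlink u w' hu hw' huW hw'W (Ne.symm hw'u.1)).extend (Y := X ∪ {w'}) h1
        (.nil (hDB.1 hw'))
        (by
          rw [Set.disjoint_singleton_right]
          exact fun h => hw'X (hXeq ▸ Or.inl h)) ?_ (by simp) (by
            rw [hXeq]; exact fun a ha => Or.inl (Or.inl ha)) (by simp) hF'
        (by rw [hFeq]; exact Set.subset_union_left) (by simp)
      · have : W ∪ (X ∪ {w'}) = W ∪ X := by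
          ext a
          constructor
          · rintro (h | h | rfl)
            exacts [Or.inl h, Or.inr h, Or.inl hw'W]
          · rintro (h | h)
            exacts [Or.inl h, Or.inr (Or.inl h)]
        rwa [this] at hl
      · rintro a ⟨ha, haW⟩
        rcases hX.subset ⟨hXeq ▸ Or.inl ha, haW⟩ with h | rfl
        · exact h
        · have : a = u' := h12.subset ⟨ha, h2.right_mem⟩
          exact absurd (this ▸ haW) hu'W
  by_cases h1 : u' ∈ W <;> by_cases h2 : w' ∈ W
  · obtain ⟨x, y, X₁, F₁, X₂, F₂, hx, hy, p1, p2, hXd, a1, a2, a3, a4⟩ :=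
      hlink u' w' hu' hw' h1 h2 hne
    exact ⟨x, y, X₁, F₁, X₂, F₂, hx, hy, p1, p2, hXd, fun _ h => Or.inl (a1 h),
      fun _ h => Or.inl (a2 h), fun _ h => ⟨(a3 h).1, Or.inl (a3 h).2⟩,
      fun _ h => ⟨(a4 h).1, Or.inl (a4 h).2⟩⟩
  · exact (mixed w' u' (hw'W.resolve_left h2) h2 hu' h1).symm
  · exact mixed u' w' (hu'W.resolve_left h1) h1 hw' h2
  · exact both u' w' (hu'W.resolve_left h1) (hw'W.resolve_left h2) hne

/-- If `(W, F)` contains the circle `C` but not all edges of the block `B`, it has an ear in some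
bridge of `C`. -/
theorem IsBlock.exists_ear (hB : B.IsBlock) (hloop : ∀ f x, ¬ B.IsLink f x x) (hCB : C ≤ B)
    {e : β} {p q : α} (he : C.IsLink e p q) (hCW : V(C) ⊆ W) (hCF : E(C) ⊆ F)
    (hinc : ∀ f ∈ F, ∀ x, B.Inc f x → x ∈ W) (hne : ∃ f ∈ E(B), f ∉ F) :
    ∃ D u w X F', B.IsBridge C D ∧ u ∈ V(D) ∧ w ∈ V(D) ∧ u ≠ w ∧ B.IsPath u w X F' ∧
      X ∩ W = {u, w} ∧ F' ⊆ E(D) ∧ X ⊆ V(D) ∧ Disjoint F' F := by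
  obtain ⟨f₀, hf₀, hf₀F⟩ := hne
  obtain ⟨f, u, w', hl, hfF, huW⟩ : ∃ f u w, B.IsLink f u w ∧ f ∉ F ∧ u ∈ W := by
    by_contra! hcon
    have hVW : ∀ y ∈ V(B), y ∈ W := by
      intro y hy
      have hr := hB.1.2 p (hCB.1 he.left_mem) y hy
      clear hy
      induction hr with
      | refl => exact hCW he.left_mem
      | tail _ h ih =>
        obtain ⟨k, hk⟩ := h
        by_cases hkF : k ∈ F
        · exact hinc k hkF _ hk.inc_right
        · exact absurd ih (hcon k _ _ hk hkF)
    obtain ⟨a, b, hab⟩ := exists_isLink_of_mem_edgeSet hf₀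
    exact hcon f₀ a b hab hf₀F (hVW a hab.left_mem)
  have huw : u ≠ w' := by rintro rfl; exact hloop _ _ hl
  obtain ⟨D, hD, hfD⟩ := exists_isBridge_of_mem_edgeSet hloop hl.edge_mem (fun h => hfF (hCF h))
  have huD := hD.inc_mem hfD hl.inc_left
  have hw'D := hD.inc_mem hfD hl.inc_right
  by_cases hw' : w' ∈ W
  · refine ⟨D, u, w', {u, w'}, {f}, hD, huD, hw'D, huw, ?_, ?_, by simpa using hfD, ?_, ?_⟩
    · simpa using IsPath.cons hl (by simpa using huw) (.nil hl.right_mem)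
    · exact Set.inter_eq_left.2 (Set.insert_subset huW (by simpa using hw'))
    · exact Set.insert_subset huD (by simpa using hw'D)
    · simpa using hfF
  · obtain ⟨z, X, F', hz, hzu, hP, hX⟩ := hB.exists_isPath_avoiding hl.left_mem huW hl.right_mem
      hw' (he.mono hCB) (hCW he.left_mem) (hCW he.right_mem)
    obtain ⟨hXD, hF'D⟩ := hD.subset_of_isPath hP hw'D (fun h => hw' (hCW h))
      (fun a ha => hX.subset ⟨ha.1, hCW ha.2⟩)
    have huX : u ∉ X := fun h => hzu (hX.subset ⟨h, huW⟩).symm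
    refine ⟨D, u, z, insert u X, insert f F', hD, huD, hXD hP.right_mem, hzu.symm,
      .cons hl huX hP, ?_, Set.insert_subset hfD hF'D, Set.insert_subset huD hXD, ?_⟩
    · rw [Set.insert_inter_of_mem huW, hX]
    · rw [Set.disjoint_left]
      rintro g (rfl | hg) hgF
      · exact hfF hgF
      · obtain ⟨a, b, hab, ha, hb, hl'⟩ := hP.exists_ends hg
        exact hab ((hX.subset ⟨ha, hinc g hgF _ hl'.inc_left⟩).trans
          (hX.subset ⟨hb, hinc g hgF _ hl'.inc_right⟩).symm)

/-- A switching function on the circle `C` that leaves `b` as the only negative edge of `C` extends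
to `B`, if every path through a bridge has the sign that it prescribes. -/
theorem IsBlock.isBalancingEdge (hB : B.IsBlock) (hloop : ∀ f x, ¬ B.IsLink f x x) (hCB : C ≤ B)
    (hE : E(B).Finite) (hb : b ∈ E(C)) (ζ₀ : α → ℤˣ)
    (hC : ∀ f x y, C.IsLink f x y → (ζ₀ x * σ f * ζ₀ y = -1 ↔ f = b))
    (hpath : ∀ D x y X F, B.IsBridge C D → x ∈ C.attachments D → y ∈ C.attachments D → x ≠ y →
      B.IsPath x y X F → X ⊆ V(D) → F ⊆ E(D) → edgeSign σ F = ζ₀ x * ζ₀ y) :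
    B.IsBalancingEdge σ b := by
  obtain ⟨p, q, hpq⟩ := exists_isLink_of_mem_edgeSet hb
  have main : ∀ (N : ℕ) (W : Set α) (F : Set β) (ζ : α → ℤˣ), V(C) ⊆ W → E(C) ⊆ F → W ⊆ V(B) →
      (∀ f ∈ F, ∀ x, B.Inc f x → x ∈ W) →
      (∀ f ∈ F, ∀ x y, B.IsLink f x y → (ζ x * σ f * ζ y = -1 ↔ f = b)) →
      (∀ x ∈ V(C), ζ x = ζ₀ x) →
      (∀ D, B.IsBridge C D → ∀ u w, u ∈ V(D) → w ∈ V(D) → u ∈ W → w ∈ W → u ≠ w →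
        B.IsLinkedIn C D W F u w) → (E(B) \ F).ncard = N → B.IsBalancingEdge σ b := by
    intro N
    induction N using Nat.strong_induction_on with
    | _ N ih =>
      intro W F ζ hCW hCF hWB hinc hζ hζ₀ hlink hN
      by_cases hne : ∃ f ∈ E(B), f ∉ F
      swap
      · push Not at hne
        exact ⟨(IsSubgraph.edgeSet_mono hCB) hb, ζ, fun f x y hl => hζ f (hne f hl.edge_mem) x y hl⟩
      obtain ⟨D, u, w, X, F', hD, hu, hw, huw, hP, hX, hF'D, hXD, hF'F⟩ :=
        hB.exists_ear hloop hCB hpq hCW hCF hinc hne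
      have huW : u ∈ W := (hX.symm.subset (Or.inl rfl)).2
      have hwW : w ∈ W := (hX.symm.subset (Or.inr rfl)).2
      have hbD : ∀ f ∈ E(D), f ≠ b := fun f hf h => hD.edge_notMem hCB hf (h ▸ hb)
      have hpos : ∀ f ∈ E(D) ∩ F, ∀ a c, B.IsLink f a c → ζ a * σ f * ζ c = 1 := by
        intro f hf a c hl
        by_contra h
        exact hbD f hf.1 ((hζ f hf.2 a c hl).1 (Int.units_ne_iff_eq_neg.1 h))
      have hs : edgeSign σ F' = ζ u * ζ w := by
        obtain ⟨x, y, X₁, F₁, X₂, F₂, hx, hy, p1, p2, hXd, a1, a2, a3, a4⟩ :=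
          hlink D hD u w hu hw huW hwW huw
        have i1 : X₁ ∩ X ⊆ {u} := by
          rintro a ⟨ha, haX⟩
          rcases hX.subset ⟨haX, a1 ha⟩ with h | rfl
          · exact h
          · exact absurd p2.right_mem (Set.disjoint_left.1 hXd ha)
        have i2 : (X₁ ∪ X) ∩ X₂ ⊆ {w} := by
          rintro a ⟨ha | ha, ha2⟩
          · exact absurd ha2 (Set.disjoint_left.1 hXd ha)
          · rcases hX.subset ⟨ha, a2 ha2⟩ with rfl | h
            · exact absurd ha2 (Set.disjoint_left.1 hXd p1.right_mem)
            · exact h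
        have hall := (p1.concat hP i1).concat p2.symm i2
        have hxy : x ≠ y := by
          rintro rfl
          exact Set.disjoint_left.1 hXd p1.left_mem p2.left_mem
        have hFD : F₁ ∪ F' ∪ F₂ ⊆ E(D) := by
          rintro f ((hf | hf) | hf)
          exacts [(a3 hf).1, hF'D hf, (a4 hf).1]
        have key := hpath D x y _ _ hD hx hy hxy hall
          (hall.vertices_subset hD.1 hx.1 hFD) hFD
        rw [(p1.concat hP i1).edgeSign_concat p2.symm i2, p1.edgeSign_concat hP i1,
          p1.edgeSign_eq (fun f hf => hpos f (a3 hf)), p2.edgeSign_eq (fun f hf => hpos f (a4 hf)),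
          ← hζ₀ x hx.2, ← hζ₀ y hy.2] at key
        revert key
        generalize edgeSign σ F' = a
        generalize ζ x = b
        generalize ζ y = c
        generalize ζ u = d
        generalize ζ w = f
        revert a b c d f
        decide
      obtain ⟨ζ', h1, h2⟩ := hP.exists_switching ζ hs
      have hζ' : ∀ a ∈ W, ζ' a = ζ a := by
        intro a ha
        refine h1 a ?_
        by_cases haX : a ∈ X
        · exact Or.inr (hX.subset ⟨haX, ha⟩)
        · exact Or.inl haX
      refine ih _ ?_ (W ∪ X) (F ∪ F') ζ' (fun a ha => Or.inl (hCW ha)) (fun a ha => Or.inl (hCF ha))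
        (Set.union_subset hWB hP.subset_vertexSet) ?_ ?_ ?_ ?_ rfl
      · rw [← hN]
        refine Set.ncard_lt_ncard ⟨fun f hf => ⟨hf.1, fun h => hf.2 (Or.inl h)⟩, fun h => ?_⟩
          hE.sdiff
        obtain ⟨f, hf⟩ := hP.edges_nonempty huw
        exact (h ⟨hP.subset_edgeSet hf, Set.disjoint_left.1 hF'F hf⟩).2 (Or.inr hf)
      · rintro f (hf | hf) x hx
        exacts [Or.inl (hinc f hf x hx), Or.inr (hP.inc_mem hf hx)]
      · rintro f (hf | hf) x y hl
        · rw [hζ' x (hinc f hf x hl.inc_left), hζ' y (hinc f hf y hl.inc_right)]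
          exact hζ f hf x y hl
        · rw [h2 f hf x y hl]
          exact ⟨fun h => absurd h (by decide), fun h => absurd h (hbD f (hF'D hf))⟩
      · intro x hx
        rw [hζ' x (hCW hx), hζ₀ x hx]
      · intro D' hD' u' w' hu' hw' hu'W hw'W hne
        by_cases hDD : D' = D
        · subst hDD
          exact isLinkedIn_ear hD'.1 (hlink D' hD') hu hw huw hP hX hF'D hu' hw' hu'W hw'W hne
        · have hout : ∀ a ∈ V(D'), a ∈ W ∪ X → a ∈ W := by
            rintro a ha (h | h)
            · exact h
            · by_contra haW
              exact hDD (hD'.eq_of_mem hD ha (hXD h) fun h => haW (hCW h))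
          obtain ⟨x, y, X₁, F₁, X₂, F₂, hx, hy, p1, p2, hXd, a1, a2, a3, a4⟩ :=
            hlink D' hD' u' w' hu' hw' (hout u' hu' hu'W) (hout w' hw' hw'W) hne
          exact ⟨x, y, X₁, F₁, X₂, F₂, hx, hy, p1, p2, hXd, fun _ h => Or.inl (a1 h),
            fun _ h => Or.inl (a2 h), fun _ h => ⟨(a3 h).1, Or.inl (a3 h).2⟩,
            fun _ h => ⟨(a4 h).1, Or.inl (a4 h).2⟩⟩
  refine main _ V(C) E(C) ζ₀ le_rfl le_rfl hCB.1 ?_ ?_ (fun _ _ => rfl) ?_ rfl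
  · intro f hf x hx
    exact ((IsSubgraph.inc_congr hCB hf).2 hx).vertex_mem
  · intro f hf x y hl
    exact hC f x y ((IsSubgraph.isLink_iff hCB hf).2 hl)
  · intro D hD u w hu hw huC hwC huw
    exact ⟨u, w, {u}, ∅, {w}, ∅, ⟨hu, huC⟩, ⟨hw, hwC⟩, .nil (hCB.1 huC), .nil (hCB.1 hwC),
      by simpa using huw, by simpa using huC, by simpa using hwC, by simp, by simp⟩

end

section

/-! ### Edge colourings of circles -/

variable {α β κ : Type*} {B C D D' G Z : Graph α β} {σ : β → ℤˣ} {X : Set α} {F : Set β}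
  {p q u x y : α} {b e : β} {n : ℕ} {v : ℕ → α} {ε : ℕ → β} {col : β → κ}

/-- If the colour of the edges can change only at `x` and `y`, it is constant along a path avoiding
both. -/
theorem IsPath.color_eq (hP : G.IsPath u q X F)
    (hcol : ∀ w, w ≠ x → w ≠ y → ∀ f g, G.Inc f w → G.Inc g w → col f = col g)
    (he : G.Inc e q) (hx : x ∉ X) (hy : y ∉ X) :
    (∀ g, G.Inc g u → col g = col e) ∧ ∀ f ∈ F, col f = col e := by
  induction hP with
  | @nil z hz =>
    refine ⟨fun g hg => hcol z ?_ ?_ g e hg he, by simp⟩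
    · rintro rfl; exact hx rfl
    · rintro rfl; exact hy rfl
  | @cons f u w z X F hl huX hp ih =>
    obtain ⟨h1, h2⟩ := ih he (fun h => hx (Or.inr h)) (fun h => hy (Or.inr h))
    have hf := h1 f hl.inc_right
    refine ⟨fun g hg => ?_, ?_⟩
    · rw [← hf]
      refine hcol u ?_ ?_ g f hg hl.inc_left
      · rintro rfl; exact hx (Or.inl rfl)
      · rintro rfl; exact hy (Or.inl rfl)
    · rintro g (rfl | hg)
      exacts [hf, h2 g hg]

/-- A path that may pass through only one of the two vertices where the colour can change has at most
one change of colour. The edge `e` at its last vertex provides the final colour. -/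
theorem IsPath.color_mem_pair_of_notMem (hP : G.IsPath u q X F)
    (hcol : ∀ w, w ≠ x → w ≠ y → ∀ f g, G.Inc f w → G.Inc g w → col f = col g)
    (he : G.Inc e q) (hy : y ∉ X) :
    ∃ c, (u ≠ x → ∀ g, G.Inc g u → col g = c) ∧ (∀ f ∈ F, col f = col e ∨ col f = c) ∧
      (u = x → ∀ f ∈ F, col f = col e) := by
  induction hP with
  | @nil z hz =>
    refine ⟨col e, fun hzx g hg => hcol z hzx ?_ g e hg he, by simp, by simp⟩
    rintro rfl; exact hy rfl
  | @cons f u w z X F hl huX hp ih =>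
    have huy : u ≠ y := by rintro rfl; exact hy (Or.inl rfl)
    by_cases hux : u = x
    · subst hux
      obtain ⟨h1, h2⟩ := hp.color_eq hcol he huX (fun h => hy (Or.inr h))
      have : ∀ g ∈ insert f F, col g = col e := by
        rintro g (rfl | hg)
        exacts [h1 g hl.inc_right, h2 g hg]
      exact ⟨col e, fun h => absurd rfl h, fun g hg => Or.inl (this g hg), fun _ => this⟩
    · obtain ⟨c, h1, h2, h3⟩ := ih he (fun h => hy (Or.inr h))
      by_cases hwx : w = x
      · refine ⟨col f, fun _ g hg => hcol u hux huy g f hg hl.inc_left, ?_, fun h => absurd h hux⟩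
        rintro g (rfl | hg)
        exacts [Or.inr rfl, Or.inl (h3 hwx g hg)]
      · have hf := h1 hwx f hl.inc_right
        refine ⟨c, fun _ g hg => (hcol u hux huy g f hg hl.inc_left).trans hf, ?_,
          fun h => absurd h hux⟩
        rintro g (rfl | hg)
        exacts [Or.inr hf, h2 g hg]

theorem IsPath.color_mem_pair (hP : G.IsPath u q X F)
    (hcol : ∀ w, w ≠ x → w ≠ y → ∀ f g, G.Inc f w → G.Inc g w → col f = col g)
    (he : G.Inc e q) (hu : u ≠ x → u ≠ y → ∀ g, G.Inc g u → col g = col e) :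
    ∃ c, ∀ f ∈ F, col f = col e ∨ col f = c := by
  induction hP with
  | nil => exact ⟨col e, by simp⟩
  | @cons f u w z X F hl huX hp ih =>
    have aux : ∀ x y, (∀ w, w ≠ x → w ≠ y → ∀ f g, G.Inc f w → G.Inc g w → col f = col g) →
        y ∉ X → ∃ c, ∀ g ∈ insert f F, col g = col e ∨ col g = c := by
      intro x y hcol hy
      obtain ⟨c, h1, h2, h3⟩ := hp.color_mem_pair_of_notMem hcol he hy
      by_cases hwx : w = x
      · refine ⟨col f, ?_⟩
        rintro g (rfl | hg)
        exacts [Or.inr rfl, Or.inl (h3 hwx g hg)]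
      · refine ⟨c, ?_⟩
        rintro g (rfl | hg)
        exacts [Or.inr (h1 hwx g hl.inc_right), h2 g hg]
    by_cases hux : u = x
    · exact aux y x (fun w h1 h2 => hcol w h2 h1) (hux ▸ huX)
    · by_cases huy : u = y
      · exact aux x y hcol (huy ▸ huX)
      · have hf := hu hux huy f hl.inc_left
        obtain ⟨c, hc⟩ := ih he fun hwx hwy g hg => (hcol w hwx hwy g f hg hl.inc_right).trans hf
        refine ⟨c, ?_⟩
        rintro g (rfl | hg)
        exacts [Or.inl hf, hc g hg]

/-- If the colour of the edges can change at only two vertices, then a circle has edges of at most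
two colours. -/
theorem IsCircle.color_eq_or (hZ : Z.IsCircle) (hfin : V(Z).Finite)
    (hloop : ∀ f x, ¬ Z.IsLink f x x)
    (hcol : ∀ w, w ≠ x → w ≠ y → ∀ f g, Z.Inc f w → Z.Inc g w → col f = col g)
    {f g : β} (he : e ∈ E(Z)) (hf : f ∈ E(Z)) (hg : g ∈ E(Z)) :
    col f = col e ∨ col g = col e ∨ col f = col g := by
  obtain ⟨p, q, hpq⟩ := exists_isLink_of_mem_edgeSet he
  obtain ⟨c, hc⟩ := (hZ.exists_isPath hfin hloop hpq).color_mem_pair hcol hpq.inc_right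
    (fun h1 h2 g hg => hcol p h1 h2 g e hg hpq.inc_left)
  have hc' : ∀ f ∈ E(Z), col f = col e ∨ col f = c := by
    intro f hf
    by_cases hfe : f = e
    · exact Or.inl (hfe ▸ rfl)
    · exact hc f ⟨hf, hfe⟩
  rcases hc' f hf with h | h
  · exact Or.inl h
  · rcases hc' g hg with h' | h'
    · exact Or.inr (Or.inl h')
    · exact Or.inr (Or.inr (h.trans h'.symm))

/-! ### Circles through both handles -/

/-- In the nested situation, a circle through `e` and an edge of the arc that a bridge `D` cuts off
does not use the bridge: the ends of the arc separate the arc, the bridge and the rest of the graph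
from each other. -/
theorem IsNested.edge_notMem (hN : B.IsNested C n v) (hcyc : C.IsCyc e n v ε) (hCB : C ≤ B)
    (hV : V(B).Finite) (hloop : ∀ f x, ¬ B.IsLink f x x) {c d m : ℕ} (hD : B.Span C n v D c d)
    (hcm : c ≤ m) (hmd : m < d) (hZB : Z ≤ B) (hZ : Z.IsCircle) (he : e ∈ E(Z))
    (hm : ε m ∈ E(Z)) {g : β} (hg : g ∈ E(Z)) : g ∉ E(D) := by
  intro hgD
  have hcd := hD.2.1
  have hdn := hD.2.2.1
  set inside : β → Prop := fun f => (∃ i, c ≤ i ∧ i < d ∧ f = ε i) ∨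
    ∃ D' i j, D' ≠ D ∧ B.Span C n v D' i j ∧ c ≤ i ∧ j ≤ d ∧ f ∈ E(D') with hinside
  have hε : ∀ i, i < d → ε i ∈ E(C) := fun i hi => hcyc.edge_mem (by omega)
  have hin : ∀ {D' f}, B.IsBridge C D' → f ∈ E(D') → ((f ∈ E(D) ↔ D' = D) ∧
      (inside f ↔ D' ≠ D ∧ ∃ i j, B.Span C n v D' i j ∧ c ≤ i ∧ j ≤ d)) := by
    intro D' f hD' hf
    refine ⟨⟨fun h => hD'.eq_of_edge_mem hD.1 hf h, fun h => h ▸ hf⟩, ⟨?_, ?_⟩⟩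
    · rintro (⟨i, -, hi, rfl⟩ | ⟨D'', i, j, hne, hs, hci, hjd, hf'⟩)
      · exact absurd (hε i hi) (hD'.edge_notMem hCB hf)
      · obtain rfl := hD'.eq_of_edge_mem hs.1 hf hf'
        exact ⟨hne, i, j, hs, hci, hjd⟩
    · rintro ⟨hne, i, j, hs, hci, hjd⟩
      exact Or.inr ⟨D', i, j, hne, hs, hci, hjd, hf⟩
  have hbridge : ∀ f ∈ E(B), f ∉ E(C) → ∃ D' i j, B.Span C n v D' i j ∧ f ∈ E(D') := by
    intro f hf hfC
    obtain ⟨D', hD', hfD'⟩ := exists_isBridge_of_mem_edgeSet hloop hf hfC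
    obtain ⟨i, j, hs⟩ := hN.1 D' hD'
    exact ⟨D', i, j, hs, hfD'⟩
  have hkatt : ∀ {D' i j f k}, B.Span C n v D' i j → f ∈ E(D') → k ≤ n → B.Inc f (v k) →
      k = i ∨ k = j := by
    intro D' i j f k hs hf hk hi
    have : v k ∈ C.attachments D' := ⟨hs.1.inc_mem hf hi, hcyc.v_mem hk⟩
    rw [hs.2.2.2] at this
    have h1 := hs.2
    exact this.imp (hcyc.v_inj hk (by omega)) (hcyc.v_inj hk h1.2.1)
  have hcol : ∀ w, w ≠ v c → w ≠ v d → ∀ f g, B.Inc f w → B.Inc g w →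
      ((f ∈ E(D), inside f) : Prop × Prop) = (g ∈ E(D), inside g) := by
    intro w hwc hwd
    suffices h : ∃ P Q : Prop, ∀ f, B.Inc f w → ((f ∈ E(D) ↔ P) ∧ (inside f ↔ Q)) by
      obtain ⟨P, Q, h⟩ := h
      intro f g hf hg
      rw [Prod.mk.injEq]
      exact ⟨propext ((h f hf).1.trans (h g hg).1.symm), propext ((h f hf).2.trans (h g hg).2.symm)⟩
    by_cases hwC : w ∈ V(C)
    · obtain ⟨k, hk, rfl⟩ := hcyc.exists_index hwC
      have hkc : k ≠ c := by rintro rfl; exact hwc rfl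
      have hkd : k ≠ d := by rintro rfl; exact hwd rfl
      by_cases hkin : c < k ∧ k < d
      · refine ⟨False, True, fun f hf => ?_⟩
        by_cases hfC : f ∈ E(C)
        · refine ⟨⟨fun h => hD.1.edge_notMem hCB h hfC, False.elim⟩, ⟨fun _ => trivial, fun _ => ?_⟩⟩
          obtain ⟨y, hy⟩ := (IsSubgraph.inc_congr hCB hfC).2 hf
          rcases hcyc.isLink_cases hk hy with ⟨-, rfl, -⟩ | ⟨i, rfl, rfl, -⟩ | ⟨h, -⟩ | ⟨h, -⟩
          · exact Or.inl ⟨k, by omega, by omega, rfl⟩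
          · exact Or.inl ⟨i, by omega, by omega, rfl⟩
          · omega
          · omega
        · obtain ⟨D', i, j, hs, hfD'⟩ := hbridge f hf.edge_mem hfC
          have hki := hkatt hs hfD' hk hf
          have hne : D' ≠ D := by
            rintro rfl
            obtain ⟨rfl, rfl⟩ := hs.unique hcyc hD
            omega
          have hij := hs.2.1
          have hins : c ≤ i ∧ j ≤ d := by
            have := hN.2 _ _ _ _ _ _ hs hD
            omega
          obtain ⟨h1, h2⟩ := hin hs.1 hfD'
          exact ⟨h1.trans (iff_of_false hne id), h2.trans (iff_of_true ⟨hne, i, j, hs, hins⟩ trivial)⟩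
      · refine ⟨False, False, fun f hf => ?_⟩
        by_cases hfC : f ∈ E(C)
        · refine ⟨⟨fun h => hD.1.edge_notMem hCB h hfC, False.elim⟩, ⟨?_, False.elim⟩⟩
          rintro (⟨i, hci, hid, rfl⟩ | ⟨D', i, j, hne, hs, -, -, hfD'⟩)
          · rcases hf.eq_or_eq_of_isLink ((hcyc.isLink i (by omega)).mono hCB) with h | h
            · have := hcyc.v_inj hk (by omega) h
              omega
            · have := hcyc.v_inj hk (by omega) h
              omega
          · exact hs.1.edge_notMem hCB hfD' hfC
        · obtain ⟨D', i, j, hs, hfD'⟩ := hbridge f hf.edge_mem hfC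
          have hki := hkatt hs hfD' hk hf
          have hne : D' ≠ D := by
            rintro rfl
            obtain ⟨rfl, rfl⟩ := hs.unique hcyc hD
            omega
          have hij := hs.2.1
          obtain ⟨h1, h2⟩ := hin hs.1 hfD'
          refine ⟨h1.trans (iff_of_false hne id), h2.trans (iff_of_false ?_ id)⟩
          rintro ⟨-, i', j', hs', h3, h4⟩
          obtain ⟨rfl, rfl⟩ := hs.unique hcyc hs'
          omega
    · by_cases hwB : w ∈ V(B)
      · obtain ⟨D', hD', hwD'⟩ := exists_isBridge_of_mem_vertexSet hwB hwC
        exact ⟨_, _, fun f hf => hin hD' (hD'.edge_mem_of_inc hwD' hwC hf)⟩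
      · exact ⟨True, True, fun f hf => absurd hf.vertex_mem hwB⟩
  have key := hZ.color_eq_or (hV.subset hZB.1) (fun f x h => hloop f x (h.mono hZB))
    (col := fun f => ((f ∈ E(D), inside f) : Prop × Prop)) (x := v c) (y := v d)
    (fun w h1 h2 f g hf hg => hcol w h1 h2 f g (hf.mono hZB) (hg.mono hZB)) he hm hg
  simp only [Prod.mk.injEq, eq_iff_iff] at key
  have e1 : e ∉ E(D) := fun h => hD.1.edge_notMem hCB h hcyc.closing.edge_mem
  have m1 : ε m ∉ E(D) := fun h => hD.1.edge_notMem hCB h (hε m hmd)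
  have m2 : inside (ε m) := Or.inl ⟨m, hcm, hmd, rfl⟩
  have e2 : ¬ inside e := by
    rintro (⟨i, -, hi, h⟩ | ⟨D', i, j, -, hs, -, -, h⟩)
    · exact hcyc.ne_closing i (by omega) h.symm
    · exact hs.1.edge_notMem hCB h hcyc.closing.edge_mem
  rcases key with h | h | h
  · exact e2 (h.2.1 m2)
  · exact e1 (h.1.1 hgD)
  · exact m1 (h.1.2 hgD)

/-- A circle through `e` and an edge of the arc common to all bridges uses no bridge, so it is `C`. -/
theorem IsNested.eq_of_mem (hN : B.IsNested C n v) (hcyc : C.IsCyc e n v ε) (hCB : C ≤ B)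
    (hV : V(B).Finite) (hloop : ∀ f x, ¬ B.IsLink f x x) {m : ℕ}
    (hm : ∀ D c d, B.Span C n v D c d → c ≤ m ∧ m < d) (hZB : Z ≤ B) (hZ : Z.IsCircle)
    (he : e ∈ E(Z)) (hmZ : ε m ∈ E(Z)) : Z = C := by
  have hEZ : E(Z) ⊆ E(C) := by
    intro g hg
    by_contra hgC
    obtain ⟨D, hD, hgD⟩ := exists_isBridge_of_mem_edgeSet hloop (IsSubgraph.edgeSet_mono hZB hg) hgC
    obtain ⟨c, d, hs⟩ := hN.1 D hD
    obtain ⟨h1, h2⟩ := hm D c d hs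
    exact hN.edge_notMem hcyc hCB hV hloop hs h1 h2 hZB hZ he hmZ hg hgD
  have hl : Z.IsLink e (v 0) (v n) :=
    (IsSubgraph.isLink_iff hZB he).2 (hcyc.closing.symm.mono hCB)
  have hP := hZ.exists_isPath (hV.subset hZB.1) (fun f x h => hloop f x (h.mono hZB)) hl
  have hVZ : V(Z) ⊆ V(C) := by
    refine (hP.mono hZB).vertices_subset hCB (hcyc.v_mem (Nat.zero_le n)) fun f hf => hEZ hf.1
  have hZC : Z ≤ C := ⟨hVZ, fun f a b hab =>
    (IsSubgraph.isLink_iff hCB (hEZ hab.edge_mem)).2 (hab.mono hZB)⟩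
  rcases hcyc.path_eq_arc hcyc.pos le_rfl (hP.mono hZC) with ⟨h1, h2⟩ | ⟨-, h2⟩
  · refine eq_of_le_le hZC le_rfl ?_ ?_
    · rw [h1, hcyc.vertexSet_eq]
      congr 1; ext i; simp
    · refine Set.Subset.antisymm hEZ ?_
      rw [hcyc.edgeSet_eq]
      rintro f (rfl | ⟨i, hi, rfl⟩)
      · exact he
      · have : ε i ∈ E(Z) \ {e} := by
          rw [h2]
          exact ⟨i, ⟨Nat.zero_le i, hi⟩, rfl⟩
        exact this.1
  · have : e ∈ E(Z) \ {e} := by rw [h2]; exact Or.inl rfl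
    exact absurd rfl this.2

/-- Switching does not change the sign of a circle, so a circle is negative exactly if it contains the
balancing edge. -/
theorem IsBalancingEdge.sign_eq (hb : B.IsBalancingEdge σ b) (hV : V(B).Finite)
    (hloop : ∀ f x, ¬ B.IsLink f x x) (hZB : Z ≤ B) (hZ : Z.IsCircle) (he : e ∈ E(Z)) :
    (b ∈ E(Z) → Z.sign σ = -1) ∧ (b ∉ E(Z) → Z.sign σ = 1) := by
  obtain ⟨-, ζ, hζ⟩ := hb
  have hpos : ∀ f a c, B.IsLink f a c → f ≠ b → ζ a * σ f * ζ c = 1 := by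
    intro f a c hl hf
    by_contra h
    exact hf ((hζ f a c hl).1 (Int.units_ne_iff_eq_neg.1 h))
  have key : ∀ e ∈ E(Z), (∀ f ∈ E(Z) \ {e}, f ≠ b) → ∃ p q, B.IsLink e p q ∧
      Z.sign σ = σ e * (ζ p * ζ q) := by
    intro e he hne
    obtain ⟨p, q, hl⟩ := exists_isLink_of_mem_edgeSet he
    have hP := hZ.exists_isPath (hV.subset hZB.1) (fun f x h => hloop f x (h.mono hZB)) hl
    refine ⟨p, q, hl.mono hZB, ?_⟩
    rw [← hP.edgeSign_eq (σ := σ) (ζ := ζ) fun f hf a c hl => hpos f a c (hl.mono hZB) (hne f hf),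
      ← edgeSign_insert hP.finite_edges (by simp), Set.insert_sdiff_singleton,
      Set.insert_eq_of_mem he, sign_eq_edgeSign]
  constructor
  · intro hbZ
    obtain ⟨p, q, hl, hs⟩ := key b hbZ fun f hf => hf.2
    rw [hs, ← (hζ b p q hl).2 rfl]
    ac_rfl
  · intro hbZ
    have hne : ∀ f ∈ E(Z), f ≠ b := fun f hf h => hbZ (h ▸ hf)
    obtain ⟨p, q, hl, hs⟩ := key e he fun f hf => hne f hf.1
    rw [hs, ← hpos e p q hl (hne e he)]
    ac_rfl

/-- A balancing edge in the arc common to all bridges makes `C` the only negative circle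
through `e`. -/
theorem IsNested.isSignUnique (hN : B.IsNested C n v) (hcyc : C.IsCyc e n v ε) (hCB : C ≤ B)
    (hC : C.IsCircle) (hV : V(B).Finite) (hloop : ∀ f x, ¬ B.IsLink f x x) {m : ℕ} (hmn : m < n)
    (hm : ∀ D c d, B.Span C n v D c d → c ≤ m ∧ m < d) (hb : B.IsBalancingEdge σ (ε m)) :
    C.sign σ = -1 ∧ B.IsSignUnique σ e C := by
  have hs := (hb.sign_eq hV hloop hCB hC hcyc.closing.edge_mem).1 (hcyc.edge_mem hmn)
  refine ⟨hs, fun Z hZB hZ he hne => ?_⟩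
  rw [hs, neg_neg]
  exact (hb.sign_eq hV hloop hZB hZ he).2 fun hmZ =>
    hne (hN.eq_of_mem hcyc hCB hV hloop hm hZB hZ he hmZ)

end

section

/-! ### Handles of the reduced graph -/

variable {α β : Type*} {B C D D' G S : Graph α β} {H : Graph α (β ⊕ Graph α β)} {x y : α} {e : β}
  {n : ℕ} {v : ℕ → α} {ε : ℕ → β}

theorem isSegmentBetween_iff : G.IsSegmentBetween C S x y ↔
    x ≠ y ∧ S ≤ C ∧ C.IsPath x y V(S) E(S) ∧ x ∈ G.chordEnds C ∧ y ∈ G.chordEnds C ∧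
      ∀ z ∈ V(S), z ∈ G.chordEnds C → z = x ∨ z = y := by
  constructor
  · rintro ⟨P, rfl, hpos, rfl, rfl, hx, hy, hP⟩
    refine ⟨?_, P.toGraph_le, P.isPath, hx, hy, ?_⟩
    · intro h
      have := congrArg Fin.val (P.vert_injective h)
      simp at this
      omega
    · rintro _ ⟨i, rfl⟩ hi
      rcases hP i hi with rfl | rfl
      exacts [Or.inl rfl, Or.inr rfl]
  · rintro ⟨hxy, hSC, hP, hx, hy, hz⟩
    obtain ⟨P, rfl, rfl, hV, hE⟩ := hP.exists_vPath
    refine ⟨P, eq_of_le_le P.toGraph_le hSC hV hE, ?_, rfl, rfl, hx, hy, ?_⟩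
    · rcases Nat.eq_zero_or_pos P.length with h | h
      · refine absurd ?_ hxy
        have : (0 : Fin (P.length + 1)) = Fin.last P.length := by
          ext; simp [h]
        rw [VPath.first, VPath.last, ← this]
      · exact h
    · intro i hi
      rcases hz _ (hV ▸ ⟨i, rfl⟩) hi with h | h
      exacts [Or.inl (P.vert_injective h), Or.inr (P.vert_injective h)]

theorem circleInReduced_le : C.circleInReduced ≤ B.reduced C :=
  ⟨le_rfl, fun _ _ _ h => Or.inl h⟩

theorem IsCyc.circleInReduced (hcyc : C.IsCyc e n v ε) :
    C.circleInReduced.IsCyc (Sum.inl e) n v (fun i => Sum.inl (ε i)) where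
  pos := hcyc.pos
  inj := hcyc.inj
  vertexSet_eq := hcyc.vertexSet_eq
  edgeSet_eq := by
    ext f
    constructor
    · rintro ⟨x, y, g, rfl, hg⟩
      have := hg.edge_mem
      rw [hcyc.edgeSet_eq] at this
      rcases this with rfl | ⟨i, hi, rfl⟩
      exacts [Or.inl rfl, Or.inr ⟨i, hi, rfl⟩]
    · rintro (rfl | ⟨i, hi, rfl⟩)
      exacts [⟨_, _, _, rfl, hcyc.closing⟩, ⟨_, _, _, rfl, hcyc.isLink i hi⟩]
  isLink i hi := ⟨_, rfl, hcyc.isLink i hi⟩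
  closing := ⟨_, rfl, hcyc.closing⟩
  ne_closing i hi h := hcyc.ne_closing i hi (Sum.inl_injective h)

theorem reduced_isLink_inr : (B.reduced C).IsLink (Sum.inr D) x y ↔
    B.IsBridge C D ∧ x ≠ y ∧ C.attachments D = {x, y} := by
  constructor
  · rintro (⟨g, h, -⟩ | ⟨D', h, h1, h2, h3⟩)
    · cases h
    · cases h
      exact ⟨h1, h2, h3⟩
  · rintro ⟨h1, h2, h3⟩
    exact Or.inr ⟨D, rfl, h1, h2, h3⟩

theorem Span.isLink {i j : ℕ} (hcyc : C.IsCyc e n v ε) (h : B.Span C n v D i j) :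
    (B.reduced C).IsLink (Sum.inr D) (v i) (v j) := by
  refine reduced_isLink_inr.2 ⟨h.1, fun hij => ?_, h.2.2.2⟩
  have h1 := h.2
  have := hcyc.v_inj (by omega) h1.2.1 hij
  omega

theorem Span.isChord {i j : ℕ} (hcyc : C.IsCyc e n v ε) (h : B.Span C n v D i j) :
    (B.reduced C).IsChord C.circleInReduced (Sum.inr D) := by
  have hl := h.isLink hcyc
  refine ⟨hl.edge_mem, ?_, v i, hl.left_mem, v j, hl.right_mem, (reduced_isLink_inr.1 hl).2.1, hl⟩
  rintro ⟨x, y, g, hg, -⟩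
  cases hg

theorem exists_span_of_isChord (hcyc : C.IsCyc e n v ε) {c : β ⊕ Graph α β}
    (hc : (B.reduced C).IsChord C.circleInReduced c) :
    ∃ D i j, c = Sum.inr D ∧ B.Span C n v D i j := by
  obtain ⟨-, hcC, x, hx, y, hy, hxy, hl⟩ := hc
  rcases hl with ⟨g, rfl, hg⟩ | ⟨D, rfl, hD, -, hA⟩
  · exact absurd (⟨x, y, g, rfl, hg⟩ : Sum.inl g ∈ E(C.circleInReduced)) hcC
  · obtain ⟨i, j, h⟩ := hcyc.exists_span hD (by rw [hA, Set.encard_pair hxy])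
    exact ⟨D, i, j, rfl, h⟩

/-- The index `k` is an end of the span of some bridge. -/
def IsSpanEnd (B C : Graph α β) (n : ℕ) (v : ℕ → α) (k : ℕ) : Prop :=
  ∃ D i j, B.Span C n v D i j ∧ (k = i ∨ k = j)

theorem IsCyc.mem_chordEnds_iff (hcyc : C.IsCyc e n v ε) {k : ℕ} (hk : k ≤ n) :
    v k ∈ (B.reduced C).chordEnds C.circleInReduced ↔ B.IsSpanEnd C n v k := by
  constructor
  · rintro ⟨-, c, hc, hi⟩
    obtain ⟨D, i, j, rfl, h⟩ := exists_span_of_isChord hcyc hc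
    have h1 := h.2
    refine ⟨D, i, j, h, ?_⟩
    rcases hi.eq_or_eq_of_isLink (h.isLink hcyc) with h2 | h2
    exacts [Or.inl (hcyc.v_inj hk (by omega) h2), Or.inr (hcyc.v_inj hk h1.2.1 h2)]
  · rintro ⟨D, i, j, h, rfl | rfl⟩
    · exact ⟨hcyc.v_mem hk, _, h.isChord hcyc, (h.isLink hcyc).inc_left⟩
    · exact ⟨hcyc.v_mem hk, _, h.isChord hcyc, (h.isLink hcyc).inc_right⟩

/-- The handle formed by the arc between the ends of a span which avoids `e`. -/
def IsInnerHandle (B C : Graph α β) (n : ℕ) (v : ℕ → α) (ε : ℕ → β) (i j : ℕ)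
    (H : Graph α (β ⊕ Graph α β)) : Prop :=
  H ≤ C.circleInReduced ∧ (∀ k, i < k → k < j → ¬ B.IsSpanEnd C n v k) ∧
    V(H) = v '' Set.Icc i j ∧ E(H) = (fun m => Sum.inl (ε m)) '' Set.Ico i j

/-- The handle formed by the arc between the ends of a span which contains `e`. -/
def IsOuterHandle (B C : Graph α β) (e : β) (n : ℕ) (v : ℕ → α) (ε : ℕ → β) (i j : ℕ)
    (H : Graph α (β ⊕ Graph α β)) : Prop :=
  H ≤ C.circleInReduced ∧ (∀ k, B.IsSpanEnd C n v k → i ≤ k ∧ k ≤ j) ∧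
    V(H) = v '' (Set.Iic i ∪ Set.Icc j n) ∧
    E(H) = insert (Sum.inl e) ((fun m => Sum.inl (ε m)) '' (Set.Iio i ∪ Set.Ico j n))

theorem IsReducedHandle.inner_or_outer (hcyc : C.IsCyc e n v ε) (hH : B.IsReducedHandle C H) :
    ∃ D i j, B.Span C n v D i j ∧
      (B.IsInnerHandle C n v ε i j H ∨ B.IsOuterHandle C e n v ε i j H) := by
  obtain ⟨x, y, hseg, c, hc, hl⟩ := hH
  rw [isSegmentBetween_iff] at hseg
  obtain ⟨hxy, hHC, hP, hx, hy, hz⟩ := hseg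
  obtain ⟨D, i, j, rfl, h⟩ := exists_span_of_isChord hcyc hc
  have hij := h.2.1
  have hjn := h.2.2.1
  have hP' : C.circleInReduced.IsPath (v i) (v j) V(H) E(H) ∧
      ∀ z ∈ V(H), z ∈ (B.reduced C).chordEnds C.circleInReduced → z = v i ∨ z = v j := by
    rcases hl.eq_and_eq_or_eq_and_eq (h.isLink hcyc) with ⟨rfl, rfl⟩ | ⟨rfl, rfl⟩
    · exact ⟨hP, hz⟩
    · exact ⟨hP.symm, fun z h1 h2 => (hz z h1 h2).symm⟩
  refine ⟨D, i, j, h, ?_⟩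
  have hend : ∀ k ≤ n, v k ∈ V(H) → B.IsSpanEnd C n v k → k = i ∨ k = j := by
    intro k hk hkH hke
    exact (hP'.2 _ hkH ((hcyc.mem_chordEnds_iff hk).2 hke)).imp (hcyc.v_inj hk (by omega))
      (hcyc.v_inj hk hjn)
  rcases hcyc.circleInReduced.path_eq_arc hij hjn hP'.1 with ⟨hV, hE⟩ | ⟨hV, hE⟩
  · refine Or.inl ⟨hHC, fun k h1 h2 hk => ?_, hV, hE⟩
    have := hend k (by omega) (hV ▸ ⟨k, ⟨h1.le, h2.le⟩, rfl⟩) hk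
    omega
  · refine Or.inr ⟨hHC, fun k hk => ?_, hV, hE⟩
    have hkn : k ≤ n := by
      obtain ⟨D', i', j', h', h''⟩ := hk
      have := h'.2
      omega
    by_contra hcon
    have := hend k hkn (hV ▸ ⟨k, by simp only [Set.mem_union, Set.mem_Iic, Set.mem_Icc]; omega, rfl⟩)
      hk
    omega

theorem Span.exists_innerHandle (hcyc : C.IsCyc e n v ε) {i j : ℕ} (h : B.Span C n v D i j)
    (hk : ∀ k, i < k → k < j → ¬ B.IsSpanEnd C n v k) :
    ∃ H, B.IsReducedHandle C H ∧ B.IsInnerHandle C n v ε i j H := by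
  have hij := h.2.1
  have hjn := h.2.2.1
  have hP := hcyc.circleInReduced.arc hij.le hjn
  obtain ⟨H, hHC, hV, hE⟩ := exists_subgraph hP.subset_vertexSet hP.subset_edgeSet
    (fun f hf w hw => hP.inc_mem hf hw)
  have hl := h.isLink hcyc
  refine ⟨H, ⟨v i, v j, isSegmentBetween_iff.2 ⟨(reduced_isLink_inr.1 hl).2.1, hHC,
    hV ▸ hE ▸ hP, (hcyc.mem_chordEnds_iff (by omega)).2 ⟨D, i, j, h, Or.inl rfl⟩,
    (hcyc.mem_chordEnds_iff hjn).2 ⟨D, i, j, h, Or.inr rfl⟩, ?_⟩, _, h.isChord hcyc, hl⟩,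
    hHC, hk, hV, hE⟩
  rw [hV]
  rintro _ ⟨k, hk', rfl⟩ hkE
  simp only [Set.mem_Icc] at hk'
  rw [hcyc.mem_chordEnds_iff (by omega)] at hkE
  by_contra hcon
  push Not at hcon
  refine hk k (lt_of_le_of_ne hk'.1 ?_) (lt_of_le_of_ne hk'.2 ?_) hkE
  · rintro rfl; exact hcon.1 rfl
  · rintro rfl; exact hcon.2 rfl

theorem Span.exists_outerHandle (hcyc : C.IsCyc e n v ε) {i j : ℕ} (h : B.Span C n v D i j)
    (hk : ∀ k, B.IsSpanEnd C n v k → i ≤ k ∧ k ≤ j) :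
    ∃ H, B.IsReducedHandle C H ∧ B.IsOuterHandle C e n v ε i j H := by
  have hij := h.2.1
  have hjn := h.2.2.1
  have hP := hcyc.circleInReduced.outer_arc hij hjn
  obtain ⟨H, hHC, hV, hE⟩ := exists_subgraph hP.subset_vertexSet hP.subset_edgeSet
    (fun f hf w hw => hP.inc_mem hf hw)
  have hl := h.isLink hcyc
  refine ⟨H, ⟨v i, v j, isSegmentBetween_iff.2 ⟨(reduced_isLink_inr.1 hl).2.1, hHC,
    hV ▸ hE ▸ hP, (hcyc.mem_chordEnds_iff (by omega)).2 ⟨D, i, j, h, Or.inl rfl⟩,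
    (hcyc.mem_chordEnds_iff hjn).2 ⟨D, i, j, h, Or.inr rfl⟩, ?_⟩, _, h.isChord hcyc, hl⟩,
    hHC, hk, hV, hE⟩
  rw [hV]
  rintro _ ⟨k, hk', rfl⟩ hkE
  simp only [Set.mem_union, Set.mem_Iic, Set.mem_Icc] at hk'
  rw [hcyc.mem_chordEnds_iff (by omega)] at hkE
  have h1 := hk k hkE
  rcases (by omega : k = i ∨ k = j) with rfl | rfl
  exacts [Or.inl rfl, Or.inr rfl]

/-- In the nested situation there are exactly two handles: the arc of the innermost span, and the
complement of the arc of the outermost span. -/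
theorem IsNested.exists_handles (hN : B.IsNested C n v) (hcyc : C.IsCyc e n v ε)
    (hex : ∃ D, B.IsBridge C D) :
    ∃ a b Hin Hout, (∃ D, B.Span C n v D a b) ∧ (∀ D i j, B.Span C n v D i j → i ≤ a ∧ b ≤ j) ∧
      (∀ H, B.IsReducedHandle C H ↔ H = Hin ∨ H = Hout) ∧ Hin ≠ Hout ∧
      E(Hin) = (fun m => Sum.inl (ε m)) '' Set.Ico a b ∧ Sum.inl e ∈ E(Hout) := by
  obtain ⟨D₀, hD₀⟩ := hex
  obtain ⟨i₀, j₀, h₀⟩ := hN.1 D₀ hD₀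
  obtain ⟨a, b, Da, ha, hmin⟩ : ∃ a b D, B.Span C n v D a b ∧
      ∀ D i j, B.Span C n v D i j → i ≤ a ∧ b ≤ j := by
    have hne : ∃ l, ∃ D i j, B.Span C n v D i j ∧ l = j - i := ⟨_, D₀, i₀, j₀, h₀, rfl⟩
    classical
    obtain ⟨D, a, b, h, hl⟩ := Nat.find_spec hne
    refine ⟨a, b, D, h, fun D' i j h' => ?_⟩
    have h1 := Nat.find_min' hne ⟨D', i, j, h', rfl⟩
    have h2 := hN.2 _ _ _ _ _ _ h h'
    have h3 := h.2
    have h4 := h'.2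
    omega
  obtain ⟨a', b', Da', ha', hmax⟩ : ∃ a' b' D, B.Span C n v D a' b' ∧
      ∀ D i j, B.Span C n v D i j → a' ≤ i ∧ j ≤ b' := by
    have hne : ∃ l, ∃ D i j, B.Span C n v D i j ∧ l = i + (n - j) := ⟨_, D₀, i₀, j₀, h₀, rfl⟩
    classical
    obtain ⟨D, a, b, h, hl⟩ := Nat.find_spec hne
    refine ⟨a, b, D, h, fun D' i j h' => ?_⟩
    have h1 := Nat.find_min' hne ⟨D', i, j, h', rfl⟩
    have h2 := hN.2 _ _ _ _ _ _ h h'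
    have h3 := h.2
    have h4 := h'.2
    omega
  have hab := ha.2
  have hab' := ha'.2
  obtain ⟨Hin, hHin, hin⟩ := ha.exists_innerHandle hcyc (by
    rintro k h1 h2 ⟨D, i, j, h, hk⟩
    have := hmin D i j h
    omega)
  obtain ⟨Hout, hHout, hout⟩ := ha'.exists_outerHandle hcyc (by
    rintro k ⟨D, i, j, h, hk⟩
    have := hmax D i j h
    have := h.2
    omega)
  have heout : Sum.inl e ∈ E(Hout) := by rw [hout.2.2.2]; exact Or.inl rfl
  refine ⟨a, b, Hin, Hout, ⟨Da, ha⟩, hmin, fun H => ⟨fun hH => ?_, ?_⟩, ?_, hin.2.2.2, heout⟩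
  · obtain ⟨D, i, j, h, h' | h'⟩ := hH.inner_or_outer hcyc
    · left
      have h1 := hmin D i j h
      have h2 : ¬ (i < a ∧ a < j) := fun h2 => h'.2.1 a h2.1 h2.2 ⟨Da, a, b, ha, Or.inl rfl⟩
      have h3 : ¬ (i < b ∧ b < j) := fun h2 => h'.2.1 b h2.1 h2.2 ⟨Da, a, b, ha, Or.inr rfl⟩
      obtain rfl : i = a := by omega
      obtain rfl : j = b := by omega
      exact eq_of_le_le h'.1 hin.1 (h'.2.2.1.trans hin.2.2.1.symm) (h'.2.2.2.trans hin.2.2.2.symm)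
    · right
      have h1 := hmax D i j h
      have h2 := h'.2.1 a' ⟨Da', a', b', ha', Or.inl rfl⟩
      have h3 := h'.2.1 b' ⟨Da', a', b', ha', Or.inr rfl⟩
      obtain rfl : i = a' := by omega
      obtain rfl : j = b' := by omega
      exact eq_of_le_le h'.1 hout.1 (h'.2.2.1.trans hout.2.2.1.symm)
        (h'.2.2.2.trans hout.2.2.2.symm)
  · rintro (rfl | rfl)
    exacts [hHin, hHout]
  · rintro rfl
    rw [hin.2.2.2] at heout
    obtain ⟨m, hm, h⟩ := heout
    simp only [Set.mem_Ico] at hm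
    exact hcyc.ne_closing m (by omega) (Sum.inl_injective h)

/-- If no two spans cross and there are only two handles, one of which contains `e`, then the spans
are nested: two disjoint spans would contain two further handles. -/
theorem isNested_of_handles (hcyc : C.IsCyc e n v ε)
    (hspan : ∀ D, B.IsBridge C D → ∃ i j, B.Span C n v D i j)
    (hcross : ∀ D D' i j k l, B.Span C n v D i j → B.Span C n v D' k l → ¬ (i < k ∧ k < j ∧ j < l))
    (htwo : {H | B.IsReducedHandle C H}.encard = 2)
    (he : ∃ H, B.IsReducedHandle C H ∧ Sum.inl e ∈ E(H)) : B.IsNested C n v := by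
  have hinner : ∀ N D i j, B.Span C n v D i j → j - i = N →
      ∃ a b H, i ≤ a ∧ a < b ∧ b ≤ j ∧ B.IsReducedHandle C H ∧
        E(H) = (fun m => Sum.inl (ε m)) '' Set.Ico a b := by
    intro N
    induction N using Nat.strong_induction_on with
    | _ N ih =>
      intro D i j h hN
      have hij := h.2
      by_cases hk : ∀ k, i < k → k < j → ¬ B.IsSpanEnd C n v k
      · obtain ⟨H, hH, h'⟩ := h.exists_innerHandle hcyc hk
        exact ⟨i, j, H, le_rfl, hij.1, le_rfl, hH, h'.2.2.2⟩
      · push Not at hk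
        obtain ⟨k, h1, h2, D', i', j', h', hk⟩ := hk
        have h3 := hcross _ _ _ _ _ _ h h'
        have h4 := hcross _ _ _ _ _ _ h' h
        have hij' := h'.2
        obtain ⟨a, b, H, g1, g2, g3, g4, g5⟩ := ih (j' - i') (by omega) D' i' j' h' rfl
        exact ⟨a, b, H, by omega, g2, by omega, g4, g5⟩
  refine ⟨hspan, fun D D' i j k l h h' => ?_⟩
  by_contra hcon
  have hdisj : ∀ {D D' i j k l}, B.Span C n v D i j → B.Span C n v D' k l → j ≤ k → False := by
    intro D D' i j k l h h' hjk
    obtain ⟨a, b, H, h1, h2, h3, hH, hE⟩ := hinner _ D i j h rfl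
    obtain ⟨a', b', H', h1', h2', h3', hH', hE'⟩ := hinner _ D' k l h' rfl
    obtain ⟨H₀, hH₀, heH⟩ := he
    have hln := h'.2.2.1
    have hnot : ∀ a b, b ≤ n → (Sum.inl e : β ⊕ Graph α β) ∉
        (fun m => Sum.inl (ε m)) '' Set.Ico a b := by
      rintro a b hb ⟨m, hm, h⟩
      simp only [Set.mem_Ico] at hm
      exact hcyc.ne_closing m (by omega) (Sum.inl_injective h)
    have n1 : H₀ ≠ H := by
      rintro rfl
      exact hnot a b (by omega) (hE ▸ heH)
    have n2 : H₀ ≠ H' := by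
      rintro rfl
      exact hnot a' b' (by omega) (hE' ▸ heH)
    have n3 : H ≠ H' := by
      rintro rfl
      have : Sum.inl (ε a) ∈ E(H) := by rw [hE]; exact ⟨a, ⟨le_rfl, h2⟩, rfl⟩
      rw [hE'] at this
      obtain ⟨m, hm, hma⟩ := this
      simp only [Set.mem_Ico] at hm
      have := hcyc.ε_inj (by omega) (by omega) (Sum.inl_injective hma)
      omega
    obtain ⟨K, L, -, hKL⟩ := Set.encard_eq_two.1 htwo
    have m0 : H₀ ∈ ({K, L} : Set _) := hKL ▸ hH₀
    have m1 : H ∈ ({K, L} : Set _) := hKL ▸ hH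
    have m2 : H' ∈ ({K, L} : Set _) := hKL ▸ hH'
    rcases m0 with rfl | rfl <;> rcases m1 with rfl | rfl <;> rcases m2 with rfl | rfl <;>
      contradiction
  have h1 := hcross _ _ _ _ _ _ h h'
  have h2 := hcross _ _ _ _ _ _ h' h
  have h3 : ¬ j ≤ k := fun hjk => hdisj h h' hjk
  have h4 : ¬ l ≤ i := fun hli => hdisj h' h hli
  omega

end

section

/-! ### Crossing chords -/

variable {α β : Type*} {B C D D' G K : Graph α β} {x y : α} {e : β} {X S : Set α} {F : Set β}
  {n : ℕ} {v : ℕ → α} {ε : ℕ → β}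

theorem IsPath.exists_crossing (hP : G.IsPath x y X F) (hx : x ∈ S) (hy : y ∉ S) :
    ∃ f ∈ F, ∃ u ∈ X, ∃ w ∈ X, u ∈ S ∧ w ∉ S ∧ G.IsLink f u w := by
  induction hP with
  | nil => exact absurd hx hy
  | @cons g x z y X F hl hxX hp ih =>
    by_cases hz : z ∈ S
    · obtain ⟨f, hf, u, hu, w, hw, h⟩ := ih hz hy
      exact ⟨f, Or.inr hf, u, Or.inr hu, w, Or.inr hw, h⟩
    · exact ⟨g, Or.inl rfl, x, Or.inl rfl, z, Or.inr hp.left_mem, hx, hz, hl⟩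

/-- In a subdivision of `K₄`, an edge cut with at most two edges does not separate the branch
vertices: at least three of the six paths join branch vertices from different sides of a cut that
does separate them, and these paths have no edge in common. -/
theorem branch_mem_of_cut {b : Fin 4 → α} {P : Fin 4 → Fin 4 → K.VPath}
    (hb : Function.Injective b)
    (hends : ∀ i j, i < j → (P i j).first = b i ∧ (P i j).last = b j)
    (hdisj : ∀ i j k l, i < j → k < l → (i, j) ≠ (k, l) →
      V((P i j).toGraph) ∩ V((P k l).toGraph) ⊆ {b i, b j} ∩ {b k, b l})
    {g₁ g₂ : β} (hcut : ∀ f x y, K.IsLink f x y → x ∈ S → y ∉ S → f = g₁ ∨ f = g₂)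
    {i j : Fin 4} (hi : b i ∈ S) : b j ∈ S := by
  by_contra hj
  -- `T p q g`: the edge `g` of the cut lies on the path between `b p ∈ S` and `b q ∉ S`.
  let T : Fin 4 → Fin 4 → β → Prop := fun p q g => b p ∈ S ∧ b q ∉ S ∧ ∃ u w, u ∈ S ∧ w ∉ S ∧
    K.IsLink g u w ∧ u ∈ V((P (min p q) (max p q)).toGraph) ∧
      w ∈ V((P (min p q) (max p q)).toGraph)
  have hex : ∀ p q, b p ∈ S → b q ∉ S → T p q g₁ ∨ T p q g₂ := by
    intro p q hp hq
    have hpq : p ≠ q := by rintro rfl; exact hq hp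
    have hpath : K.IsPath (b p) (b q) V((P (min p q) (max p q)).toGraph)
        E((P (min p q) (max p q)).toGraph) := by
      have h := (P (min p q) (max p q)).isPath
      obtain ⟨h1, h2⟩ := hends _ _ (min_lt_max.2 hpq)
      rw [h1, h2] at h
      rcases lt_or_gt_of_ne hpq with hlt | hlt
      · simpa only [min_eq_left hlt.le, max_eq_right hlt.le] using h
      · have h := h.symm
        simpa only [min_eq_right hlt.le, max_eq_left hlt.le] using h
    obtain ⟨f, -, u, hu, w, hw, huS, hwS, hl⟩ := hpath.exists_crossing hp hq
    rcases hcut f u w hl huS hwS with rfl | rfl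
    · exact Or.inl ⟨hp, hq, u, w, huS, hwS, hl, hu, hw⟩
    · exact Or.inr ⟨hp, hq, u, w, huS, hwS, hl, hu, hw⟩
  have huniq : ∀ p q r s g, T p q g → T r s g → p = r ∧ q = s := by
    rintro p q r s g ⟨hp, hq, u, w, hu, hw, hl, hu1, hw1⟩ ⟨hr, hs, u', w', hu', hw', hl', hu2, hw2⟩
    have huw : u = u' ∧ w = w' := by
      rcases hl.eq_and_eq_or_eq_and_eq hl' with h | ⟨rfl, -⟩
      · exact h
      · exact absurd hu hw'
    obtain ⟨rfl, rfl⟩ := huw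
    have hpq : p ≠ q := by rintro rfl; exact hq hp
    have hrs : r ≠ s := by rintro rfl; exact hs hr
    have hps : p ≠ s := by rintro rfl; exact hs hp
    have hqr : q ≠ r := by rintro rfl; exact hq hr
    by_cases heq : (min p q, max p q) = (min r s, max r s)
    · rw [Prod.mk.injEq] at heq
      obtain ⟨h1, h2⟩ := heq
      rcases lt_or_gt_of_ne hpq with h | h <;> rcases lt_or_gt_of_ne hrs with h' | h' <;>
        simp only [min_eq_left h.le, max_eq_right h.le, min_eq_right h.le, max_eq_left h.le,
          min_eq_left h'.le, max_eq_right h'.le, min_eq_right h'.le, max_eq_left h'.le] at h1 h2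
      · exact ⟨h1, h2⟩
      · exact absurd h1 hps
      · exact absurd h1 hqr
      · exact ⟨h2, h1⟩
    · have hsub := hdisj _ _ _ _ (min_lt_max.2 hpq) (min_lt_max.2 hrs) heq
      have mem : ∀ p q : Fin 4, ∀ z, z ∈ ({b (min p q), b (max p q)} : Set α) → z = b p ∨ z = b q := by
        intro p q z hz
        rcases le_total p q with h | h
        · rw [min_eq_left h, max_eq_right h] at hz
          exact hz
        · rw [min_eq_right h, max_eq_left h] at hz
          exact Or.symm hz
      obtain ⟨hu3, hu4⟩ := hsub ⟨hu1, hu2⟩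
      obtain ⟨hw3, hw4⟩ := hsub ⟨hw1, hw2⟩
      have up : u = b p := (mem _ _ _ hu3).resolve_right (by rintro rfl; exact hq hu)
      have ur : u = b r := (mem _ _ _ hu4).resolve_right (by rintro rfl; exact hs hu)
      have wq : w = b q := (mem _ _ _ hw3).resolve_left (by rintro rfl; exact hw hp)
      have ws : w = b s := (mem _ _ _ hw4).resolve_left (by rintro rfl; exact hw hr)
      exact ⟨hb (up.symm.trans ur), hb (wq.symm.trans ws)⟩
  have hij : i ≠ j := by rintro rfl; exact hj hi
  obtain ⟨k, l, hki, hkj, hli, hlj, hkl⟩ : ∃ k l : Fin 4, k ≠ i ∧ k ≠ j ∧ l ≠ i ∧ l ≠ j ∧ k ≠ l := by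
    have : ∀ i j : Fin 4, i ≠ j → ∃ k l : Fin 4, k ≠ i ∧ k ≠ j ∧ l ≠ i ∧ l ≠ j ∧ k ≠ l := by decide
    exact this i j hij
  -- Each of the other two branch vertices is joined across the cut to `b i` or to `b j`.
  have third : ∀ k, k ≠ i → k ≠ j → ∃ p q, (p = k ∧ q = j ∨ p = i ∧ q = k) ∧ b p ∈ S ∧ b q ∉ S := by
    intro k hki hkj
    by_cases hk : b k ∈ S
    · exact ⟨k, j, Or.inl ⟨rfl, rfl⟩, hk, hj⟩
    · exact ⟨i, k, Or.inr ⟨rfl, rfl⟩, hi, hk⟩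
  obtain ⟨p, q, hpq, hp, hq⟩ := third k hki hkj
  obtain ⟨r, s, hrs, hr, hs⟩ := third l hli hlj
  have n1 : ¬ (i = p ∧ j = q) := by grind
  have n2 : ¬ (i = r ∧ j = s) := by grind
  have n3 : ¬ (p = r ∧ q = s) := by grind
  rcases hex i j hi hj with h1 | h1 <;> rcases hex p q hp hq with h2 | h2 <;>
    rcases hex r s hr hs with h3 | h3
  · exact n1 (huniq _ _ _ _ _ h1 h2)
  · exact n1 (huniq _ _ _ _ _ h1 h2)
  · exact n2 (huniq _ _ _ _ _ h1 h3)
  · exact n3 (huniq _ _ _ _ _ h2 h3)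
  · exact n3 (huniq _ _ _ _ _ h2 h3)
  · exact n2 (huniq _ _ _ _ _ h1 h3)
  · exact n1 (huniq _ _ _ _ _ h1 h2)
  · exact n1 (huniq _ _ _ _ _ h1 h2)

/-- Chords with nested spans do not cross. -/
theorem Span.not_chordsCross (hcyc : C.IsCyc e n v ε) {i j k l : ℕ} (h : B.Span C n v D i j)
    (h' : B.Span C n v D' k l) (hik : i ≤ k) (hlj : l ≤ j) :
    ¬ (B.reduced C).ChordsCross C.circleInReduced (Sum.inr D) (Sum.inr D') := by
  rintro ⟨K, hKR, hKV, hKE, b, P, hb, hends, hdisj, -, -⟩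
  have hcyc' := hcyc.circleInReduced
  have hkl := h'.2.1
  have hjn := h.2.2.1
  have hlink : ∀ {f x y}, K.IsLink f x y → C.circleInReduced.IsLink f x y ∨
      (f = Sum.inr D ∧ (x = v i ∧ y = v j ∨ x = v j ∧ y = v i)) ∨
      (f = Sum.inr D' ∧ (x = v k ∧ y = v l ∨ x = v l ∧ y = v k)) := by
    intro f x y hl
    have hf := hl.edge_mem
    rw [hKE] at hf
    rcases hf with hf | rfl | rfl
    · exact Or.inl ((IsSubgraph.isLink_iff circleInReduced_le hf).2 (hl.mono hKR))
    · exact Or.inr (Or.inl ⟨rfl, (hl.mono hKR).eq_and_eq_or_eq_and_eq (h.isLink hcyc)⟩)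
    · exact Or.inr (Or.inr ⟨rfl, (hl.mono hKR).eq_and_eq_or_eq_and_eq (h'.isLink hcyc)⟩)
  have hbV : ∀ p, ∃ m ≤ n, v m = b p := by
    intro p
    have : b p ∈ V(K) := by
      rcases eq_or_ne p 0 with rfl | hp
      · rw [← (hends 0 1 (by decide)).1]; exact (P 0 1).vert_mem _
      · rw [← (hends 0 p (Fin.pos_of_ne_zero hp)).2]; exact (P 0 p).vert_mem _
    rw [hKV] at this
    exact hcyc'.exists_index this
  choose m hmn hm using hbV
  have hmne : ∀ p q, p ≠ q → m p ≠ m q := by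
    intro p q hpq hmm
    exact hpq (hb (by rw [← hm p, ← hm q, hmm]))
  -- Branch vertices are ends of the chords: other vertices have only two edges.
  have hmem : ∀ p, m p = i ∨ m p = j ∨ m p = k ∨ m p = l := by
    intro p
    by_contra hcon
    push Not at hcon
    obtain ⟨h1, h2, h3, h4⟩ := hcon
    have hne : ∀ {t : ℕ}, t ≤ n → m p ≠ t → v (m p) ≠ v t := fun ht hne h =>
      hne (hcyc.v_inj (hmn p) ht h)
    have key : ∀ q, b q ∈ ({b p} : Set α) := fun q =>
      branch_mem_of_cut (S := {b p}) hb hends hdisj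
        (g₁ := if m p < n then Sum.inl (ε (m p)) else Sum.inl e)
        (g₂ := if 0 < m p then Sum.inl (ε (m p - 1)) else Sum.inl e) (by
          rintro f x y hl hx -
          obtain rfl : x = b p := hx
          rw [← hm p] at hl
          rcases hlink hl with hl | ⟨-, hl⟩ | ⟨-, hl⟩
          · rcases hcyc'.isLink_cases (hmn p) hl with
              ⟨h, rfl, -⟩ | ⟨t, h, rfl, -⟩ | ⟨h, rfl, -⟩ | ⟨h, rfl, -⟩
            · left; rw [if_pos h]
            · right; rw [if_pos (by omega), h]; rfl
            · left; rw [if_neg (by omega)]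
            · right; rw [if_neg (by omega)]
          · rcases hl with ⟨h, -⟩ | ⟨h, -⟩
            · exact absurd h (hne (by omega) h1)
            · exact absurd h (hne (by omega) h2)
          · rcases hl with ⟨h, -⟩ | ⟨h, -⟩
            · exact absurd h (hne (by omega) h3)
            · exact absurd h (hne (by omega) h4)) (i := p) rfl
    have h01 : b 0 = b 1 := (key 0).trans (key 1).symm
    exact absurd (hb h01) (by decide)
  have d01 := hmne 0 1 (by decide)
  have d02 := hmne 0 2 (by decide)
  have d03 := hmne 0 3 (by decide)
  have d12 := hmne 1 2 (by decide)
  have d13 := hmne 1 3 (by decide)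
  have d23 := hmne 2 3 (by decide)
  have e0 := hmem 0
  have e1 := hmem 1
  have e2 := hmem 2
  have e3 := hmem 3
  have hik' : i < k := by omega
  have hlj' : l < j := by omega
  -- Two edges separate the arc of the inner chord from the ends of the outer one.
  have hS : ∀ t ≤ n, v t ∈ v '' Set.Icc k l ↔ k ≤ t ∧ t ≤ l := fun t ht =>
    hcyc.mem_image_iff ht fun s hs => by simp only [Set.mem_Icc, Set.mem_Iic] at *; omega
  have hcut : ∀ f x y, K.IsLink f x y → x ∈ v '' Set.Icc k l → y ∉ v '' Set.Icc k l →
      f = Sum.inl (ε l) ∨ f = Sum.inl (ε (k - 1)) := by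
    rintro f _ y hl ⟨t, ht, rfl⟩ hy
    simp only [Set.mem_Icc] at ht
    rcases hlink hl with hl | ⟨-, hl⟩ | ⟨-, hl⟩
    · rcases hcyc'.isLink_cases (by omega) hl with
        ⟨h, rfl, rfl⟩ | ⟨t, rfl, rfl, rfl⟩ | ⟨h, rfl, -⟩ | ⟨h, rfl, -⟩
      · rw [hS _ h] at hy
        left
        rw [show t = l by omega]
      · rw [hS _ (by omega)] at hy
        right
        rw [show t = k - 1 by omega]
      · omega
      · omega
    · rcases hl with ⟨h, -⟩ | ⟨h, -⟩
      · have := hcyc.v_inj (by omega) (by omega) h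
        omega
      · have := hcyc.v_inj (by omega) (by omega) h
        omega
    · rcases hl with ⟨-, rfl⟩ | ⟨-, rfl⟩
      · exact absurd ((hS l (by omega)).2 ⟨by omega, le_rfl⟩) hy
      · exact absurd ((hS k (by omega)).2 ⟨le_rfl, by omega⟩) hy
  have hall : ∀ p q, k ≤ m p ∧ m p ≤ l → k ≤ m q ∧ m q ≤ l := by
    intro p q hp
    rw [← hS _ (hmn q), hm]
    refine branch_mem_of_cut hb hends hdisj hcut (i := p) ?_
    rw [← hm]
    exact (hS _ (hmn p)).2 hp
  have a01 := hall 0 1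
  have a02 := hall 0 2
  have a10 := hall 1 0
  have a20 := hall 2 0
  omega

theorem ChordsCross.symm {c₁ c₂ : β} (h : G.ChordsCross C c₁ c₂) : G.ChordsCross C c₂ c₁ := by
  obtain ⟨K, h1, h2, h3, h4⟩ := h
  exact ⟨K, h1, h2, h3.trans (by rw [Set.pair_comm]), h4⟩

set_option maxHeartbeats 1000000 in
/-- Chords with properly interleaved spans cross. -/
theorem Span.chordsCross (hcyc : C.IsCyc e n v ε) {i j k l : ℕ} (h : B.Span C n v D i j)
    (h' : B.Span C n v D' k l) (hik : i < k) (hkj : k < j) (hjl : j < l) :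
    (B.reduced C).ChordsCross C.circleInReduced (Sum.inr D) (Sum.inr D') := by
  have hcyc' := hcyc.circleInReduced
  have hln := h'.2.2.1
  have hl := h.isLink hcyc
  have hl' := h'.isLink hcyc
  have hCR : C.circleInReduced ≤ B.reduced C := circleInReduced_le
  obtain ⟨K, hKR, hKV, hKE⟩ := exists_subgraph (G := B.reduced C) (X := V(C))
    (F := E(C.circleInReduced) ∪ {Sum.inr D, Sum.inr D'}) le_rfl
    (by
      rintro f (hf | rfl | rfl)
      exacts [IsSubgraph.edgeSet_mono hCR hf, hl.edge_mem, hl'.edge_mem])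
    (fun f _ w hw => hw.vertex_mem)
  have hCK : C.circleInReduced ≤ K := ⟨hKV.symm.subset, fun f a b hab =>
    (IsSubgraph.isLink_iff hKR (by rw [hKE]; exact Or.inl hab.edge_mem)).2 (hab.mono hCR)⟩
  have hlK : K.IsLink (Sum.inr D) (v i) (v j) :=
    (IsSubgraph.isLink_iff hKR (by rw [hKE]; exact Or.inr (Or.inl rfl))).2 hl
  have hlK' : K.IsLink (Sum.inr D') (v k) (v l) :=
    (IsSubgraph.isLink_iff hKR (by rw [hKE]; exact Or.inr (Or.inr rfl))).2 hl'
  have hedge : ∀ {f} {x y : α}, K.IsLink f x y → x ≠ y → K.IsPath x y {x, y} {f} := by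
    intro f x y hl hxy
    simpa using IsPath.cons hl (by simpa using hxy) (.nil hl.right_mem)
  let t : Fin 4 → ℕ := ![i, k, j, l]
  let N : Fin 4 → Fin 4 → Set ℕ := ![![∅, Set.Icc i k, {i, j}, Set.Iic i ∪ Set.Icc l n],
    ![∅, ∅, Set.Icc k j, {k, l}], ![∅, ∅, ∅, Set.Icc j l], ![∅, ∅, ∅, ∅]]
  let M : Fin 4 → Fin 4 → Set (β ⊕ Graph α β) :=
    ![![∅, (fun m => Sum.inl (ε m)) '' Set.Ico i k, {Sum.inr D},
        insert (Sum.inl e) ((fun m => Sum.inl (ε m)) '' (Set.Iio i ∪ Set.Ico l n))],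
      ![∅, ∅, (fun m => Sum.inl (ε m)) '' Set.Ico k j, {Sum.inr D'}],
      ![∅, ∅, ∅, (fun m => Sum.inl (ε m)) '' Set.Ico j l], ![∅, ∅, ∅, ∅]]
  have hpath : ∀ p q, p < q → K.IsPath (v (t p)) (v (t q)) (v '' N p q) (M p q) := by
    intro p q hpq
    fin_cases p <;> fin_cases q <;> first | exact absurd hpq (by decide) | skip
    · exact (hcyc'.arc hik.le (by omega)).mono hCK
    · have := hedge hlK (reduced_isLink_inr.1 hl).2.1
      rw [← Set.image_pair] at this
      exact this
    · exact (hcyc'.outer_arc ((hik.trans hkj).trans hjl) hln).mono hCK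
    · exact (hcyc'.arc hkj.le (by omega)).mono hCK
    · have := hedge hlK' (reduced_isLink_inr.1 hl').2.1
      rw [← Set.image_pair] at this
      exact this
    · exact (hcyc'.arc hjl.le (by omega)).mono hCK
  have hNn : ∀ p q m, m ∈ N p q → m ≤ n := by
    intro p q m
    fin_cases p <;> fin_cases q <;> simp [N] <;> omega
  have hNint : ∀ p q r s m, p < q → r < s → (p, q) ≠ (r, s) → m ∈ N p q → m ∈ N r s →
      (m = t p ∨ m = t q) ∧ (m = t r ∨ m = t s) := by
    intro p q r s m hpq hrs
    fin_cases p <;> fin_cases q <;> first | exact absurd hpq (by decide) | skip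
    all_goals
      fin_cases r <;> fin_cases s <;> first | exact absurd hrs (by decide) | skip
    all_goals
      simp [N, t]
    all_goals omega
  have hex : ∀ p q, ∃ P : K.VPath, p < q → P.first = v (t p) ∧ P.last = v (t q) ∧
      V(P.toGraph) = v '' N p q ∧ E(P.toGraph) = M p q := by
    intro p q
    by_cases hpq : p < q
    · obtain ⟨P, hP⟩ := (hpath p q hpq).exists_vPath
      exact ⟨P, fun _ => hP⟩
    · obtain ⟨P, -⟩ := (hpath 0 1 (by decide)).exists_vPath
      exact ⟨P, fun h => absurd h hpq⟩
  choose P hP using hex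
  have htn : ∀ p, t p ≤ n := by
    intro p
    fin_cases p <;> simp [t] <;> omega
  have ht : Function.Injective t := by
    intro p q
    fin_cases p <;> fin_cases q <;> simp [t] <;> omega
  refine ⟨K, hKR, hKV, hKE, fun p => v (t p), P, ?_, ?_, ?_, ?_, ?_⟩
  · intro p q hpq
    exact ht (hcyc.v_inj (htn p) (htn q) hpq)
  · intro p q hpq
    exact ⟨(hP p q hpq).1, (hP p q hpq).2.1⟩
  · intro p q r s hpq hrs hne
    rw [(hP p q hpq).2.2.1, (hP r s hrs).2.2.1]
    rintro _ ⟨⟨m, hm, rfl⟩, m', hm', hmm⟩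
    obtain rfl := hcyc.v_inj (hNn _ _ _ hm') (hNn _ _ _ hm) hmm
    obtain ⟨h1, h2⟩ := hNint p q r s m' hpq hrs hne hm hm'
    exact ⟨h1.imp (congrArg v) (congrArg v), h2.imp (congrArg v) (congrArg v)⟩
  · intro x hx
    rw [hKV] at hx
    obtain ⟨m, hm, rfl⟩ := hcyc.exists_index hx
    have hall : m ∈ N 0 3 ∨ m ∈ N 0 1 ∨ m ∈ N 1 2 ∨ m ∈ N 2 3 := by
      simp [N]; omega
    have fin : ∀ p q, p < q → m ∈ N p q → ∃ p q, p < q ∧ v m ∈ V((P p q).toGraph) := by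
      intro p q hpq h
      exact ⟨p, q, hpq, by rw [(hP p q hpq).2.2.1]; exact ⟨m, h, rfl⟩⟩
    rcases hall with h | h | h | h
    exacts [fin _ _ (by decide) h, fin _ _ (by decide) h, fin _ _ (by decide) h,
      fin _ _ (by decide) h]
  · intro f hf
    have fin : ∀ p q, p < q → f ∈ M p q → ∃ p q, p < q ∧ f ∈ E((P p q).toGraph) := by
      intro p q hpq h
      exact ⟨p, q, hpq, by rw [(hP p q hpq).2.2.2]; exact h⟩
    rw [hKE] at hf
    rcases hf with hf | rfl | rfl
    · rw [hcyc'.edgeSet_eq] at hf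
      rcases hf with rfl | ⟨m, hm, rfl⟩
      · exact fin 0 3 (by decide) (Or.inl rfl)
      · simp only [Set.mem_Iio] at hm
        rcases lt_or_ge m i with h1 | h1
        · exact fin 0 3 (by decide) (Or.inr ⟨m, Or.inl h1, rfl⟩)
        rcases lt_or_ge m k with h2 | h2
        · exact fin 0 1 (by decide) ⟨m, ⟨h1, h2⟩, rfl⟩
        rcases lt_or_ge m j with h3 | h3
        · exact fin 1 2 (by decide) ⟨m, ⟨h2, h3⟩, rfl⟩
        rcases lt_or_ge m l with h4 | h4
        · exact fin 2 3 (by decide) ⟨m, ⟨h3, h4⟩, rfl⟩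
        · exact fin 0 3 (by decide) (Or.inr ⟨m, Or.inr ⟨h4, hm⟩, rfl⟩)
    · exact fin 0 2 (by decide) rfl
    · exact fin 1 3 (by decide) rfl

/-! ### Layered graphs -/

theorem IsNested.isLayered (hN : B.IsNested C n v) (hcyc : C.IsCyc e n v ε)
    (hex : ∃ D, B.IsBridge C D) : B.IsLayered C := by
  refine ⟨fun D hD => ?_, fun c₁ c₂ h₁ h₂ => ?_, ?_⟩
  · obtain ⟨i, j, h⟩ := hN.1 D hD
    exact h.encard_attachments hcyc
  · obtain ⟨D, i, j, rfl, h⟩ := exists_span_of_isChord hcyc h₁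
    obtain ⟨D', k, l, rfl, h'⟩ := exists_span_of_isChord hcyc h₂
    rcases hN.2 _ _ _ _ _ _ h h' with ⟨h3, h4⟩ | ⟨h3, h4⟩
    · exact h.not_chordsCross hcyc h' h3 h4
    · exact fun hc => h'.not_chordsCross hcyc h h3 h4 hc.symm
  · obtain ⟨a, b, Hin, Hout, -, -, hH, hne, -, -⟩ := hN.exists_handles hcyc hex
    rw [show {H | (B.reduced C).IsHandle C.circleInReduced H} = {Hin, Hout} from Set.ext hH]
    exact Set.encard_pair hne

theorem IsLayered.isNested (hL : B.IsLayered C) (hcyc : C.IsCyc e n v ε)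
    (he : ∃ H, B.IsReducedHandle C H ∧ Sum.inl e ∈ E(H)) : B.IsNested C n v := by
  refine isNested_of_handles hcyc (fun D hD => hcyc.exists_span hD (hL.1 D hD)) ?_ hL.2.2 he
  rintro D D' i j k l h h' ⟨h1, h2, h3⟩
  exact hL.2.1 _ _ (h.isChord hcyc) (h'.isChord hcyc) (h.chordsCross hcyc h' h1 h2 h3)

end

section

/-! ### Balancing edges and negative bridge paths -/

variable {α β : Type*} {B C D G Z : Graph α β} {σ : β → ℤˣ} {X X' : Set α} {F F' : Set β} {x y : α}
  {e : β} {n : ℕ} {v : ℕ → α} {ε : ℕ → β}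

/-- A function on the vertices of a numbered circle may be prescribed by index. -/
theorem IsCyc.exists_vertexFunction (hcyc : C.IsCyc e n v ε) (g : ℕ → ℤˣ) :
    ∃ ζ : α → ℤˣ, ∀ i ≤ n, ζ (v i) = g i := by
  refine ⟨fun x => g (Function.invFunOn v (Set.Iic n) x), fun i hi => ?_⟩
  have h : ∃ a ∈ Set.Iic n, v a = v i := ⟨i, hi, rfl⟩
  exact congrArg g (hcyc.v_inj (Function.invFunOn_mem h) hi (Function.invFunOn_eq h))

theorem IsCyc.edgeSign_outer (hcyc : C.IsCyc e n v ε) {i j : ℕ} (hij : i ≤ j) (hj : j ≤ n) :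
    edgeSign σ (insert e (ε '' (Set.Iio i ∪ Set.Ico j n))) =
      C.sign σ * (prefixSign σ ε i * prefixSign σ ε j) := by
  have hfin : (insert e (ε '' (Set.Iio i ∪ Set.Ico j n))).Finite :=
    (((Set.finite_Iio i).union (Set.finite_Ico j n)).image ε).insert e
  have hE : E(C) = insert e (ε '' (Set.Iio i ∪ Set.Ico j n)) ∪ ε '' Set.Ico i j := by
    rw [hcyc.edgeSet_eq, Set.insert_union, ← Set.image_union]
    congr 2
    ext m
    simp only [Set.mem_Iio, Set.mem_union, Set.mem_Ico]
    omega
  have hdisj : Disjoint (insert e (ε '' (Set.Iio i ∪ Set.Ico j n))) (ε '' Set.Ico i j) := by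
    rw [Set.disjoint_left]
    rintro f (rfl | ⟨m, hm, rfl⟩) ⟨k, hk, hkm⟩
    · simp only [Set.mem_Ico] at hk
      exact hcyc.ne_closing k (by omega) hkm
    · simp only [Set.mem_Ico, Set.mem_union, Set.mem_Iio] at hk hm
      have := hcyc.ε_inj (by omega) (by omega) hkm
      omega
  rw [sign_eq_edgeSign, hE, edgeSign_union hfin ((Set.finite_Ico i j).image ε) hdisj,
    hcyc.edgeSign_Ico hij hj, mul_assoc, Int.units_mul_self, mul_one]

/-- If `C` is negative and every path through a bridge forms a positive circle with the half of `C`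
containing `e`, then every edge of the arc common to all bridges is a balancing edge. -/
theorem IsNested.isBalancingEdge (hN : B.IsNested C n v) (hcyc : C.IsCyc e n v ε) (hCB : C ≤ B)
    (hB : B.IsBlock) (hloop : ∀ f x, ¬ B.IsLink f x x) (hE : E(B).Finite) (hs : C.sign σ = -1)
    {m : ℕ} (hmn : m < n) (hm : ∀ D i j, B.Span C n v D i j → i ≤ m ∧ m < j)
    (hpath : ∀ D i j X F, B.Span C n v D i j → B.IsPath (v i) (v j) X F → X ⊆ V(D) → F ⊆ E(D) →
      edgeSign σ F = -(prefixSign σ ε i * prefixSign σ ε j)) :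
    B.IsBalancingEdge σ (ε m) := by
  -- Switching along the path `C ∖ ε m` makes all its edges positive.
  obtain ⟨ζ, hζ⟩ := hcyc.exists_vertexFunction
    fun i => if i ≤ m then prefixSign σ ε i else -prefixSign σ ε i
  have hstep : ∀ i < n, ζ (v i) * σ (ε i) * ζ (v (i + 1)) = -1 ↔ i = m := by
    intro i hi
    rw [hζ i hi.le, hζ (i + 1) hi, prefixSign]
    generalize prefixSign σ ε i = p
    generalize σ (ε i) = q
    have key : ∀ p q : ℤˣ, p * q * (p * q) ≠ -1 ∧ p * q * -(p * q) = -1 ∧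
        -p * q * -(p * q) ≠ -1 := by decide
    obtain ⟨h1, h2, h3⟩ := key p q
    rcases lt_trichotomy i m with h | rfl | h
    · rw [if_pos h.le, if_pos (by omega)]
      exact iff_of_false h1 h.ne
    · rw [if_pos le_rfl, if_neg (by omega)]
      exact iff_of_true h2 rfl
    · rw [if_neg (by omega), if_neg (by omega)]
      exact iff_of_false h3 h.ne'
  have hclose : ζ (v n) * σ e * ζ (v 0) = 1 := by
    rw [hζ n le_rfl, hζ 0 (Nat.zero_le n), if_neg (by omega), if_pos (Nat.zero_le m), prefixSign,
      mul_one, neg_mul, mul_comm, ← hcyc.sign_eq, hs, neg_neg]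
  have hcomm : ∀ a b c : ℤˣ, a * b * c = c * b * a := by decide
  refine hB.isBalancingEdge hloop hCB hE (hcyc.edge_mem hmn) ζ ?_ ?_
  · intro f x y hl
    obtain ⟨k, hk, rfl⟩ := hcyc.exists_index hl.left_mem
    have hcl : ¬ ((1 : ℤˣ) = -1) := by decide
    rcases hcyc.isLink_cases hk hl with ⟨h, rfl, rfl⟩ | ⟨k, rfl, rfl, rfl⟩ | ⟨rfl, rfl, rfl⟩ |
      ⟨rfl, rfl, rfl⟩
    · rw [hstep k h]
      exact ⟨fun h => h ▸ rfl, fun h' => hcyc.ε_inj h hmn h'⟩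
    · rw [hcomm, hstep k (by omega)]
      exact ⟨fun h => h ▸ rfl, fun h' => hcyc.ε_inj (by omega) hmn h'⟩
    · rw [hclose]
      exact iff_of_false hcl (hcyc.ne_closing m hmn).symm
    · rw [hcomm, hclose]
      exact iff_of_false hcl (hcyc.ne_closing m hmn).symm
  · intro D x y X F hD hx hy hxy hP hX hF
    obtain ⟨i, j, h⟩ := hN.1 D hD
    obtain ⟨h1, h2⟩ := hm D i j h
    have hjn := h.2.2.1
    have hij : ζ (v i) * ζ (v j) = -(prefixSign σ ε i * prefixSign σ ε j) := by
      rw [hζ i (by omega), hζ j hjn, if_pos h1, if_neg (by omega), mul_neg]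
    rw [h.2.2.2] at hx hy
    rcases hx with rfl | rfl <;> rcases hy with rfl | rfl
    · exact absurd rfl hxy
    · rw [hij, hpath D i j X F h hP hX hF]
    · rw [mul_comm, hij, hpath D i j X F h hP.symm hX hF]
    · exact absurd rfl hxy

theorem Span.inter_eq {i j : ℕ} (h : B.Span C n v D i j) (hP : B.IsPath (v i) (v j) X F)
    (hX : X ⊆ V(D)) : X ∩ V(C) = {v i, v j} := by
  have hA := h.2.2.2
  refine Set.Subset.antisymm (fun a ha => hA.subset ⟨hX ha.1, ha.2⟩) ?_
  rintro a (rfl | rfl)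
  · exact ⟨hP.left_mem, (hA.symm.subset (Or.inl rfl)).2⟩
  · exact ⟨hP.right_mem, (hA.symm.subset (Or.inr rfl)).2⟩

/-- Two paths with the same ends and nothing else in common form a circle. -/
theorem IsPath.exists_circle_union (hP : G.IsPath x y X F) (hP' : G.IsPath x y X' F') (hxy : x ≠ y)
    (hX : X ∩ X' ⊆ {x, y}) (hF : Disjoint F F') :
    ∃ Z, Z ≤ G ∧ Z.IsCircle ∧ V(Z) = X ∪ X' ∧ E(Z) = F ∪ F' := by
  cases hP' with
  | nil => exact absurd rfl hxy
  | @cons g _ z _ X' F' hl hx hp =>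
    have hzx : z ≠ x := by rintro rfl; exact hx hp.left_mem
    have hQ := hp.concat hP.symm (by
      rintro a ⟨ha, ha'⟩
      rcases hX ⟨ha', Or.inr ha⟩ with rfl | h
      exacts [absurd ha hx, h])
    obtain ⟨Z, h1, h2, h3, h4⟩ := hQ.exists_circle hzx hl.symm (by
      rintro (h | h)
      · exact hx (hp.inc_mem h hl.inc_left)
      · exact Set.disjoint_left.1 hF h (Or.inl rfl))
    refine ⟨Z, h1, h2, h3.trans ?_, h4.trans ?_⟩
    · rw [Set.union_insert, Set.insert_eq_of_mem (Set.mem_union_left _ hP.left_mem), Set.union_comm]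
    · rw [Set.union_insert, Set.union_comm]

/-- A path through a bridge has the sign opposite to that of the arc avoiding `e`; if `C` is positive,
the other arc has the same sign as that one, so both halves give negative circles. -/
theorem IsSignUnique.bridgePathsNegative (hu : B.IsSignUnique σ e C) (hN : B.IsNested C n v)
    (hcyc : C.IsCyc e n v ε) (hCB : C ≤ B) (hs : C.sign σ = 1) : B.BridgePathsNegative σ C := by
  intro D hD P hPf hPl hPne Q hQf hQl
  obtain ⟨i, j, h⟩ := hN.1 D hD
  have hij := h.2.1
  have hjn := h.2.2.1
  have hP := P.isPath.mono hD.1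
  have hQ := Q.isPath
  rw [hQf, hQl] at hQ
  have hXD : V(P.toGraph) ⊆ V(D) := P.toGraph_le.1
  have hFD : E(P.toGraph) ⊆ E(D) := IsSubgraph.edgeSet_mono P.toGraph_le
  -- Reverse both paths if necessary, so that they run from `v i` to `v j`.
  obtain ⟨hP', hQ'⟩ : B.IsPath (v i) (v j) V(P.toGraph) E(P.toGraph) ∧
      C.IsPath (v i) (v j) V(Q.toGraph) E(Q.toGraph) := by
    rw [h.2.2.2] at hPf hPl
    rcases hPf with h1 | h1 <;> rcases hPl with h2 | h2
    · exact absurd (h1.trans h2.symm) hPne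
    · rw [h1, h2] at hP hQ
      exact ⟨hP, hQ⟩
    · rw [h1, h2] at hP hQ
      exact ⟨hP.symm, hQ.symm⟩
    · exact absurd (h1.trans h2.symm) hPne
  have hXC := h.inter_eq hP' hXD
  have hFC : ∀ f ∈ E(P.toGraph), f ∉ E(C) := fun f hf => hD.edge_notMem hCB (hFD hf)
  have hne : v i ≠ v j := fun hv => by
    have := hcyc.v_inj (by omega) hjn hv
    omega
  have hdisj : Disjoint E(P.toGraph) E(Q.toGraph) :=
    Set.disjoint_left.2 fun f hf hf' => hFC f hf (hQ'.subset_edgeSet hf')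
  obtain ⟨Z, hZB, hZ, hZV, hZE⟩ := hP'.exists_circle_union (hQ'.mono hCB) hne
    (fun a ha => hXC.subset ⟨ha.1, hQ'.subset_vertexSet ha.2⟩) hdisj
  refine ⟨Z, hZB, ⟨?_, ?_, hZV, hZE⟩, hZ, ?_⟩
  · exact (Compatible.of_le_le (P.toGraph_le.trans hD.1) hZB).le_iff.2
      ⟨hZV ▸ Set.subset_union_left, hZE ▸ Set.subset_union_left⟩
  · exact (Compatible.of_le_le (Q.toGraph_le.trans hCB) hZB).le_iff.2
      ⟨hZV ▸ Set.subset_union_right, hZE ▸ Set.subset_union_right⟩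
  · rw [sign_eq_edgeSign, hZE, edgeSign_union hP'.finite_edges hQ'.finite_edges hdisj,
      hu.edgeSign_jump hcyc hCB hij hjn hP' hXC hFC]
    have hQs : edgeSign σ E(Q.toGraph) = prefixSign σ ε i * prefixSign σ ε j := by
      rcases hcyc.path_eq_arc hij hjn hQ' with ⟨-, hE⟩ | ⟨-, hE⟩
      · rw [hE, hcyc.edgeSign_Ico hij.le hjn]
      · rw [hE, hcyc.edgeSign_outer hij.le hjn, hs, one_mul]
    rw [hQs, neg_mul, Int.units_mul_self]

/-! ### Reversing the sign of one edge -/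

theorem sign_update [DecidableEq β] (hZ : E(Z).Finite) (he : e ∈ E(Z)) :
    Z.sign (Function.update σ e (-σ e)) = -Z.sign σ := by
  have hins : E(Z) = insert e (E(Z) \ {e}) := by
    rw [Set.insert_sdiff_singleton, Set.insert_eq_of_mem he]
  have hrest : edgeSign (Function.update σ e (-σ e)) (E(Z) \ {e}) = edgeSign σ (E(Z) \ {e}) :=
    edgeSign_congr fun f hf => Function.update_of_ne hf.2 _ _
  rw [sign_eq_edgeSign, sign_eq_edgeSign, hins, edgeSign_insert hZ.sdiff (by simp),
    edgeSign_insert hZ.sdiff (by simp), Function.update_self, neg_mul, hrest]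

/-- Reversing the sign of `e` reverses the signs of all circles through `e`, so it interchanges the
negative and the positive case. -/
theorem isSignUnique_update_iff [DecidableEq β] (hE : E(B).Finite) (hCB : C ≤ B) (he : e ∈ E(C)) :
    B.IsSignUnique (Function.update σ e (-σ e)) e C ↔ B.IsSignUnique σ e C := by
  have hfin : ∀ Z ≤ B, E(Z).Finite := fun Z hZ => hE.subset (IsSubgraph.edgeSet_mono hZ)
  refine forall_congr' fun Z => forall_congr' fun hZ => forall_congr' fun _ =>
    forall_congr' fun heZ => forall_congr' fun _ => ?_
  rw [sign_update (hfin Z hZ) heZ, sign_update (hfin C hCB) he, neg_inj]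

theorem prefixSign_update [DecidableEq β] (hcyc : C.IsCyc e n v ε) (s : ℤˣ) {i : ℕ} (hi : i ≤ n) :
    prefixSign (Function.update σ e s) ε i = prefixSign σ ε i := by
  induction i with
  | zero => rfl
  | succ i ih =>
    rw [prefixSign, prefixSign, ih (by omega), Function.update_of_ne (hcyc.ne_closing i hi)]

/-- If every path through a bridge forms a negative circle with either half of `C`, then after
reversing the sign of `e` the edges of the arc common to all bridges are balancing edges. -/
theorem IsNested.isBalancingEdge_update [DecidableEq β] (hN : B.IsNested C n v)
    (hcyc : C.IsCyc e n v ε) (hCB : C ≤ B) (hB : B.IsBlock) (hloop : ∀ f x, ¬ B.IsLink f x x)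
    (hE : E(B).Finite) (hex : ∃ D, B.IsBridge C D) {m : ℕ} (hmn : m < n)
    (hm : ∀ D i j, B.Span C n v D i j → i ≤ m ∧ m < j) (hneg : B.BridgePathsNegative σ C) :
    B.IsBalancingEdge (Function.update σ e (-σ e)) (ε m) := by
  have hpath : ∀ D i j X F, B.Span C n v D i j → B.IsPath (v i) (v j) X F → X ⊆ V(D) →
      F ⊆ E(D) → ∀ Y K, C.IsPath (v i) (v j) Y K → edgeSign σ F * edgeSign σ K = -1 := by
    intro D i j X F h hP hX hF Y K hQ
    have hij := h.2
    obtain ⟨P, h1, h2, rfl, rfl⟩ := (hP.of_le h.1.1 hX hF).exists_vPath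
    obtain ⟨Q, h3, h4, rfl, rfl⟩ := hQ.exists_vPath
    obtain ⟨Z, -, ⟨-, -, -, hZE⟩, -, hZs⟩ := hneg D h.1 P (by rw [h1, h.2.2.2]; simp)
      (by rw [h2, h.2.2.2]; simp) (by
        rw [h1, h2]
        intro hv
        have := hcyc.v_inj (by omega) hij.2.1 hv
        omega) Q (h3.trans h1.symm) (h4.trans h2.symm)
    rwa [sign_eq_edgeSign, hZE, edgeSign_union hP.finite_edges hQ.finite_edges
      (Set.disjoint_left.2 fun f hf hf' => h.1.edge_notMem hCB (hF hf) (hQ.subset_edgeSet hf'))]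
      at hZs
  have hs : C.sign (Function.update σ e (-σ e)) = -1 := by
    rw [sign_update (hE.subset (IsSubgraph.edgeSet_mono hCB)) hcyc.closing.edge_mem]
    obtain ⟨D, hD⟩ := hex
    obtain ⟨i, j, h⟩ := hN.1 D hD
    obtain ⟨X, F, hP, -, hX, hF⟩ := h.exists_isPath hcyc
    have h1 := hpath D i j X F h hP hX hF _ _ (hcyc.arc h.2.1.le h.2.2.1)
    have h2 := hpath D i j X F h hP hX hF _ _ (hcyc.outer_arc h.2.1 h.2.2.1)
    rw [hcyc.edgeSign_Ico h.2.1.le h.2.2.1] at h1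
    rw [hcyc.edgeSign_outer h.2.1.le h.2.2.1, mul_left_comm, h1] at h2
    rw [neg_inj]
    simpa using h2
  refine hN.isBalancingEdge hcyc hCB hB hloop hE hs hmn hm fun D i j X F h hP hX hF => ?_
  have hjn := h.2.2.1
  have hij := h.2.1
  have h1 := hpath D i j X F h hP hX hF _ _ (hcyc.arc hij.le hjn)
  rw [hcyc.edgeSign_Ico hij.le hjn] at h1
  rw [prefixSign_update hcyc _ (by omega), prefixSign_update hcyc _ hjn,
    edgeSign_congr (τ := σ) fun f hf => Function.update_of_ne (by
      rintro rfl
      exact h.1.edge_notMem hCB (hF hf) hcyc.closing.edge_mem) _ _]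
  revert h1
  generalize edgeSign σ F = a
  generalize prefixSign σ ε i = b
  generalize prefixSign σ ε j = c
  revert a b c
  decide

end

end Graph

/-- `B` is the underlying graph of a finite signed graph; it is a block and not a circle. (It is not
an isthmus either, because it contains the circle `C`.) The first part is the characterization of
`e` lying in a unique signed circle `C`, the other two are its negative and positive versions. -/
theorem mainTheorem1 {α β : Type*} (B : Graph α β) (hV : V(B).Finite) (hE : E(B).Finite)
    (σ : β → ℤˣ) (hB : B.IsBlock) (hB' : ¬ B.IsCircle)
    (C : Graph α β) (hCB : C ≤ B) (hC : C.IsCircle) (e : β) (he : e ∈ E(C)) :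
    ((B.IsBatteryIn σ e C (-1) ∨ B.IsBatteryIn σ e C 1) ↔
      B.IsLayered C ∧ (∃ H, B.IsReducedHandle C H ∧ Sum.inl e ∈ E(H)) ∧
        (B.OtherHandleBalancing σ C e ∨ B.BridgePathsNegative σ C)) ∧
    (B.IsBatteryIn σ e C (-1) ↔
      B.IsLayered C ∧ (∃ H, B.IsReducedHandle C H ∧ Sum.inl e ∈ E(H)) ∧
        B.OtherHandleBalancing σ C e) ∧
    (B.IsBatteryIn σ e C 1 ↔
      B.IsLayered C ∧ (∃ H, B.IsReducedHandle C H ∧ Sum.inl e ∈ E(H)) ∧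
        B.BridgePathsNegative σ C) := by
  classical
  have hloop := hB.not_isLink_self hB'
  obtain ⟨n, v, ε, hcyc⟩ := hC.exists_isCyc (hV.subset hCB.1)
    (fun f x h => hloop f x (h.mono hCB)) he
  have hex : ∃ D, B.IsBridge C D := by
    obtain ⟨f, hf, hfC⟩ := hB.exists_edge_notMem hB' hCB hC
    obtain ⟨D, hD, -⟩ := Graph.exists_isBridge_of_mem_edgeSet hloop hf hfC
    exact ⟨D, hD⟩
  -- Layering provides the nested structure and its two handles.
  have hnest : B.IsNested C n v → ∃ a b Hin Hout, a < b ∧ b ≤ n ∧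
      (∀ m, a ≤ m → m < b → ∀ D i j, B.Span C n v D i j → i ≤ m ∧ m < j) ∧
      B.IsReducedHandle C Hin ∧ B.IsReducedHandle C Hout ∧ Hin ≠ Hout ∧
      (∀ H, B.IsReducedHandle C H → H = Hin ∨ H = Hout) ∧
      E(Hin) = (fun m => Sum.inl (ε m)) '' Set.Ico a b ∧ Sum.inl e ∈ E(Hout) := by
    intro hN
    obtain ⟨a, b, Hin, Hout, ⟨D, hD⟩, hmin, hH, hne, hEin, heout⟩ := hN.exists_handles hcyc hex
    refine ⟨a, b, Hin, Hout, hD.2.1, hD.2.2.1, fun m h1 h2 D i j h => ?_, (hH _).2 (Or.inl rfl),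
      (hH _).2 (Or.inr rfl), hne, fun H => (hH H).1, hEin, heout⟩
    have := hmin D i j h
    omega
  have hminus : B.IsBatteryIn σ e C (-1) ↔
      B.IsLayered C ∧ (∃ H, B.IsReducedHandle C H ∧ Sum.inl e ∈ E(H)) ∧
        B.OtherHandleBalancing σ C e := by
    rw [Graph.isBatteryIn_iff hCB hC he]
    constructor
    · rintro ⟨hs, hu⟩
      have hN := hu.isNested hcyc hCB hB
      obtain ⟨a, b, Hin, Hout, hab, hbn, hm, hHin, hHout, hne, -, hEin, heout⟩ := hnest hN
      refine ⟨hN.isLayered hcyc hex, ⟨Hout, hHout, heout⟩, Hout, Hin, hHout, hHin, hne.symm, heout,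
        ε a, by rw [hEin]; exact ⟨a, ⟨le_rfl, hab⟩, rfl⟩, ?_⟩
      refine hN.isBalancingEdge hcyc hCB hB hloop hE hs (by omega) (hm a le_rfl hab)
        fun D i j X F h hP hX hF => ?_
      exact hu.edgeSign_jump hcyc hCB h.2.1 h.2.2.1 hP (h.inter_eq hP hX)
        fun f hf => h.1.edge_notMem hCB (hF hf)
    · rintro ⟨hL, he', H, H', hH, hH', hHH, heH, b, hbH, hb⟩
      have hN := hL.isNested hcyc he'
      obtain ⟨a, b, Hin, Hout, hab, hbn, hm, -, -, -, hall, hEin, -⟩ := hnest hN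
      have hHin : H ≠ Hin := by
        rintro rfl
        rw [hEin] at heH
        obtain ⟨m, hm, h⟩ := heH
        simp only [Set.mem_Ico] at hm
        exact hcyc.ne_closing m (by omega) (Sum.inl_injective h)
      obtain rfl := (hall H hH).resolve_left hHin
      obtain rfl := (hall H' hH').resolve_right hHH.symm
      rw [hEin] at hbH
      obtain ⟨m, ⟨h1, h2⟩, h⟩ := hbH
      obtain rfl := Sum.inl_injective h
      exact hN.isSignUnique hcyc hCB hC hV hloop (by omega) (hm m h1 h2) hb
  have hplus : B.IsBatteryIn σ e C 1 ↔
      B.IsLayered C ∧ (∃ H, B.IsReducedHandle C H ∧ Sum.inl e ∈ E(H)) ∧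
        B.BridgePathsNegative σ C := by
    rw [Graph.isBatteryIn_iff hCB hC he]
    constructor
    · rintro ⟨hs, hu⟩
      have hN := hu.isNested hcyc hCB hB
      obtain ⟨a, b, Hin, Hout, -, -, -, -, hHout, -, -, -, heout⟩ := hnest hN
      exact ⟨hN.isLayered hcyc hex, ⟨Hout, hHout, heout⟩,
        hu.bridgePathsNegative hN hcyc hCB hs⟩
    · rintro ⟨hL, he', hneg⟩
      have hN := hL.isNested hcyc he'
      obtain ⟨a, b, Hin, Hout, hab, hbn, hm, -⟩ := hnest hN
      have hb := hN.isBalancingEdge_update hcyc hCB hB hloop hE hex (by omega) (hm a le_rfl hab)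
        hneg
      obtain ⟨hs, hu⟩ := hN.isSignUnique hcyc hCB hC hV hloop (by omega) (hm a le_rfl hab) hb
      rw [Graph.sign_update (hE.subset (Graph.IsSubgraph.edgeSet_mono hCB)) he, neg_inj] at hs
      exact ⟨hs, (Graph.isSignUnique_update_iff hE hCB he).1 hu⟩
  refine ⟨?_, hminus, hplus⟩
  rw [hminus, hplus, ← and_or_left, ← and_or_left]
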